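/- **Setting.** Let $n\ge 0$, $X=\mathbb R^{2n}/\mathbb Z^{2n}$ with coordinates $(x,y)$, $x,y\in\mathbb R^n$, and symplectic form $\omega=\sum_i dy^i\wedge dx^i$, also written $\omega(u,v)=\sum_i(u_{n+i}v_i-u_iv_{n+i})$. Let $\mathcal P^T$ and $\mathcal P^{\check T}$ be the real polarizations spanned by the $\partial_{x^i}$, respectively by the $\partial_{y^i}$. For an integer $k\ge1$ put $\hbar=1/k$. Smooth sections of the prequantum bundle $L^{\otimes k}$ are the smooth functions $s$ on $\mathbb R^{2n}$ with $s(u+\lambda)=(-1)^{k\sum_i\lambda_i\lambda_{n+i}}e^{-k\pi\sqrt{-1}\,\omega(u,\lambda)}s(u)$ for $\lambda\in\mathbb Z^{2n}$, with $\langle s,s'\rangle_{L^2}=\int_{[0,1]^{2n}}s\,\overline{s'}$ and connection $\nabla=d-k\pi\sqrt{-1}\sum_i(y^i\,dx^i-x^i\,dy^i)$. A distributional section $s$ is a continuous antilinear functional $\tau\mapsto\langle s,\tau\rangle$ on smooth sections; $\langle fs,\tau\rangle=\langle s,\bar f\tau\rangle$ for $f\in C^\infty(X,\mathbb C)$, and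 $\langle\nabla_v s,\tau\rangle=-\langle s,\nabla_v\tau\rangle$ for constant real $v$. **Quantum spaces.** $\mathcal H^\hbar$ (resp. $\check{\mathcal H}^\hbar$) is the space of distributional sections of $L^{\otimes k}$ that are covariantly constant along $\mathcal P^T$ (resp. $\mathcal P^{\check T}$), tensored with a fixed half-form $\rho$ (resp. $\check\rho$), where $\langle\rho,\check\rho\rangle=(2^nk^{-n})^{1/2}$. For $m\in(\mathbb Z/k)^n$, with a representative in $\mathbb Z^n$ denoted by the same letter, put $$\langle\vartheta^m,\tau\rangle=(2k)^{-n/2}\int_{[0,1]^n}e^{\pi\sqrt{-1}\,m\cdot x}\,\overline{\tau(x,\tfrac mk)}\,dx,$$ $$\langle\check\vartheta^m,\tau\rangle=2^{-n/2}k^{-n}\sum_{j\in(\mathbb Z/k)^n}e^{2\pi\sqrt{-1}\,m\cdot j/k}\int_{[0,1]^n}e^{-\pi\sqrt{-1}\,j\cdot y}\,\overline{\tau(\tfrac jk,y)}\,dy,$$ and $\sigma^m=2^{n/4}k^{n/2}\vartheta^m\otimes\rho\in\mathcal H^\hbar$, $\check\sigma^m=2^{n/4}k^{n/2}\check\vartheta^m\otimes\check\rho\in\check{\mathcal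 H}^\hbar$. **Toeplitz-type operators.** Two distributional sections $s,s'$ have the pairing $\langle s,s'\rangle$ if for all $\chi,\chi'\in C_c^\infty(\mathbb R^{2n},\mathbb C)$ with $\sum_{\lambda\in\mathbb Z^{2n}}(\chi\overline{\chi'})(u+\lambda)=1$ for every $u$, the integral $\int_{\mathbb R^{2n}}\widehat{\chi s}\;\overline{\widehat{\chi's'}}$ of the Fourier transforms of the localized distributions converges absolutely, to the value $\langle s,s'\rangle$ (this extends the $L^2$ product of smooth sections to sections with disjoint wavefront sets). Put $\langle s\otimes\rho,s'\otimes\check\rho\rangle=\langle s,s'\rangle\langle\rho,\check\rho\rangle$. With the distributional kernel $K^\hbar=\sum_m\check\sigma^m\otimes\sigma^m$, let $$\Pi^\hbar s=\sum_m\langle s,\check\sigma^m\rangle\,\sigma^m,\qquad Q^\hbar_fs=\Pi^\hbar(fs)\quad(f\in C^\infty(X,\mathbb C),\ s\in\mathcal H^\hbar).$$ **Inner product.** For $0<r<1$ let $\vartheta^m_r(x,y)=(1-r)^{-n/2}e^{-k\pi\sqrt{-1}\,x\cdot y}\sum_{p\in m+k\mathbb Z^n}e^{-k\pi\frac{1+r}{1-r}|y-p/k|^2}e^{2\pi\sqrt{-1}\,p\cdot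 x}$, the theta functions spanning the quantum space at the point $-rI_n$ of the Siegel disc. The inner product of $\mathcal H^\hbar$ is the boundary value of the half-form corrected (Blattner–Kostant–Sternberg) product: $$\langle\sigma^m,\sigma^{m'}\rangle=\lim_{r\to1^-}2^{n/2}k^n\Big(\frac{1-r^2}{k}\Big)^{n/2}\langle\vartheta^m_r,\vartheta^{m'}_r\rangle_{L^2}.$$ Let $\lVert\cdot\rVert$ be the operator norm on $\operatorname{End}_{\mathbb C}\mathcal H^\hbar$ for this inner product. **Star product.** For $f,g\in C^\infty(X,\mathbb C)$ let $f\star_Ng=\sum_{j=0}^N\hbar^jC_j(f,g)$, where $$C_j(f,g)=\frac1{j!\,(2\pi\sqrt{-1})^j}\sum_{i_1,\dots,i_j=1}^n\frac{\partial^jf}{\partial y^{i_1}\cdots\partial y^{i_j}}\,\frac{\partial^jg}{\partial x^{i_1}\cdots\partial x^{i_j}}=\frac1{(2\pi\sqrt{-1})^j}\sum_{|I|=j}\frac1{I!}\,\frac{\partial^jf}{\partial y^I}\,\frac{\partial^jg}{\partial x^I}.$$ **Theorem.** The pairings above are defined, and $Q^\hbar_f$ is a well-defined linear operator on $\mathcal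 H^\hbar$ for all $k\ge1$ and $f\in C^\infty(X,\mathbb C)$; the inner product is well defined. For all $f,g\in C^\infty(X,\mathbb C)$ and every integer $N\ge0$ there is $K_N(f,g)>0$ such that for all integers $k\ge1$, with $\hbar=1/k$, $$\big\lVert Q^\hbar_f\circ Q^\hbar_g-Q^\hbar_{f\star_Ng}\big\rVert\le K_N(f,g)\,\hbar^{N+1}.$$ -/

import Mathlib

set_option maxSynthPendingDepth 3

open scoped ContDiff

noncomputable section

namespace RealToeplitz

/-! ## The torus, its functions and the star product -/

/-- The universal cover `ℝ²ⁿ` of the torus `X = ℝ²ⁿ/ℤ²ⁿ`; a point is `u = (x, y)`. -/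
abbrev Vec (n : ℕ) : Type := (Fin n → ℝ) × (Fin n → ℝ)

/-- The lattice `ℤ²ⁿ`. -/
abbrev Lat (n : ℕ) : Type := (Fin n → ℤ) × (Fin n → ℤ)

/-- The inclusion of the lattice `ℤ²ⁿ` in `ℝ²ⁿ`. -/
def latVec {n : ℕ} (l : Lat n) : Vec n := (fun i => (l.1 i : ℝ), fun i => (l.2 i : ℝ))

lemma latVec_add {n : ℕ} (l l' : Lat n) : latVec (l + l') = latVec l + latVec l' := by
  ext i <;> simp [latVec]

/-- `C^∞(X, ℂ)`, as the space of smooth `ℤ²ⁿ`-periodic functions on `ℝ²ⁿ`. -/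
def smoothTorus (n : ℕ) : Submodule ℂ (Vec n → ℂ) where
  carrier := {f | ContDiff ℝ ∞ f ∧ ∀ (u : Vec n) (l : Lat n), f (u + latVec l) = f u}
  add_mem' := by
    rintro f g ⟨hf, hf'⟩ ⟨hg, hg'⟩
    exact ⟨hf.add hg, fun u l => by simp [hf', hg']⟩
  zero_mem' := ⟨contDiff_const, fun _ _ => rfl⟩
  smul_mem' := by
    rintro c f ⟨hf, hf'⟩
    exact ⟨contDiff_const.smul hf, fun u l => by simp [hf']⟩

/-- The coordinate vector field `∂/∂xⁱ`. -/
def ex {n : ℕ} (i : Fin n) : Vec n := (Pi.single i 1, 0)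

/-- The coordinate vector field `∂/∂yⁱ`. -/
def ey {n : ℕ} (i : Fin n) : Vec n := (0, Pi.single i 1)

/-- The iterated partial derivative `∂_{v 0} ⋯ ∂_{v (j-1)} f` of a smooth function on `X`. -/
def partials {n j : ℕ} (v : Fin j → Vec n) (f : smoothTorus n) : smoothTorus n :=
  ⟨fun u => iteratedFDeriv ℝ j f.1 u v, by
    refine ⟨?_, fun u l => ?_⟩
    · have h : ContDiff ℝ ∞ (iteratedFDeriv ℝ j f.1) :=
        f.2.1.iteratedFDeriv_right (by exact_mod_cast le_top)
      exact (ContinuousMultilinearMap.apply ℝ (fun _ : Fin j => Vec n) ℂ v).contDiff.comp h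
    · have h : (fun z => f.1 (z + latVec l)) = f.1 := funext fun z => f.2.2 z l
      have h2 := iteratedFDeriv_comp_add_right (𝕜 := ℝ) (f := f.1) j (latVec l) u
      rw [h] at h2
      exact congrArg (fun T => T v) h2.symm⟩

/-- The pointwise product of two smooth functions on `X`. -/
def torusMul {n : ℕ} (f g : smoothTorus n) : smoothTorus n :=
  ⟨fun u => f.1 u * g.1 u, f.2.1.mul g.2.1, fun u l => by simp [f.2.2 u l, g.2.2 u l]⟩

/-- The bidifferential operator
`C_j(f,g) = (1 / (j! (2πi)^j)) ∑_{i₁,…,i_j} (∂^j f/∂y^{i₁}⋯∂y^{i_j}) (∂^j g/∂x^{i₁}⋯∂x^{i_j})`. -/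
def starTerm {n : ℕ} (j : ℕ) (f g : smoothTorus n) : smoothTorus n :=
  (1 / ((j.factorial : ℂ) * (2 * Real.pi * Complex.I) ^ j)) •
    ∑ i : Fin j → Fin n, torusMul (partials (fun l => ey (i l)) f) (partials (fun l => ex (i l)) g)

/-- The truncated star product `f ⋆_N g = ∑_{j ≤ N} ħ^j C_j(f,g)`. -/
def starTrunc {n : ℕ} (N : ℕ) (hbar : ℝ) (f g : smoothTorus n) : smoothTorus n :=
  ∑ j ∈ Finset.range (N + 1), ((hbar : ℂ) ^ j) • starTerm j f g

/-! ## Sections of the prequantum line bundle `L^{⊗k}` -/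

/-- The symplectic form `ω = ∑ dyⁱ ∧ dxⁱ` as a bilinear form. -/
def omega {n : ℕ} (u v : Vec n) : ℝ := ∑ i, (u.2 i * v.1 i - u.1 i * v.2 i)

lemma omega_add_left {n : ℕ} (u u' v : Vec n) : omega (u + u') v = omega u v + omega u' v := by
  simp only [omega, ← Finset.sum_add_distrib]
  exact Finset.sum_congr rfl fun i _ => by simp; ring

lemma omega_smul_left {n : ℕ} (c : ℝ) (u v : Vec n) : omega (c • u) v = c * omega u v := by
  simp only [omega, Finset.mul_sum]
  exact Finset.sum_congr rfl fun i _ => by simp; ring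

lemma omega_add_right {n : ℕ} (u v v' : Vec n) : omega u (v + v') = omega u v + omega u v' := by
  simp only [omega, ← Finset.sum_add_distrib]
  exact Finset.sum_congr rfl fun i _ => by simp; ring

lemma omega_antisymm {n : ℕ} (u v : Vec n) : omega u v = -omega v u := by
  simp only [omega, ← Finset.sum_neg_distrib]
  exact Finset.sum_congr rfl fun i _ => by ring

/-- The multiplier `α(λ)^k e^{-kπi ω(u,λ)}`, where `α(λ) = (-1)^{∑ λ_i λ_{n+i}}`. -/
def multiplier {n : ℕ} (k : ℕ) (u : Vec n) (l : Lat n) : ℂ :=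
  ((-1 : ℂ) ^ (∑ i, l.1 i * l.2 i)) ^ k *
    Complex.exp (-(k * Real.pi * Complex.I * (omega u (latVec l) : ℝ)))

/-- `Γ^∞(X, L^{⊗k})`, as the space of smooth quasi-periodic functions on `ℝ²ⁿ`. -/
def smoothSection (n k : ℕ) : Submodule ℂ (Vec n → ℂ) where
  carrier := {s | ContDiff ℝ ∞ s ∧
    ∀ (u : Vec n) (l : Lat n), s (u + latVec l) = multiplier k u l * s u}
  add_mem' := by
    rintro f g ⟨hf, hf'⟩ ⟨hg, hg'⟩
    exact ⟨hf.add hg, fun u l => by simp [hf', hg']; ring⟩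
  zero_mem' := ⟨contDiff_const, fun _ _ => by simp⟩
  smul_mem' := by
    rintro c f ⟨hf, hf'⟩
    exact ⟨contDiff_const.smul hf, fun u l => by simp [hf']; ring⟩

/-- The section `f̄ τ`, for a smooth function `f` and a smooth section `τ`. -/
def conjMul {n k : ℕ} (f : smoothTorus n) (t : smoothSection n k) : smoothSection n k :=
  ⟨fun u => starRingEnd ℂ (f.1 u) * t.1 u,
    (Complex.conjCLE.contDiff.comp f.2.1).mul t.2.1,
    fun u l => by simp only [f.2.2 u l, t.2.2 u l]; ring⟩

/-- The covariant derivative `∇_v` along a constant real vector field `v`, for the connection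
`d - kπi ∑ (yⁱ dxⁱ - xⁱ dyⁱ)` on `L^{⊗k}`; the value of `∑ (yⁱ dxⁱ - xⁱ dyⁱ)` on `v` at the
point `u = (x, y)` is `ω(u,v)`. -/
def nablaFun {n : ℕ} (k : ℕ) (v : Vec n) (t : Vec n → ℂ) (u : Vec n) : ℂ :=
  fderiv ℝ t u v - k * Real.pi * Complex.I * (omega u v : ℝ) * t u

lemma contDiff_omega_left {n : ℕ} (v : Vec n) : ContDiff ℝ ∞ (fun u : Vec n => omega u v) := by
  unfold omega
  fun_prop

lemma hasFDerivAt_omega {n : ℕ} (u v : Vec n) :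
    ∃ D : Vec n →L[ℝ] ℝ, HasFDerivAt (fun u : Vec n => omega u v) D u ∧
      ∀ w, D w = omega w v := by
  let A : Vec n →ₗ[ℝ] ℝ :=
    { toFun := fun u => omega u v
      map_add' := fun a b => omega_add_left a b v
      map_smul' := fun c a => by simp [omega_smul_left] }
  exact ⟨A.toContinuousLinearMap, A.toContinuousLinearMap.hasFDerivAt, fun w => rfl⟩

lemma hasFDerivAt_multiplier {n : ℕ} (k : ℕ) (u : Vec n) (l : Lat n) :
    ∃ D : Vec n →L[ℝ] ℂ, HasFDerivAt (fun u : Vec n => multiplier k u l) D u ∧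
      ∀ w, D w = -(k * Real.pi * Complex.I * (omega w (latVec l) : ℝ)) * multiplier k u l := by
  obtain ⟨D, hD, hw⟩ := hasFDerivAt_omega u (latVec l)
  have h1 := (Complex.ofRealCLM.hasFDerivAt (x := omega u (latVec l))).comp u hD
  have h2 := ((h1.const_mul (k * Real.pi * Complex.I : ℂ)).neg.cexp).const_mul
    (((-1 : ℂ) ^ (∑ i, l.1 i * l.2 i)) ^ k)
  refine ⟨_, h2, fun w => ?_⟩
  simp [multiplier, hw]
  ring

lemma contDiff_multiplier {n : ℕ} (k : ℕ) (l : Lat n) :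
    ContDiff ℝ ∞ (fun u : Vec n => multiplier k u l) := by
  unfold multiplier
  exact contDiff_const.mul
    ((contDiff_const.mul (Complex.ofRealCLM.contDiff.comp (contDiff_omega_left _))).neg.cexp)

/-- The covariant derivative `∇_v` on smooth sections of `L^{⊗k}`. -/
def nabla {n k : ℕ} (v : Vec n) (t : smoothSection n k) : smoothSection n k :=
  ⟨nablaFun k v t.1, by
    refine ⟨?_, fun u l => ?_⟩
    · have h1 : ContDiff ℝ ∞ (fun u => fderiv ℝ t.1 u v) :=
        (t.2.1.fderiv_right (m := ∞) (by exact_mod_cast le_top)).clm_apply contDiff_const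
      exact h1.sub ((contDiff_const.mul
        (Complex.ofRealCLM.contDiff.comp (contDiff_omega_left v))).mul t.2.1)
    · obtain ⟨D, hD, hw⟩ := hasFDerivAt_multiplier k u l
      have hdiff : Differentiable ℝ t.1 := t.2.1.differentiable (by simp)
      have h1 : HasFDerivAt (fun z => t.1 (z + latVec l)) (fderiv ℝ t.1 (u + latVec l)) u :=
        (hasFDerivAt_comp_add_right (latVec l)).2 (hdiff _).hasFDerivAt
      have h2 := hD.mul (hdiff u).hasFDerivAt
      have h3 : (fun z => t.1 (z + latVec l)) = fun z => multiplier k z l * t.1 z :=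
        funext fun z => t.2.2 z l
      rw [h3] at h1
      have h4 := congrArg (fun T : Vec n →L[ℝ] ℂ => T v) (h1.unique h2)
      simp only [nablaFun]
      rw [h4, t.2.2 u l, omega_add_left, omega_antisymm (latVec l) v]
      simp [hw]
      ring⟩

/-! ## Distributional sections -/

/-- The unit cube `[0,1]ⁿ`. -/
def cube (n : ℕ) : Set (Fin n → ℝ) := Set.Icc 0 1

/-- `Γ^{-∞}(X, L^{⊗k})`. A distributional section `s` is encoded by the antilinear functional
`τ ↦ ⟨s, τ⟩ = s(τ̄)` on smooth sections of `L^{⊗k}`, continuous for the `C^∞` topology, which is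
defined by the suprema of the derivatives over a fundamental domain. -/
def distSection (n k : ℕ) : Submodule ℂ (smoothSection n k →ₛₗ[starRingEnd ℂ] ℂ) where
  carrier := {s | ∃ (N : ℕ) (C : ℝ), ∀ (t : smoothSection n k) (M : ℝ),
    (∀ j ≤ N, ∀ u ∈ cube n ×ˢ cube n, ‖iteratedFDeriv ℝ j t.1 u‖ ≤ M) → ‖s t‖ ≤ C * M}
  add_mem' := by
    rintro s s' ⟨N, C, h⟩ ⟨N', C', h'⟩
    refine ⟨max N N', C + C', fun t M hM => ?_⟩
    have h1 := h t M fun j hj => hM j (hj.trans (le_max_left _ _))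
    have h2 := h' t M fun j hj => hM j (hj.trans (le_max_right _ _))
    calc ‖s t + s' t‖ ≤ ‖s t‖ + ‖s' t‖ := norm_add_le _ _
      _ ≤ (C + C') * M := by linarith
  zero_mem' := ⟨0, 0, fun t M _ => by simp⟩
  smul_mem' := by
    rintro c s ⟨N, C, h⟩
    refine ⟨N, ‖c‖ * C, fun t M hM => ?_⟩
    have h1 := h t M hM
    calc ‖c • s t‖ = ‖c‖ * ‖s t‖ := norm_smul _ _
      _ ≤ ‖c‖ * (C * M) := by gcongr
      _ = ‖c‖ * C * M := by ring

lemma isCompact_box (n : ℕ) : IsCompact (cube n ×ˢ cube n) := isCompact_Icc.prod isCompact_Icc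

/-- Multiplication of a distributional section by a smooth function: `⟨f s, τ⟩ = ⟨s, f̄ τ⟩`. -/
def distMul {n k : ℕ} (f : smoothTorus n) (s : distSection n k) : distSection n k :=
  ⟨{ toFun := fun t => s.1 (conjMul f t)
     map_add' := fun t t' => by
       rw [← map_add]; congr 1; ext u; simp [conjMul, mul_add]
     map_smul' := fun c t => by
       rw [← map_smulₛₗ]; congr 1; ext u; simp [conjMul]; ring }, by
    obtain ⟨N, C, h⟩ := s.2
    have hfc : ContDiff ℝ ∞ (fun u => starRingEnd ℂ (f.1 u)) :=
      Complex.conjCLE.contDiff.comp f.2.1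
    have hB : ∀ j : ℕ, ∃ B : ℝ, 0 ≤ B ∧ ∀ u ∈ cube n ×ˢ cube n,
        ‖iteratedFDeriv ℝ j (fun u => starRingEnd ℂ (f.1 u)) u‖ ≤ B := by
      intro j
      obtain ⟨B, hB⟩ := (isCompact_box n).exists_bound_of_continuousOn
        (hfc.continuous_iteratedFDeriv (m := j) (by exact_mod_cast le_top)).continuousOn
      exact ⟨max B 0, le_max_right _ _, fun u hu => (hB u hu).trans (le_max_left _ _)⟩
    choose B hB0 hB using hB
    let E : ℝ := ∑ j ∈ Finset.range (N + 1), ∑ i ∈ Finset.range (j + 1), (j.choose i : ℝ) * B i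
    refine ⟨N, C * E, fun t M hM => ?_⟩
    have h0 : (0 : Vec n) ∈ cube n ×ˢ cube n := by
      constructor <;> simp [cube]
    have hM0 : 0 ≤ M := (norm_nonneg _).trans (hM 0 (Nat.zero_le _) 0 h0)
    have key := h (conjMul f t) (E * M) fun j hj u hu => ?_
    · calc _ ≤ _ := key
        _ = _ := by ring
    · have h1 := norm_iteratedFDeriv_mul_le (N := ∞) hfc t.2.1 u (n := j)
        (by exact_mod_cast le_top)
      refine h1.trans ?_
      calc _ ≤ ∑ i ∈ Finset.range (j + 1), (j.choose i : ℝ) * B i * M := by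
            refine Finset.sum_le_sum fun i hi => ?_
            have := hB i u hu
            have := hM (j - i) ((Nat.sub_le _ _).trans hj) u hu
            have := hB0 i
            gcongr
        _ = (∑ i ∈ Finset.range (j + 1), (j.choose i : ℝ) * B i) * M := by rw [Finset.sum_mul]
        _ ≤ E * M := by
            refine mul_le_mul_of_nonneg_right ?_ hM0
            refine Finset.single_le_sum
              (f := fun j => ∑ i ∈ Finset.range (j + 1), (j.choose i : ℝ) * B i)
              (fun a _ => Finset.sum_nonneg fun i _ => mul_nonneg (by positivity) (hB0 i))
              (Finset.mem_range.2 (by omega))⟩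

/-- The polarization `P^T = ker dμ̌`, where `μ̌(x,y) = y`; it is translation invariant, and
is given by its real constant vector fields, whose complex smooth combinations are
all its sections. -/
def polT (n : ℕ) : Submodule ℝ (Vec n) :=
  LinearMap.ker (LinearMap.snd ℝ (Fin n → ℝ) (Fin n → ℝ))

/-- The polarization `P^Ť = ker dμ`, where `μ(x,y) = x`. -/
def polTcheck (n : ℕ) : Submodule ℝ (Vec n) :=
  LinearMap.ker (LinearMap.fst ℝ (Fin n → ℝ) (Fin n → ℝ))

/-- The distributional sections `s` of `L^{⊗k}` with `∇_v s = 0` for all `v` in the polarization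
`P`, where `⟨∇_v s, τ⟩ = -⟨s, ∇_v τ⟩` (constant fields are divergence free). -/
def polarized {n : ℕ} (k : ℕ) (P : Submodule ℝ (Vec n)) : Submodule ℂ (distSection n k) where
  carrier := {s | ∀ v ∈ P, ∀ t : smoothSection n k, -s.1 (nabla v t) = 0}
  add_mem' := by
    intro s s' h h' v hv t
    have h1 := h v hv t
    have h2 := h' v hv t
    simp only [neg_eq_zero] at h1 h2 ⊢
    simp [h1, h2]
  zero_mem' := fun v _ t => by simp
  smul_mem' := by
    intro c s h v hv t
    have h1 := h v hv t
    simp only [neg_eq_zero] at h1 ⊢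
    simp [h1]

/-- The quantum Hilbert space `H^ħ`, `ħ = 1/k`, in the polarization `P^T`. A quantum state
`s ⊗ ρ`, with `ρ = √(dⁿ(x,y)_{-I})` the fixed half-form, is encoded by `s`. -/
abbrev quantumSpace (n k : ℕ) : Type := polarized k (polT n)

/-- The quantum Hilbert space `Ȟ^ħ` in the polarization `P^Ť`. A quantum state `s ⊗ ρ̌`, with
`ρ̌ = √(dⁿ(x,y)_I)` the fixed half-form, is encoded by `s`. -/
abbrev quantumSpaceCheck (n k : ℕ) : Type := polarized k (polTcheck n)

/-! ## Bohr-Sommerfeld bases -/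

/-- The point `m/k` of `[0,1)ⁿ`, for `m ∈ (ℤ/k)ⁿ` (with the representative in `{0,…,k-1}ⁿ`). -/
def bsPoint {n k : ℕ} (m : Fin n → ZMod k) : Fin n → ℝ := fun i => ((m i).val : ℝ) / k

lemma bsPoint_mem {n k : ℕ} [NeZero k] (m : Fin n → ZMod k) : bsPoint m ∈ cube n := by
  have hk : (0 : ℝ) < k := by exact_mod_cast Nat.pos_of_ne_zero (NeZero.ne k)
  refine ⟨fun i => ?_, fun i => ?_⟩
  · simp only [bsPoint, Pi.zero_apply]; positivity
  · simp only [bsPoint, Pi.one_apply]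
    rw [div_le_one hk]
    exact_mod_cast (ZMod.val_lt (m i)).le

/-- The phase `e^{cπi m·x}`, for `c = ±1` and `m ∈ (ℤ/k)ⁿ` (with the same representative). -/
def phase {n k : ℕ} (c : ℤ) (m : Fin n → ZMod k) (x : Fin n → ℝ) : ℂ :=
  Complex.exp (c * Real.pi * Complex.I * ((∑ i, ((m i).val : ℝ) * x i : ℝ) : ℂ))

lemma continuous_phase {n k : ℕ} (c : ℤ) (m : Fin n → ZMod k) : Continuous (phase c m) := by
  unfold phase; fun_prop

lemma norm_phase {n k : ℕ} (c : ℤ) (m : Fin n → ZMod k) (x : Fin n → ℝ) : ‖phase c m x‖ = 1 := by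
  unfold phase
  rw [Complex.norm_exp]
  simp

/-- The continuous functional `τ ↦ ∫_{[0,1]ⁿ} w(x) conj(τ(p(x))) dx`, for a continuous weight `w`
with values in the unit circle and a continuous map `p` to the fundamental domain. -/
def cubeDist {n k : ℕ} (w : (Fin n → ℝ) → ℂ) (p : (Fin n → ℝ) → Vec n) (hw : Continuous w)
    (hw1 : ∀ x, ‖w x‖ = 1) (hp : Continuous p) (hpc : ∀ x ∈ cube n, p x ∈ cube n ×ˢ cube n) :
    distSection n k :=
  ⟨{ toFun := fun t => ∫ x in cube n, w x * starRingEnd ℂ (t.1 (p x))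
     map_add' := fun t t' => by
       have hi : ∀ t : smoothSection n k, MeasureTheory.IntegrableOn
           (fun x => w x * starRingEnd ℂ (t.1 (p x))) (cube n) := fun t =>
         ((hw.mul (Complex.continuous_conj.comp
           (t.2.1.continuous.comp hp))).continuousOn).integrableOn_compact isCompact_Icc
       rw [← MeasureTheory.integral_add (hi t) (hi t')]
       congr 1; ext x; simp [mul_add]
     map_smul' := fun c t => by
       rw [smul_eq_mul, ← MeasureTheory.integral_const_mul]
       congr 1; ext x; simp; ring }, by
    refine ⟨0, MeasureTheory.volume.real (cube n), fun t M hM => ?_⟩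
    have h := MeasureTheory.norm_setIntegral_le_of_norm_le_const (μ := MeasureTheory.volume)
      (s := cube n) (f := fun x => w x * starRingEnd ℂ (t.1 (p x))) (C := M)
      isCompact_Icc.measure_lt_top (fun x hx => by
        rw [norm_mul, hw1, one_mul, RCLike.norm_conj]
        simpa using hM 0 le_rfl (p x) (hpc x hx))
    exact h.trans_eq (mul_comm _ _)⟩

/-- The distributional section `τ ↦ ∫_{[0,1]ⁿ} e^{πi m·x} conj(τ(x, m/k)) dx`, supported on the
Bohr-Sommerfeld fibre `{y = m/k}` of `μ̌`. -/
def deltaT {n k : ℕ} [NeZero k] (m : Fin n → ZMod k) : distSection n k :=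
  cubeDist (phase 1 m) (fun x => (x, bsPoint m)) (continuous_phase 1 m) (norm_phase 1 m)
    (by fun_prop) (fun _ hx => ⟨hx, bsPoint_mem m⟩)

/-- The distributional section `τ ↦ ∫_{[0,1]ⁿ} e^{-πi m·y} conj(τ(m/k, y)) dy`, supported on the
Bohr-Sommerfeld fibre `{x = m/k}` of `μ`. -/
def deltaTcheck {n k : ℕ} [NeZero k] (m : Fin n → ZMod k) : distSection n k :=
  cubeDist (phase (-1) m) (fun y => (bsPoint m, y)) (continuous_phase (-1) m) (norm_phase (-1) m)
    (by fun_prop) (fun _ hy => ⟨bsPoint_mem m, hy⟩)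

lemma isCompact_cube (n : ℕ) : IsCompact (cube n) := isCompact_Icc

lemma integral_cube_fderiv {n : ℕ} (F : (Fin n → ℝ) → ℂ) (hF : ContDiff ℝ 1 F)
    (hper : ∀ x i, F (x + Pi.single i 1) = F x) (a : Fin n → ℝ) :
    ∫ x in cube n, fderiv ℝ F x a = 0 := by
  cases n with
  | zero =>
    have h0 : a = 0 := Subsingleton.elim _ _
    subst h0
    simp only [map_zero, MeasureTheory.integral_zero]
  | succ n =>
    have hd : Differentiable ℝ F := hF.differentiable one_ne_zero
    have hc : Continuous (fderiv ℝ F) := hF.continuous_fderiv one_ne_zero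
    have hsum : ∀ x, fderiv ℝ F x a
        = ∑ i, ((a i : ℂ) • fderiv ℝ F x) (Pi.single i 1) := fun x => by
      have ha : a = ∑ i, a i • (Pi.single i (1 : ℝ) : Fin (n + 1) → ℝ) := by
        ext j; simp [Finset.sum_apply, Pi.single_apply]
      conv_lhs => rw [ha]
      rw [map_sum]
      exact Finset.sum_congr rfl fun i _ => by rw [map_smul]; simp
    have h := MeasureTheory.integral_divergence_of_hasFDerivAt_off_countable'
      (0 : Fin (n + 1) → ℝ) 1 zero_le_one (fun i x => (a i : ℂ) * F x)
      (fun i x => (a i : ℂ) • fderiv ℝ F x) ∅ Set.countable_empty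
      (fun i => (continuous_const.mul hF.continuous).continuousOn)
      (fun x _ i => (hd x).hasFDerivAt.const_mul _)
      (by
        refine ContinuousOn.integrableOn_compact isCompact_Icc (Continuous.continuousOn ?_)
        refine continuous_finsetSum _ fun i _ => ?_
        exact (hc.clm_apply continuous_const).const_smul (a i : ℂ))
    simp only [cube, hsum]
    rw [h]
    refine Finset.sum_eq_zero fun i _ => ?_
    rw [sub_eq_zero]
    congr 1
    ext x
    have hins : i.insertNth (α := fun _ => ℝ) ((1 : Fin (n + 1) → ℝ) i) x
        = i.insertNth (α := fun _ => ℝ) ((0 : Fin (n + 1) → ℝ) i) x + Pi.single i 1 := by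
      ext j
      refine Fin.succAboveCases i ?_ (fun j => ?_) j <;> simp
    rw [hins, hper]

lemma hasFDerivAt_phase {n k : ℕ} (c : ℤ) (m : Fin n → ZMod k) (x : Fin n → ℝ) :
    ∃ D : (Fin n → ℝ) →L[ℝ] ℂ, HasFDerivAt (phase c m) D x ∧
      ∀ a, D a = c * Real.pi * Complex.I * ((∑ i, ((m i).val : ℝ) * a i : ℝ) : ℂ) * phase c m x := by
  let A : (Fin n → ℝ) →ₗ[ℝ] ℝ :=
    { toFun := fun a => ∑ i, ((m i).val : ℝ) * a i
      map_add' := fun a b => by simp [mul_add, Finset.sum_add_distrib]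
      map_smul' := fun r a => by
        simp only [Pi.smul_apply, smul_eq_mul, RingHom.id_apply, Finset.mul_sum]
        exact Finset.sum_congr rfl fun i _ => by ring }
  have h1 := (Complex.ofRealCLM.hasFDerivAt (x := A x)).comp x
    A.toContinuousLinearMap.hasFDerivAt
  have h2 := (h1.const_mul (c * Real.pi * Complex.I : ℂ)).cexp
  refine ⟨_, h2, fun a => ?_⟩
  simp [phase, A]
  ring

lemma contDiff_phase {n k : ℕ} (c : ℤ) (m : Fin n → ZMod k) : ContDiff ℝ ∞ (phase c m) := by
  unfold phase
  have h : ContDiff ℝ ∞ (fun x : Fin n → ℝ => ∑ i, ((m i).val : ℝ) * x i) :=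
    ContDiff.sum fun i _ => contDiff_const.mul (contDiff_apply ℝ ℝ i)
  exact (contDiff_const.mul (Complex.ofRealCLM.contDiff.comp h)).cexp

lemma phase_add {n k : ℕ} (c : ℤ) (m : Fin n → ZMod k) (x : Fin n → ℝ) (i : Fin n) :
    phase c m (x + Pi.single i 1)
      = Complex.exp (c * Real.pi * Complex.I * ((m i).val : ℝ)) * phase c m x := by
  have h : ∑ j, ((m j).val : ℝ) * (x + Pi.single i 1 : Fin n → ℝ) j
      = ((m i).val : ℝ) + ∑ j, ((m j).val : ℝ) * x j := by
    simp [mul_add, Finset.sum_add_distrib, Pi.single_apply, add_comm]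
  unfold phase
  rw [h, ← Complex.exp_add]
  congr 1
  push_cast
  ring

lemma deltaT_nabla {n k : ℕ} [NeZero k] (m : Fin n → ZMod k) (v : Vec n) (hv : v.2 = 0)
    (t : smoothSection n k) : (deltaT (k := k) m).1 (nabla v t) = 0 := by
  have hk : (k : ℂ) ≠ 0 := by exact_mod_cast NeZero.ne k
  have hkr : (k : ℝ) ≠ 0 := by exact_mod_cast NeZero.ne k
  let F : (Fin n → ℝ) → ℂ := fun x => phase 1 m x * starRingEnd ℂ (t.1 (x, bsPoint m))
  have hp : ContDiff ℝ ∞ (fun x : Fin n → ℝ => ((x, bsPoint m) : Vec n)) := by fun_prop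
  have hF : ContDiff ℝ ∞ F :=
    (contDiff_phase 1 m).mul (Complex.conjCLE.contDiff.comp (t.2.1.comp hp))
  have hper : ∀ x i, F (x + Pi.single i 1) = F x := by
    intro x i
    have h1 : ((x + Pi.single i 1, bsPoint m) : Vec n)
        = (x, bsPoint m) + latVec ((Pi.single i 1, 0) : Lat n) := by
      ext j
      · by_cases hj : j = i
        · subst hj; simp [latVec]
        · simp [latVec, hj]
      · simp [latVec]
    have h2 : omega ((x, bsPoint m) : Vec n) (latVec ((Pi.single i 1, 0) : Lat n))
        = ((m i).val : ℝ) / k := by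
      simp [omega, latVec, Pi.single_apply, bsPoint]
    simp only [F]
    rw [h1, t.2.2, phase_add, map_mul, multiplier, h2]
    have h3 : starRingEnd ℂ (Complex.exp
        (-(k * Real.pi * Complex.I * ((((m i).val : ℝ) / k : ℝ) : ℂ))))
        = Complex.exp (Real.pi * Complex.I * (m i).val) := by
      rw [← Complex.exp_conj]
      congr 1
      simp [-ZMod.natCast_val]
      field_simp
    have h4 : Complex.exp (Real.pi * Complex.I * (m i).val)
        * Complex.exp (Real.pi * Complex.I * (m i).val) = 1 := by
      rw [← Complex.exp_add, Complex.exp_eq_one_iff]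
      exact ⟨(m i).val, by push_cast; ring⟩
    rw [map_mul, h3]
    simp [-ZMod.natCast_val]
    linear_combination (phase 1 m x * starRingEnd ℂ (t.1 (x, bsPoint m))) * h4
  have hmain := integral_cube_fderiv F (hF.of_le (by exact_mod_cast le_top)) hper v.1
  change ∫ x in cube n, phase 1 m x * starRingEnd ℂ (nablaFun k v t.1 (x, bsPoint m)) = 0
  rw [← hmain]
  congr 1
  ext x
  obtain ⟨D, hD, hw⟩ := hasFDerivAt_phase 1 m x
  have hdt : HasFDerivAt t.1 (fderiv ℝ t.1 (x, bsPoint m)) (x, bsPoint m) :=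
    (t.2.1.differentiable (by simp) _).hasFDerivAt
  have hpx : HasFDerivAt (fun x : Fin n → ℝ => ((x, bsPoint m) : Vec n))
      (ContinuousLinearMap.inl ℝ _ _) x := hasFDerivAt_prodMk_left x (bsPoint m)
  have hc := (Complex.conjCLE.toContinuousLinearMap.hasFDerivAt).comp x (hdt.comp x hpx)
  have hFd := hD.mul hc
  have e1 : fderiv ℝ F x = _ := hFd.fderiv
  have hvv : v = (v.1, 0) := by rw [← hv]
  have e2 : omega ((x, bsPoint m) : Vec n) v = (∑ i, ((m i).val : ℝ) * v.1 i) / k := by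
    rw [hvv]
    simp only [omega, bsPoint, Finset.sum_div]
    exact Finset.sum_congr rfl fun i _ => by simp; ring
  rw [e1]
  simp only [nablaFun, e2]
  conv_lhs => rw [hvv]
  simp [hw]
  field_simp

lemma deltaTcheck_nabla {n k : ℕ} [NeZero k] (m : Fin n → ZMod k) (v : Vec n) (hv : v.1 = 0)
    (t : smoothSection n k) : (deltaTcheck (k := k) m).1 (nabla v t) = 0 := by
  have hk : (k : ℂ) ≠ 0 := by exact_mod_cast NeZero.ne k
  have hkr : (k : ℝ) ≠ 0 := by exact_mod_cast NeZero.ne k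
  let F : (Fin n → ℝ) → ℂ := fun x => phase (-1) m x * starRingEnd ℂ (t.1 (bsPoint m, x))
  have hp : ContDiff ℝ ∞ (fun x : Fin n → ℝ => ((bsPoint m, x) : Vec n)) := by fun_prop
  have hF : ContDiff ℝ ∞ F :=
    (contDiff_phase (-1) m).mul (Complex.conjCLE.contDiff.comp (t.2.1.comp hp))
  have hper : ∀ x i, F (x + Pi.single i 1) = F x := by
    intro x i
    have h1 : ((bsPoint m, x + Pi.single i 1) : Vec n)
        = (bsPoint m, x) + latVec ((0, Pi.single i 1) : Lat n) := by
      ext j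
      · simp [latVec]
      · by_cases hj : j = i
        · subst hj; simp [latVec]
        · simp [latVec, hj]
    have h2 : omega ((bsPoint m, x) : Vec n) (latVec ((0, Pi.single i 1) : Lat n))
        = -(((m i).val : ℝ) / k) := by
      simp [omega, latVec, Pi.single_apply, bsPoint]
    simp only [F]
    rw [h1, t.2.2, phase_add, map_mul, multiplier, h2]
    have h3 : starRingEnd ℂ (Complex.exp
        (-(k * Real.pi * Complex.I * ((-(((m i).val : ℝ) / k) : ℝ) : ℂ))))
        = Complex.exp (-(Real.pi * Complex.I * (m i).val)) := by
      rw [← Complex.exp_conj]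
      congr 1
      simp [-ZMod.natCast_val]
      field_simp
    have h4 : Complex.exp (-(Real.pi * Complex.I * (m i).val))
        * Complex.exp (-(Real.pi * Complex.I * (m i).val)) = 1 := by
      rw [← Complex.exp_add, Complex.exp_eq_one_iff]
      exact ⟨-(m i).val, by push_cast; ring⟩
    rw [map_mul, h3]
    simp [-ZMod.natCast_val]
    linear_combination (phase (-1) m x * starRingEnd ℂ (t.1 (bsPoint m, x))) * h4
  have hmain := integral_cube_fderiv F (hF.of_le (by exact_mod_cast le_top)) hper v.2
  change ∫ x in cube n, phase (-1) m x * starRingEnd ℂ (nablaFun k v t.1 (bsPoint m, x)) = 0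
  rw [← hmain]
  congr 1
  ext x
  obtain ⟨D, hD, hw⟩ := hasFDerivAt_phase (-1) m x
  have hdt : HasFDerivAt t.1 (fderiv ℝ t.1 (bsPoint m, x)) (bsPoint m, x) :=
    (t.2.1.differentiable (by simp) _).hasFDerivAt
  have hpx : HasFDerivAt (fun x : Fin n → ℝ => ((bsPoint m, x) : Vec n))
      (ContinuousLinearMap.inr ℝ _ _) x := hasFDerivAt_prodMk_right (bsPoint m) x
  have hc := (Complex.conjCLE.toContinuousLinearMap.hasFDerivAt).comp x (hdt.comp x hpx)
  have hFd := hD.mul hc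
  have e1 : fderiv ℝ F x = _ := hFd.fderiv
  have hvv : v = (0, v.2) := by rw [← hv]
  have e2 : omega ((bsPoint m, x) : Vec n) v = -(∑ i, ((m i).val : ℝ) * v.2 i) / k := by
    rw [hvv]
    simp only [omega, bsPoint, ← Finset.sum_neg_distrib, Finset.sum_div]
    exact Finset.sum_congr rfl fun i _ => by simp; ring
  rw [e1]
  simp only [nablaFun, e2]
  conv_lhs => rw [hvv]
  simp [hw]
  field_simp

/-- `ϑ^m = (2k)^{-n/2} δ_m` for `τ = -I`: the distributional section whose `[m']`-th Weil-Brezin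
coefficient is `δ_{m,m'} (2k)^{-n/2}` times the Dirac distribution at `0`. -/
def theta {n k : ℕ} [NeZero k] (m : Fin n → ZMod k) : distSection n k :=
  (((2 * k : ℝ) ^ (-(n : ℝ) / 2) : ℝ) : ℂ) • deltaT m

/-- The character `e^{2πi m·j/k}` of `(ℤ/k)ⁿ`. -/
def character {n k : ℕ} (m j : Fin n → ZMod k) : ℂ :=
  Complex.exp (2 * Real.pi * Complex.I * ((∑ i, ((m i).val : ℝ) * ((j i).val : ℝ) : ℝ) : ℂ) / k)

/-- `ϑ̌^m` for `τ = I`: the distributional section whose `[m']`-th Weil-Brezin coefficient is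
the constant `δ_{m,m'} 2^{-n/2}`, i.e. the quasi-periodic distribution
`2^{-n/2} e^{-kπi x·y} ∑_{p ∈ m + kℤⁿ} e^{2πi p·x}`. By Poisson summation this is
`2^{-n/2} k^{-n} ∑_j e^{2πi m·j/k} δ_{{x = j/k}}`, a sum over the Bohr-Sommerfeld fibres of `μ`. -/
def thetaCheck {n k : ℕ} [NeZero k] (m : Fin n → ZMod k) : distSection n k :=
  (((2 : ℝ) ^ (-(n : ℝ) / 2) * ((k : ℝ) ^ n)⁻¹ : ℝ) : ℂ) •
    ∑ j : Fin n → ZMod k, character m j • deltaTcheck j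

/-- The normalization factor `2^{n/4} k^{n/2}`. -/
def normFactor (n k : ℕ) : ℝ := (2 : ℝ) ^ ((n : ℝ) / 4) * (k : ℝ) ^ ((n : ℝ) / 2)

/-- The quantum states `σ^m = 2^{n/4} k^{n/2} ϑ^m ⊗ ρ` in `H^ħ`. -/
def sigma {n k : ℕ} [NeZero k] (m : Fin n → ZMod k) : quantumSpace n k :=
  (normFactor n k : ℂ) • (⟨theta m, fun v hv t => by
    have h := deltaT_nabla m v (LinearMap.mem_ker.1 hv) t
    simp [theta, h]⟩ : quantumSpace n k)

/-- The quantum states `σ̌^m = 2^{n/4} k^{n/2} ϑ̌^m ⊗ ρ̌` in `Ȟ^ħ`. -/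
def sigmaCheck {n k : ℕ} [NeZero k] (m : Fin n → ZMod k) : quantumSpaceCheck n k :=
  (normFactor n k : ℂ) • (⟨thetaCheck m, fun v hv t => by
    have h := fun j => deltaTcheck_nabla (k := k) (n := n) j v (LinearMap.mem_ker.1 hv) t
    simp [thetaCheck, h, LinearMap.sum_apply]⟩ : quantumSpaceCheck n k)

/-! ## The pairing of distributional sections with transversal wavefront sets -/

/-- `C_c^∞(ℝ²ⁿ, ℂ)`. -/
structure TestFn (n : ℕ) where
  /-- the underlying function -/
  toFun : Vec n → ℂ
  smooth : ContDiff ℝ ∞ toFun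
  compact : HasCompactSupport toFun

lemma finite_lat {n : ℕ} (R : ℝ) : {l : Lat n | ‖latVec l‖ ≤ R}.Finite := by
  refine ((Set.finite_Icc (fun _ : Fin n => -⌈R⌉) (fun _ => ⌈R⌉)).prod
    (Set.finite_Icc (fun _ : Fin n => -⌈R⌉) (fun _ => ⌈R⌉))).subset fun l hl => ?_
  have h1 : ∀ i, |(l.1 i : ℝ)| ≤ R := fun i =>
    ((norm_le_pi_norm (latVec l).1 i).trans (norm_fst_le _)).trans hl
  have h2 : ∀ i, |(l.2 i : ℝ)| ≤ R := fun i =>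
    ((norm_le_pi_norm (latVec l).2 i).trans (norm_snd_le _)).trans hl
  have key : ∀ a : ℤ, |(a : ℝ)| ≤ R → -⌈R⌉ ≤ a ∧ a ≤ ⌈R⌉ := fun a ha => by
    have h := ha.trans (Int.le_ceil R)
    rw [abs_le] at h
    exact ⟨by exact_mod_cast h.1, by exact_mod_cast h.2⟩
  exact ⟨⟨fun i => (key _ (h1 i)).1, fun i => (key _ (h1 i)).2⟩,
    ⟨fun i => (key _ (h2 i)).1, fun i => (key _ (h2 i)).2⟩⟩

lemma multiplier_mul_conj {n : ℕ} (k : ℕ) (u : Vec n) (l : Lat n) :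
    multiplier k u l * starRingEnd ℂ (multiplier k u l) = 1 := by
  rw [Complex.mul_conj, Complex.normSq_eq_norm_sq]
  have h : ‖multiplier k u l‖ = 1 := by
    unfold multiplier
    rw [norm_mul, Complex.norm_exp]
    simp
  simp [h]

lemma multiplier_add {n : ℕ} (k : ℕ) (u : Vec n) (l l' : Lat n) :
    multiplier k u (l' + l) = multiplier k u l' * multiplier k (u + latVec l') l := by
  have hint : omega (latVec l') (latVec l)
      = ((∑ i, (l'.2 i * l.1 i - l'.1 i * l.2 i) : ℤ) : ℝ) := by
    simp [omega, latVec]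
  have hone : (-1 : ℂ) ≠ 0 := by norm_num
  have hexp : ∀ a : ℤ, Complex.exp (-(Real.pi * Complex.I * (a : ℂ))) = (-1 : ℂ) ^ a := by
    intro a
    have h := Complex.exp_int_mul (-(Real.pi * Complex.I)) a
    rw [Complex.exp_neg, Complex.exp_pi_mul_I] at h
    rw [show (-1 : ℂ) = (-1)⁻¹ by norm_num, ← h]
    congr 1
    ring
  have hsplit : Complex.exp (-(k * Real.pi * Complex.I * (omega (latVec l') (latVec l) : ℝ)))
      = ((-1 : ℂ) ^ (∑ i, (l'.2 i * l.1 i - l'.1 i * l.2 i))) ^ k := by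
    rw [← hexp, ← Complex.exp_nat_mul, hint]
    congr 1
    push_cast
    ring
  have hpar : (-1 : ℂ) ^ (∑ i, (l' + l).1 i * (l' + l).2 i)
      = (-1) ^ (∑ i, l'.1 i * l'.2 i) * (-1) ^ (∑ i, l.1 i * l.2 i) *
        (-1) ^ (∑ i, (l'.2 i * l.1 i - l'.1 i * l.2 i)) := by
    rw [← zpow_add₀ hone, ← zpow_add₀ hone]
    have h1 : (∑ i, (l' + l).1 i * (l' + l).2 i)
        = (∑ i, l'.1 i * l'.2 i + ∑ i, l.1 i * l.2 i
          + ∑ i, (l'.2 i * l.1 i - l'.1 i * l.2 i)) + 2 * ∑ i, l'.1 i * l.2 i := by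
      simp only [Finset.mul_sum, ← Finset.sum_add_distrib]
      exact Finset.sum_congr rfl fun i _ => by simp; ring
    rw [h1, zpow_add₀ hone, zpow_mul]
    norm_num
  unfold multiplier
  rw [latVec_add, omega_add_right, omega_add_left, hpar, mul_pow, mul_pow, ← hsplit]
  have e : ∀ a b c : ℝ, Complex.exp (-(k * Real.pi * Complex.I * ((a + b : ℝ) : ℂ)))
      = Complex.exp (-(k * Real.pi * Complex.I * (a : ℂ))) *
        Complex.exp (-(k * Real.pi * Complex.I * (b : ℂ))) := fun a b _ => by
    rw [← Complex.exp_add]; congr 1; push_cast; ring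
  rw [e _ _ 0, e _ _ 0]
  ring

/-- The push-forward to `X` of a test function `φ` on the universal cover: the smooth section
`u ↦ ∑_λ conj(multiplier(u,λ)) φ(u+λ)` of `L^{⊗k}`. It is the adjoint of the pull-back:
`⟨s, periodize φ⟩_{L²} = ∫_{ℝ²ⁿ} s φ̄` for a smooth section `s`. -/
def periodize {n : ℕ} (k : ℕ) (φ : TestFn n) : smoothSection n k :=
  ⟨fun u => ∑ᶠ l : Lat n, starRingEnd ℂ (multiplier k u l) * φ.toFun (u + latVec l), by
    refine ⟨?_, fun u l' => ?_⟩
    · obtain ⟨R, hR⟩ := φ.compact.isCompact.isBounded.subset_closedBall (0 : Vec n)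
      have hlf : LocallyFinite fun l : Lat n => Function.support
          (fun u : Vec n => starRingEnd ℂ (multiplier k u l) * φ.toFun (u + latVec l)) := by
        intro u
        refine ⟨Metric.ball u 1, Metric.ball_mem_nhds u one_pos,
          (finite_lat (n := n) (R + (‖u‖ + 1))).subset ?_⟩
        rintro l ⟨z, hz, hzu⟩
        have h1 : φ.toFun (z + latVec l) ≠ 0 := right_ne_zero_of_mul hz
        have h2 := hR (subset_tsupport _ h1)
        rw [mem_closedBall_zero_iff] at h2
        have h3 : ‖z‖ ≤ ‖u‖ + 1 := by
          have h4 := norm_sub_norm_le z u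
          rw [Metric.mem_ball, dist_eq_norm] at hzu
          linarith
        have h5 : ‖latVec l‖ ≤ ‖z + latVec l‖ + ‖z‖ := by
          simpa using norm_sub_le (z + latVec l) z
        change ‖latVec l‖ ≤ _
        linarith
      rw [← contMDiff_iff_contDiff]
      refine contMDiff_finsum (fun l => contMDiff_iff_contDiff.2 ?_) hlf
      exact (Complex.conjCLE.contDiff.comp (contDiff_multiplier k l)).mul
        (φ.smooth.comp (contDiff_id.add contDiff_const))
    · rw [← smul_eq_mul, smul_finsum, ← finsum_comp_equiv (Equiv.addLeft l')]
      refine finsum_congr fun l => ?_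
      simp only [Equiv.coe_addLeft, smul_eq_mul]
      rw [multiplier_add, map_mul, ← mul_assoc, ← mul_assoc, multiplier_mul_conj, one_mul,
        latVec_add, add_assoc]⟩

/-- The test function `u ↦ conj(χ(u)) e^{2πi ζ·u}`. -/
def modulate {n : ℕ} (χ : TestFn n) (ζ : Vec n) : TestFn n :=
  ⟨fun u => starRingEnd ℂ (χ.toFun u) * Complex.exp
      (2 * Real.pi * Complex.I * ((∑ i, (ζ.1 i * u.1 i + ζ.2 i * u.2 i) : ℝ) : ℂ)), by
    have h : ContDiff ℝ ∞ (fun u : Vec n => ∑ i, (ζ.1 i * u.1 i + ζ.2 i * u.2 i)) :=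
      ContDiff.sum fun i _ => by fun_prop
    exact (Complex.conjCLE.contDiff.comp χ.smooth).mul
      ((contDiff_const.mul (Complex.ofRealCLM.contDiff.comp h)).cexp),
    (χ.compact.comp_left (g := starRingEnd ℂ) (map_zero _)).mul_right⟩

/-- The Fourier transform `ζ ↦ (χ s)(e^{-2πi ζ·u})` of the localization `χ s` of (the pull-back to
`ℝ²ⁿ` of) a distributional section `s`. -/
def localFourier {n k : ℕ} (χ : TestFn n) (s : distSection n k) (ζ : Vec n) : ℂ :=
  s.1 (periodize k (modulate χ ζ))

/-- `HasPairing s s' c`: the two distributional sections have a well defined pairing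
`⟨s, s'⟩ = c`. As in the definition of the product of distributions with transversal wavefront
sets, both are localized, and Parseval's formula `∫ (χ s) conj(χ' s') = ∫ ℱ(χ s) conj(ℱ(χ' s'))`
is used: for all cut-offs `χ, χ'` for which the periodization of `χ χ̄'` is `1`
(so that `⟨s, s'⟩_{L²} = ∫_{ℝ²ⁿ} (χ s) conj(χ' s')` for smooth sections), the integral on the
right converges absolutely and equals `c`. -/
def HasPairing {n k : ℕ} (s s' : distSection n k) (c : ℂ) : Prop :=
  ∀ χ χ' : TestFn n,
    (∀ u, ∑ᶠ l : Lat n, χ.toFun (u + latVec l) * starRingEnd ℂ (χ'.toFun (u + latVec l)) = 1) →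
    MeasureTheory.Integrable
      (fun ζ : Vec n => localFourier χ s ζ * starRingEnd ℂ (localFourier χ' s' ζ)) ∧
    ∫ ζ : Vec n, localFourier χ s ζ * starRingEnd ℂ (localFourier χ' s' ζ) = c

/-- The half-form pairing `⟨ρ, ρ̌⟩ = ⟨dⁿ(x,y)_{-I}, dⁿ(x,y)_I⟩^{1/2} = (2ⁿ k^{-n})^{1/2}`. -/
def halfFormPairing (n k : ℕ) : ℝ := ((2 : ℝ) ^ n * ((k : ℝ) ^ n)⁻¹) ^ (1 / 2 : ℝ)

/-- `HasBKSPairing s s' c`: the half-form corrected pairing `⟨s ⊗ ρ, s' ⊗ ρ̌⟩` is `c`. -/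
def HasBKSPairing {n k : ℕ} (s s' : distSection n k) (c : ℂ) : Prop :=
  ∃ c₀ : ℂ, HasPairing s s' c₀ ∧ c = c₀ * halfFormPairing n k

/-- `IsProjection s p`: `Π^ħ s` is defined and equals `p`, where
`Π^ħ s = (⟨ , ⟩ ⊗ Id)(s ⊗ K^ħ) = ∑_m ⟨s, σ̌^m⟩ σ^m` for the kernel `K^ħ = ∑_m σ̌^m ⊗ σ^m`. -/
def IsProjection {n k : ℕ} [NeZero k] (s : distSection n k) (p : quantumSpace n k) : Prop :=
  ∃ c : (Fin n → ZMod k) → ℂ,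
    (∀ m, HasBKSPairing s (sigmaCheck m : quantumSpaceCheck n k).1 (c m)) ∧
      p = ∑ m, c m • (sigma m : quantumSpace n k)

/-- `IsToeplitz f A`: the operator `A` on `H^ħ` is the Toeplitz-type operator
`Q_f^ħ : s ↦ Π^ħ(f s)`. -/
def IsToeplitz {n k : ℕ} [NeZero k] (f : smoothTorus n) (A : Module.End ℂ (quantumSpace n k)) :
    Prop :=
  ∀ s : quantumSpace n k, IsProjection (distMul f s.1) (A s)

/-! ## The inner product on the quantum Hilbert space

The inner product on `H^ħ = H_{-I}^ħ` is the boundary value at `τ = -I` of the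
Blattner-Kostant-Sternberg pairing of the spaces `H_τ^ħ`, which are trivialized by the frame
`σ_τ^m`. It is taken here along the points `τ = -rI`, `0 < r < 1`, of the Siegel disc, where
`Ω(τ) = i (1+r)/(1-r) I`. -/

/-- The theta function `ϑ_τ^m`, `τ = -rI`, a smooth section of `L^{⊗k}`; its `[m']`-th Weil-Brezin
coefficient is `δ_{m,m'} det(I+τ)^{-1/2} e^{kπi y·Ω(τ)y}`. -/
def thetaRay {n k : ℕ} (r : ℝ) (m : Fin n → ZMod k) (u : Vec n) : ℂ :=
  (((1 - r) ^ (-(n : ℝ) / 2) : ℝ) : ℂ) *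
    Complex.exp (-(k * Real.pi * Complex.I * ((∑ i, u.1 i * u.2 i : ℝ) : ℂ))) *
    ∑' q : Fin n → ℤ,
      ((Real.exp (-(k * Real.pi * ((1 + r) / (1 - r)) *
        ∑ i, (u.2 i - (((m i).val : ℝ) + k * q i) / k) ^ 2)) : ℝ) : ℂ) *
      Complex.exp (2 * Real.pi * Complex.I *
        ((∑ i, (((m i).val : ℝ) + k * q i) * u.1 i : ℝ) : ℂ))

/-- `⟨σ_τ^m, σ_τ^{m'}⟩_{BKS}` for `τ = -rI` and `σ_τ^m = 2^{n/4} k^{n/2} ϑ_τ^m √(dⁿ(x,y)_τ)`: the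
`L²` inner product of sections, times the half-form pairing
`⟨√(dⁿ(x,y)_τ), √(dⁿ(x,y)_τ)⟩ = ((1-r²)/k)^{n/2}`. -/
def bksRay {n k : ℕ} (r : ℝ) (m m' : Fin n → ZMod k) : ℂ :=
  ((normFactor n k ^ 2 * ((1 - r ^ 2) / k) ^ ((n : ℝ) / 2) : ℝ) : ℂ) *
    ∫ u in cube n ×ˢ cube n, thetaRay r m u * starRingEnd ℂ (thetaRay r m' u)

/-- `IsBKSInner B`: `B` is the inner product on `H^ħ` given by the boundary value of the BKS
pairing (the inner product of `B` is linear in its second argument). -/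
def IsBKSInner {n k : ℕ} [NeZero k] (B : InnerProductSpace.Core ℂ (quantumSpace n k)) : Prop :=
  ∀ m m' : Fin n → ZMod k,
    Filter.Tendsto (fun r : ℝ => bksRay r m m') (nhdsWithin 1 (Set.Iio 1))
      (nhds (B.inner (sigma m') (sigma m)))

/-- The norm of an inner product. -/
def normOf {V : Type*} [AddCommGroup V] [Module ℂ V] (B : InnerProductSpace.Core ℂ V) (s : V) : ℝ :=
  Real.sqrt (B.inner s s).re

/-- `‖A‖ ≤ C` for the operator norm defined by the inner product `B`. -/
def OpNormLE {V : Type*} [AddCommGroup V] [Module ℂ V] (B : InnerProductSpace.Core ℂ V)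
    (A : Module.End ℂ V) (C : ℝ) : Prop :=
  ∀ s : V, normOf B (A s) ≤ C * normOf B s

end RealToeplitz

end

/-!
The theorem reduces to an explicit computation with matrices of size `kⁿ`, and the computation to
the Weyl relations.

**The quantum space.** A distributional section that is flat along the `x`-directions is invariant
under parallel translation along the leaves (`flat_translate`). Going once around the `i`-th loop of
a leaf multiplies a section by the holonomy `e^{-2πi k yᵢ}`, so the distribution annihilates
`(holonomy - 1) t` for every smooth `t` (`flat_holonomy`). This forces it to be supported on the
Bohr-Sommerfeld fibres `y ∈ k⁻¹ℤⁿ`; moreover it is of order zero there, because sections that vanish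
on these fibres can be deformed, modulo the ideal of the `holonomyᵢ - 1`, to sections that vanish in
a neighbourhood of them (`flat_eq_zero_of_vanish`). On a single fibre the flat sections are unique up
to a scalar. Hence the `σ^m` span (`exists_eq_sum_deltaT`), and form a basis `sigmaBasis`.

**The operators.** A Bohr-Sommerfeld fibre `{y = m/k}` and a fibre `{x = j/k}` of the other
polarization meet transversally in one point. The localized Fourier transform of
each is a finite sum of functions that are integrable in the dual variable along the fibre and characters
in the other one; the two fibres being transversal, Fourier inversion gives the pairing
`⟨f δ_m, δ̌_j⟩ = f(j/k, m/k) e^{2πi m·j/k}` (`hasPairing_deltaT`). So `Q_f` is the matrix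
`k⁻ⁿ ∑_j f(j/k, m/k) e^{2πi (m - m')·j/k}` (`isToeplitz_iff`).

**The inner product.** By orthogonality in `x` and unfolding in `y`, the theta functions on the ray
`τ = -rI` have a diagonal Gram matrix, which the half-form factor turns into the identity for every
`r` (`bksRay_eq`). So the limit exists, and the `σ^m` are orthonormal (`isBKSInner_iff`).

**The estimate.** For a character `e_p(x, y) = e^{2πi(a·x + b·y)}`, `p = (a, b)`, the operator `Q_{e_p}`
is the contraction `W_p : σ^m ↦ e^{2πi b·m/k} σ^{m+a}`, and `W_p W_q = e^{2πi b·a'/k} W_{p+q}` for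
`q = (a', b')` (`weyl_mul`). Expanding `f` and `g` in Fourier series,
`Q_f Q_g = ∑ f̂_p ĝ_q e^{2πi b·a'/k} W_{p+q}`, while `f ⋆_N g` is obtained from the same series by
replacing the phase by its Taylor polynomial of degree `N` in `1/k` (`hasSum_starTrunc`): each
`C_j` carries `j` derivatives in `y` of `f` and in `x` of `g`. The Taylor remainder is at most
`|2π b·a'/k|^{N+1}`, and the rapid decay of `f̂` and `ĝ` makes the sum of these bounds converge
(`exists_opNormLE`).
-/

noncomputable section

namespace RealToeplitz

/-! ### Integrals with parameters, and unfolding over the lattice -/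

open MeasureTheory in
/-- Differentiation under the integral sign over a compact set. -/
lemma hasFDerivAt_setIntegral_param {E P G : Type} [NormedAddCommGroup E] [NormedSpace ℝ E]
    [ProperSpace E] [TopologicalSpace P] [MeasurableSpace P] [OpensMeasurableSpace P]
    [SecondCountableTopology P]
    [NormedAddCommGroup G] [NormedSpace ℝ G] [CompleteSpace G] (μ : Measure P)
    [IsFiniteMeasureOnCompacts μ] {K : Set P} (hK : IsCompact K) (hKm : MeasurableSet K)
    {F : E → P → G} {F' : E → P → E →L[ℝ] G} (hF : Continuous F.uncurry)
    (hF' : Continuous F'.uncurry) (hd : ∀ u p, HasFDerivAt (fun u => F u p) (F' u p) u) (u : E) :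
    HasFDerivAt (fun u => ∫ p in K, F u p ∂μ) (∫ p in K, F' u p ∂μ) u := by
  obtain ⟨C, hC⟩ := ((isCompact_closedBall u 1).prod hK).exists_bound_of_continuousOn
    hF'.continuousOn
  have hμ : IsFiniteMeasure (μ.restrict K) := ⟨by
    rw [Measure.restrict_apply_univ]; exact hK.measure_lt_top⟩
  have hint : ∀ {H : Type} [NormedAddCommGroup H] (f : P → H), Continuous f →
      AEStronglyMeasurable f (μ.restrict K) := fun f hf =>
    hf.continuousOn.aestronglyMeasurable_of_isCompact hK hKm
  refine hasFDerivAt_integral_of_dominated_of_fderiv_le (bound := fun _ => C)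
    (Metric.closedBall_mem_nhds u one_pos) ?_ ?_ ?_ ?_ (integrable_const C) ?_
  · exact Filter.Eventually.of_forall fun v => hint _ (hF.comp (by fun_prop : Continuous fun p => (v, p)))
  · have h1 : ContinuousOn (F u) K :=
      (hF.comp (by fun_prop : Continuous fun p => (u, p))).continuousOn
    exact h1.integrableOn_compact' hK hKm
  · exact hint _ (hF'.comp (by fun_prop : Continuous fun p => (u, p)))
  · filter_upwards [ae_restrict_mem hKm] with p hp v hv using hC (v, p) ⟨hv, hp⟩
  · exact Filter.Eventually.of_forall fun p v _ => hd v p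

open MeasureTheory in
/-- The integral over a compact set of a jointly smooth function is smooth in the parameter. -/
lemma contDiff_setIntegral_param {E P : Type} [NormedAddCommGroup E] [NormedSpace ℝ E]
    [FiniteDimensional ℝ E] [NormedAddCommGroup P] [NormedSpace ℝ P] [MeasurableSpace P]
    [OpensMeasurableSpace P] [SecondCountableTopology P] (μ : Measure P)
    [IsFiniteMeasureOnCompacts μ] [IsLocallyFiniteMeasure μ] {K : Set P} (hK : IsCompact K) (hKm : MeasurableSet K)
    {G : Type} [NormedAddCommGroup G] [NormedSpace ℝ G] [CompleteSpace G]
    {F : E → P → G} (hF : ContDiff ℝ ∞ F.uncurry) :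
    ContDiff ℝ ∞ (fun u => ∫ p in K, F u p ∂μ) := by
  have : ProperSpace E := FiniteDimensional.proper ℝ E
  -- the induction on the order of differentiability changes the target `G` to `E →L[ℝ] G`
  suffices h : ∀ (m : ℕ) {G : Type} [NormedAddCommGroup G] [NormedSpace ℝ G] [CompleteSpace G]
      {F : E → P → G}, ContDiff ℝ ∞ F.uncurry → ContDiff ℝ m (fun u => ∫ p in K, F u p ∂μ) from
    contDiff_infty.2 fun m => h m hF
  intro m
  induction m with
  | zero =>
    intro G _ _ _ F hF
    rw [Nat.cast_zero, contDiff_zero]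
    exact continuous_parametric_integral_of_continuous hF.continuous hK
  | succ m ih =>
    intro G _ _ _ F hF
    have hd : ∀ u p, HasFDerivAt (fun u => F u p) (fderiv ℝ (fun u => F u p) u) u := fun u p =>
      ((hF.comp (contDiff_id.prodMk contDiff_const : ContDiff ℝ ∞ fun u : E => (u, p))).differentiable
        (by simp) u).hasFDerivAt
    have hF' : ContDiff ℝ ∞ (Function.uncurry fun u p => fderiv ℝ (fun u => F u p) u) := by
      have h1 : ContDiff ℝ ∞ (Function.uncurry fun (q : E × P) (u : E) => F u q.2) :=
        hF.comp (by fun_prop : ContDiff ℝ ∞ fun q : (E × P) × E => (q.2, q.1.2))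
      exact h1.fderiv contDiff_fst (by simp)
    have hI := hasFDerivAt_setIntegral_param μ hK hKm hF.continuous hF'.continuous hd
    rw [Nat.cast_succ, contDiff_succ_iff_fderiv]
    refine ⟨fun u => (hI u).differentiableAt, by simp, ?_⟩
    rw [funext fun u => (hI u).fderiv]
    exact ih hF'

/-- Products of nonnegative summable families are summable over the functions. -/
lemma summable_pi_prod {ι κ : Type*} [Fintype ι] {h : ι → κ → ℝ} (h0 : ∀ i a, 0 ≤ h i a)
    (hs : ∀ i, Summable (h i)) : Summable fun p : ι → κ => ∏ i, h i (p i) := by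
  classical
  refine summable_of_sum_le (c := ∏ i, ∑' a, h i a)
    (fun p => Finset.prod_nonneg fun i _ => h0 i _) fun s => ?_
  let T : ι → Finset κ := fun i => s.image fun p => p i
  calc ∑ p ∈ s, ∏ i, h i (p i) ≤ ∑ p ∈ Fintype.piFinset T, ∏ i, h i (p i) := by
        refine Finset.sum_le_sum_of_subset_of_nonneg (fun p hp => ?_)
          fun p _ _ => Finset.prod_nonneg fun i _ => h0 i _
        exact Fintype.mem_piFinset.2 fun i => Finset.mem_image_of_mem _ hp
    _ = ∏ i, ∑ a ∈ T i, h i a := (Finset.prod_univ_sum T h).symm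
    _ ≤ ∏ i, ∑' a, h i a := Finset.prod_le_prod
        (fun i _ => Finset.sum_nonneg fun a _ => h0 i a)
        fun i _ => (hs i).sum_le_tsum _ fun a _ => h0 i a

/-- The vector of `ℝⁿ` with the given integral coordinates. -/
def intVec {n : ℕ} (a : Fin n → ℤ) : Fin n → ℝ := fun i => (a i : ℝ)

lemma measurableSet_cube (n : ℕ) : MeasurableSet (cube n) := measurableSet_Icc

open MeasureTheory in
lemma cube_ae_eq (n : ℕ) : (Set.univ.pi fun _ : Fin n => Set.Ico (0 : ℝ) 1)
    =ᵐ[volume] cube n := by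
  have h := Measure.univ_pi_Ico_ae_eq_Icc (μ := fun _ : Fin n => (volume : Measure ℝ)) (f := 0) (g := 1)
  exact h

open MeasureTheory in
/-- Unfolding: the integral over `ℝⁿ` is the sum of the integrals over the translates of the unit
cube. -/
lemma hasSum_integral_cube_translate {n : ℕ} {φ : (Fin n → ℝ) → ℂ} (hφ : Integrable φ) :
    HasSum (fun a : Fin n → ℤ => ∫ x in cube n, φ (x + intVec a)) (∫ x, φ x) := by
  let S : (Fin n → ℤ) → Set (Fin n → ℝ) := fun a => {x | ∀ i, ⌊x i⌋ = a i}
  have hS : ∀ a, S a = (fun x => x - intVec a) ⁻¹' (Set.univ.pi fun _ => Set.Ico (0 : ℝ) 1) := by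
    intro a
    ext x
    simp only [S, Set.mem_ofPred_eq, Set.mem_preimage, Set.mem_univ_pi, Int.floor_eq_iff, intVec,
      Pi.sub_apply, Set.mem_Ico]
    exact forall_congr' fun i => and_congr (by constructor <;> intro h <;> linarith)
      (by constructor <;> intro h <;> linarith)
  have hm : ∀ a, MeasurableSet (S a) := fun a => by
    rw [hS]
    exact (MeasurableSet.univ_pi fun _ => measurableSet_Ico).preimage (by fun_prop)
  have hd : Pairwise (Function.onFun Disjoint S) := fun a b hab => by
    refine Set.disjoint_left.2 fun x hx hx' => hab (funext fun i => ?_)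
    rw [← hx i, hx' i]
  have hU : (⋃ a, S a) = Set.univ :=
    Set.eq_univ_of_forall fun x => Set.mem_iUnion.2 ⟨fun i => ⌊x i⌋, fun i => rfl⟩
  have h := hasSum_integral_iUnion hm hd (hφ.integrableOn (s := ⋃ a, S a))
  rw [hU, setIntegral_univ] at h
  refine h.congr_fun fun a => ?_
  rw [← setIntegral_congr_set (cube_ae_eq n), hS]
  have := (measurePreserving_sub_right (volume : Measure (Fin n → ℝ)) (intVec a)).setIntegral_preimage_emb
    (MeasurableEquiv.subRight (intVec a)).measurableEmbedding (fun x => φ (x + intVec a))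
    (Set.univ.pi fun _ => Set.Ico (0 : ℝ) 1)
  simp only [sub_add_cancel] at this
  exact this.symm

/-! ### Heisenberg translations of sections -/

lemma omega_smul_right {n : ℕ} (c : ℝ) (u v : Vec n) : omega u (c • v) = c * omega u v := by
  rw [omega_antisymm, omega_smul_left, omega_antisymm u v]; ring

lemma omega_self {n : ℕ} (v : Vec n) : omega v v = 0 := by
  have := omega_antisymm v v; linarith

lemma contDiff_omega {n : ℕ} : ContDiff ℝ ∞ (fun p : Vec n × Vec n => omega p.1 p.2) := by
  unfold omega
  fun_prop

/-- The value at `u` of the Heisenberg translate of `t` by `v`: the value `t (u + v)`, transported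
back to `u` along the segment from `u` to `u + v`. -/
def heis {n : ℕ} (k : ℕ) (v : Vec n) (t : Vec n → ℂ) (u : Vec n) : ℂ :=
  Complex.exp (-(k * Real.pi * Complex.I * (omega u v : ℝ))) * t (u + v)

lemma contDiff_heis {n k : ℕ} {E : Type*} [NormedAddCommGroup E] [NormedSpace ℝ E]
    {t : Vec n → ℂ} (ht : ContDiff ℝ ∞ t) {V u : E → Vec n} (hV : ContDiff ℝ ∞ V)
    (hu : ContDiff ℝ ∞ u) : ContDiff ℝ ∞ fun p => heis k (V p) t (u p) := by
  have h1 : ContDiff ℝ ∞ fun p => omega (u p) (V p) := contDiff_omega.comp (hu.prodMk hV)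
  exact ((contDiff_const.mul (Complex.ofRealCLM.contDiff.comp h1)).neg.cexp).mul
    (ht.comp (hu.add hV))

/-- Heisenberg translation preserves the space of sections of `L^{⊗k}`. -/
lemma heis_quasiperiodic {n k : ℕ} (v : Vec n) (t : smoothSection n k) (u : Vec n) (l : Lat n) :
    heis k v t.1 (u + latVec l) = multiplier k u l * heis k v t.1 u := by
  have h := t.2.2 (u + v) l
  have e : u + latVec l + v = u + v + latVec l := by abel
  simp only [heis]
  rw [e, h, omega_add_left]
  simp only [multiplier]
  rw [omega_add_left u v, omega_antisymm (latVec l) v]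
  have : ∀ a b c : ℝ, Complex.exp (-(k * Real.pi * Complex.I * ((a + -b : ℝ) : ℂ))) *
      Complex.exp (-(k * Real.pi * Complex.I * ((c + b : ℝ) : ℂ)))
      = Complex.exp (-(k * Real.pi * Complex.I * (c : ℂ))) *
        Complex.exp (-(k * Real.pi * Complex.I * (a : ℂ))) := fun a b c => by
    rw [← Complex.exp_add, ← Complex.exp_add]; congr 1; push_cast; ring
  have h3 := this (omega u v) (omega v (latVec l)) (omega u (latVec l))
  linear_combination ((-1 : ℂ) ^ (∑ i, l.1 i * l.2 i)) ^ k * t.1 (u + v) * h3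

/-- The covariant derivative is the infinitesimal generator of the Heisenberg translations. -/
lemma hasDerivAt_heis {n : ℕ} (k : ℕ) {t : Vec n → ℂ} (ht : Differentiable ℝ t) (v u : Vec n)
    (σ : ℝ) : HasDerivAt (fun σ : ℝ => heis k (σ • v) t u) (heis k (σ • v) (nablaFun k v t) u) σ := by
  have h1 : HasDerivAt (fun σ : ℝ => u + σ • v) v σ := by
    simpa using ((hasDerivAt_id σ).smul_const v).const_add u
  have h2 : HasDerivAt (fun σ : ℝ => t (u + σ • v)) (fderiv ℝ t (u + σ • v) v) σ :=
    (ht (u + σ • v)).hasFDerivAt.comp_hasDerivAt σ h1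
  have h3 : HasDerivAt (fun σ : ℝ => (σ : ℂ)) 1 σ := Complex.ofRealCLM.hasDerivAt
  have h4 := (((h3.mul_const (omega u v : ℂ)).const_mul (k * Real.pi * Complex.I : ℂ)).neg.cexp).mul h2
  have e : (fun σ : ℝ => heis k (σ • v) t u) = fun σ : ℝ =>
      Complex.exp (-(k * Real.pi * Complex.I * ((σ : ℂ) * (omega u v : ℂ)))) * t (u + σ • v) := by
    ext σ
    simp only [heis, omega_smul_right, Complex.ofReal_mul]
  rw [e]
  convert! h4 using 1
  simp only [heis, nablaFun, omega_smul_right, omega_add_left, omega_smul_left, omega_self,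
    Complex.ofReal_mul, Pi.neg_apply]
  push_cast
  ring

open MeasureTheory in
/-- The fundamental theorem of calculus along the Heisenberg translations. -/
lemma integral_heis_nabla {n : ℕ} (k : ℕ) {t : Vec n → ℂ} (ht : ContDiff ℝ ∞ t) (v u : Vec n) :
    ∫ σ in Set.Icc (0 : ℝ) 1, heis k (σ • v) (nablaFun k v t) u = heis k v t u - t u := by
  have h0 := fun σ : ℝ => hasDerivAt_heis k (ht.differentiable (by simp)) v u σ
  have hc : ContDiff ℝ ∞ (nablaFun k v t) := by
    have h1 : ContDiff ℝ ∞ (fun u => fderiv ℝ t u v) :=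
      (ht.fderiv_right (m := ∞) (by exact_mod_cast le_top)).clm_apply contDiff_const
    exact h1.sub ((contDiff_const.mul
      (Complex.ofRealCLM.contDiff.comp (contDiff_omega_left v))).mul ht)
  have hc' : Continuous fun σ : ℝ => heis k (σ • v) (nablaFun k v t) u :=
    (contDiff_heis hc (V := fun σ : ℝ => σ • v) (by fun_prop) contDiff_const).continuous
  rw [integral_Icc_eq_integral_Ioc, ← intervalIntegral.integral_of_le zero_le_one,
    intervalIntegral.integral_eq_sub_of_hasDerivAt (fun σ _ => h0 σ) (hc'.intervalIntegrable _ _)]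
  simp [heis, omega]

/-- Heisenberg translations by `x` commute with `∇_v` when `ω(x,v) = 0`. -/
lemma nablaFun_heis {n : ℕ} (k : ℕ) {t : Vec n → ℂ} (ht : Differentiable ℝ t) (x v u : Vec n)
    (hxv : omega x v = 0) :
    nablaFun k v (heis k x t) u = heis k x (nablaFun k v t) u := by
  obtain ⟨D, hD, hw⟩ := hasFDerivAt_omega u x
  have h1 := ((Complex.ofRealCLM.hasFDerivAt (x := omega u x)).comp u hD)
  have h2 := (h1.const_mul (k * Real.pi * Complex.I : ℂ)).neg.cexp
  have h3 : HasFDerivAt (fun u => t (u + x)) (fderiv ℝ t (u + x)) u :=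
    (hasFDerivAt_comp_add_right x).2 (ht _).hasFDerivAt
  have h4 : HasFDerivAt (heis k x t) _ u := h2.mul h3
  have hvx : omega v x = 0 := by rw [omega_antisymm, hxv, neg_zero]
  simp only [nablaFun]
  rw [h4.fderiv]
  simp only [nablaFun, heis, omega_add_left, hxv]
  simp [hw, hvx]
  ring

open MeasureTheory in
/-- The superposition `∫_K φ(p) U_{X(p)} t dp` of Heisenberg translates of a section, for a
family of smooth periodic vector fields `X(p)`. -/
def heisIntegral {n k : ℕ} {P : Type} [NormedAddCommGroup P] [NormedSpace ℝ P] [MeasureSpace P]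
    [OpensMeasurableSpace P] [SecondCountableTopology P]
    [IsFiniteMeasureOnCompacts (volume : Measure P)] [IsLocallyFiniteMeasure (volume : Measure P)]
    {K : Set P} (hK : IsCompact K) (hKm : MeasurableSet K) {φ : P → ℂ} (hφ : ContDiff ℝ ∞ φ)
    {X : P → Vec n → Vec n} (hX : ContDiff ℝ ∞ X.uncurry)
    (hXp : ∀ p u (l : Lat n), X p (u + latVec l) = X p u) (t : smoothSection n k) :
    smoothSection n k :=
  ⟨fun u => ∫ p in K, φ p * heis k (X p u) t.1 u, by
    refine ⟨contDiff_setIntegral_param volume hK hKm ?_, fun u l => ?_⟩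
    · have h1 : ContDiff ℝ ∞ fun q : Vec n × P => X q.2 q.1 :=
        hX.comp (by fun_prop : ContDiff ℝ ∞ fun q : Vec n × P => (q.2, q.1))
      exact (hφ.comp contDiff_snd).mul (contDiff_heis t.2.1 h1 contDiff_fst)
    · refine (integral_congr_ae (Filter.Eventually.of_forall fun p => ?_)).trans
        (integral_const_mul (multiplier k u l) _)
      simp only [hXp, heis_quasiperiodic]
      ring⟩

open MeasureTheory in
/-- `∇_v` commutes with superpositions of Heisenberg translates by constant vectors `x(p)` that are
orthogonal to `v` for `ω`. -/
lemma nabla_heisIntegral {n k : ℕ} {P : Type} [NormedAddCommGroup P] [NormedSpace ℝ P]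
    [MeasureSpace P] [OpensMeasurableSpace P] [SecondCountableTopology P]
    [IsFiniteMeasureOnCompacts (volume : Measure P)] [IsLocallyFiniteMeasure (volume : Measure P)]
    {K : Set P} (hK : IsCompact K) (hKm : MeasurableSet K) {φ : P → ℂ} (hφ : ContDiff ℝ ∞ φ)
    {x : P → Vec n} (hx : ContDiff ℝ ∞ x) (hX : ContDiff ℝ ∞ (Function.uncurry fun p (_ : Vec n) => x p))
    (t : smoothSection n k) (v : Vec n) (hv : ∀ p, omega (x p) v = 0) (u : Vec n) :
    (nabla v (heisIntegral hK hKm hφ hX (fun _ _ _ => rfl) t)).1 u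
      = ∫ p in K, φ p * heis k (x p) (nablaFun k v t.1) u := by
  have hd : ∀ p, ContDiff ℝ ∞ (heis k (x p) t.1) := fun p =>
    contDiff_heis t.2.1 contDiff_const contDiff_id
  have hj : ContDiff ℝ ∞ (Function.uncurry fun (u : Vec n) p => φ p * heis k (x p) t.1 u) :=
    (hφ.comp contDiff_snd).mul (contDiff_heis t.2.1 (hx.comp contDiff_snd) contDiff_fst)
  have hj' : ContDiff ℝ ∞ (Function.uncurry fun (u : Vec n) p =>
      fderiv ℝ (fun u => φ p * heis k (x p) t.1 u) u) := by
    have h1 : ContDiff ℝ ∞ (Function.uncurry fun (q : Vec n × P) (u : Vec n) =>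
        φ q.2 * heis k (x q.2) t.1 u) :=
      hj.comp (by fun_prop : ContDiff ℝ ∞ fun q : (Vec n × P) × Vec n => (q.2, q.1.2))
    exact h1.fderiv contDiff_fst (by simp)
  have hdp : ∀ u p, HasFDerivAt (fun u => φ p * heis k (x p) t.1 u)
      (fderiv ℝ (fun u => φ p * heis k (x p) t.1 u) u) u := fun u p =>
    ((contDiff_const.mul (hd p)).differentiable (by simp) u).hasFDerivAt
  have hI := hasFDerivAt_setIntegral_param (volume : Measure P) hK hKm hj.continuous hj'.continuous
    hdp u
  have hc1 : Continuous fun p => fderiv ℝ (fun u => φ p * heis k (x p) t.1 u) u :=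
    hj'.continuous.comp (by fun_prop : Continuous fun p : P => (u, p))
  have hc2 : Continuous fun p => φ p * heis k (x p) t.1 u :=
    hj.continuous.comp (by fun_prop : Continuous fun p : P => (u, p))
  change fderiv ℝ (fun u => ∫ p in K, φ p * heis k (x p) t.1 u) u v
    - k * Real.pi * Complex.I * (omega u v : ℝ) * ∫ p in K, φ p * heis k (x p) t.1 u = _
  rw [hI.fderiv, ContinuousLinearMap.integral_apply (hc1.continuousOn.integrableOn_compact' hK hKm),
    ← integral_const_mul, ← integral_sub]
  · congr 1
    ext p
    rw [← nablaFun_heis k (t.2.1.differentiable (by simp)) _ _ _ (hv p)]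
    have : HasFDerivAt (fun u => φ p * heis k (x p) t.1 u) (φ p • fderiv ℝ (heis k (x p) t.1) u) u :=
      (((hd p).differentiable (by simp)) u).hasFDerivAt.const_mul _
    rw [this.fderiv]
    simp only [nablaFun, _root_.smul_apply, smul_eq_mul]
    ring
  · exact (hc1.clm_apply continuous_const).continuousOn.integrableOn_compact' hK hKm
  · exact (continuous_const.mul hc2).continuousOn.integrableOn_compact' hK hKm

/-! ### Distributional sections that are flat along the first polarization -/

/-- The pointwise product of a smooth function and a smooth section. -/
def mulSection {n k : ℕ} (f : smoothTorus n) (t : smoothSection n k) : smoothSection n k :=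
  ⟨fun u => f.1 u * t.1 u, f.2.1.mul t.2.1, fun u l => by simp only [f.2.2 u l, t.2.2 u l]; ring⟩

/-- The Heisenberg translate of a section along a smooth periodic vector field. -/
def translateField {n k : ℕ} {V : Vec n → Vec n} (hV : ContDiff ℝ ∞ V)
    (hVp : ∀ u (l : Lat n), V (u + latVec l) = V u) (t : smoothSection n k) : smoothSection n k :=
  ⟨fun u => heis k (V u) t.1 u, contDiff_heis t.2.1 hV contDiff_id,
    fun u l => by simp only [hVp]; exact heis_quasiperiodic (V u) t u l⟩

/-- The Heisenberg translate of a section by a constant vector. -/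
def translate {n k : ℕ} (v : Vec n) (t : smoothSection n k) : smoothSection n k :=
  translateField (V := fun _ => v) contDiff_const (fun _ _ => rfl) t

/-- A flat distributional section is invariant under the translations along the leaves. -/
lemma flat_translate {n k : ℕ} {s : distSection n k}
    (hs : ∀ v ∈ polT n, ∀ t : smoothSection n k, s.1 (nabla v t) = 0) {v : Vec n} (hv : v ∈ polT n)
    (t : smoothSection n k) : s.1 (translate v t) = s.1 t := by
  have hX : ContDiff ℝ ∞ (Function.uncurry fun (σ : ℝ) (_ : Vec n) => σ • v) := by
    change ContDiff ℝ ∞ fun q : ℝ × Vec n => q.1 • v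
    fun_prop
  have h : translate v t - t = nabla v (heisIntegral (P := ℝ) (K := Set.Icc 0 1) isCompact_Icc
      measurableSet_Icc (φ := fun _ => 1) contDiff_const hX (fun _ _ _ => rfl) t) := by
    ext u
    rw [nabla_heisIntegral isCompact_Icc measurableSet_Icc contDiff_const (by fun_prop)]
    · simp only [one_mul]
      rw [integral_heis_nabla k t.2.1]
      rfl
    · intro σ
      rw [omega_smul_left, omega_self, mul_zero]
  have h2 := hs v hv (heisIntegral (P := ℝ) (K := Set.Icc 0 1) isCompact_Icc
      measurableSet_Icc (φ := fun _ => 1) contDiff_const hX (fun _ _ _ => rfl) t)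
  rw [← h, map_sub, sub_eq_zero] at h2
  exact h2

/-- The holonomy `e^{-2πi k yᵢ}` of `L^{⊗k}` around the loop in the direction `∂/∂xⁱ`. -/
def holonomy {n : ℕ} (k : ℕ) (i : Fin n) (u : Vec n) : ℂ :=
  Complex.exp (-(2 * Real.pi * Complex.I * ((k * u.2 i : ℝ) : ℂ)))

lemma contDiff_holonomy {n : ℕ} (k : ℕ) (i : Fin n) : ContDiff ℝ ∞ (holonomy (n := n) k i) := by
  have h : ContDiff ℝ ∞ fun u : Vec n => (k * u.2 i : ℝ) := by fun_prop
  exact (contDiff_const.mul (Complex.ofRealCLM.contDiff.comp h)).neg.cexp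

lemma holonomy_periodic {n : ℕ} (k : ℕ) (i : Fin n) (u : Vec n) (l : Lat n) :
    holonomy k i (u + latVec l) = holonomy k i u := by
  unfold holonomy
  rw [Complex.exp_eq_exp_iff_exists_int]
  refine ⟨-(k * l.2 i), ?_⟩
  simp [latVec]
  ring

lemma ex_mem_polT {n : ℕ} (i : Fin n) : ex i ∈ polT n := rfl

/-- Translating a section once around a loop of a leaf multiplies it by the holonomy. -/
lemma translate_ex {n k : ℕ} (i : Fin n) (t : smoothSection n k) (u : Vec n) :
    (translate (ex i) t).1 u = holonomy k i u * t.1 u := by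
  have h1 : (ex i : Vec n) = latVec ((Pi.single i 1, 0) : Lat n) := by
    ext j
    · by_cases hj : j = i
      · subst hj; simp [ex, latVec]
      · simp [ex, latVec, hj]
    · simp [ex, latVec]
  have h2 : omega u (ex i) = u.2 i := by simp [omega, ex, Pi.single_apply]
  change Complex.exp (-(k * Real.pi * Complex.I * (omega u (ex i) : ℝ))) * t.1 (u + ex i) = _
  have h3 := t.2.2 u ((Pi.single i 1, 0) : Lat n)
  rw [← h1, multiplier, ← h1, h2] at h3
  simp only [Pi.zero_apply, mul_zero, Finset.sum_const_zero, zpow_zero, one_pow, one_mul] at h3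
  rw [h2, h3, ← mul_assoc, ← Complex.exp_add, holonomy]
  congr 2
  push_cast
  ring

/-- A flat distributional section annihilates the multiples of `holonomy - 1`, that is, it is an
eigenvector of the multiplication by the holonomy. -/
lemma flat_holonomy {n k : ℕ} {s : distSection n k}
    (hs : ∀ v ∈ polT n, ∀ t : smoothSection n k, s.1 (nabla v t) = 0) (i : Fin n)
    {t t' : smoothSection n k} (h : ∀ u, t'.1 u = (holonomy k i u - 1) * t.1 u) : s.1 t' = 0 := by
  have h1 : t' = translate (ex i) t - t := by
    ext u
    rw [h, Submodule.coe_sub, Pi.sub_apply, translate_ex]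
    ring
  rw [h1, map_sub, flat_translate hs (ex_mem_polT i), sub_self]

lemma contDiff_horizontal {n : ℕ} :
    ContDiff ℝ ∞ (Function.uncurry fun (a : Fin n → ℝ) (_ : Vec n) => ((a, 0) : Vec n)) := by
  change ContDiff ℝ ∞ fun q : (Fin n → ℝ) × Vec n => ((q.1, 0) : Vec n)
  fun_prop

/-- The average of a section over the Heisenberg translations along the leaves of the first polarization. -/
def average {n k : ℕ} (t : smoothSection n k) : smoothSection n k :=
  heisIntegral (isCompact_cube n) (measurableSet_cube n) (φ := fun _ => 1) contDiff_const
    contDiff_horizontal (fun _ _ _ => rfl) t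

lemma volume_real_cube (n : ℕ) : MeasureTheory.volume.real (cube n) = 1 := by
  simp [cube, MeasureTheory.measureReal_def, Real.volume_Icc_pi]

lemma nablaFun_horizontal {n : ℕ} (k : ℕ) (a : Fin n → ℝ) (t : Vec n → ℂ) (u : Vec n) :
    nablaFun k (a, 0) t u = ∑ i, (a i : ℂ) * nablaFun k (ex i) t u := by
  have h : ((a, 0) : Vec n) = ∑ i, a i • ex i := by
    ext j
    · simp [ex, Prod.fst_sum, Finset.sum_apply, Pi.single_apply]
    · simp [ex, Prod.snd_sum]
  have h2 : omega u ((a, 0) : Vec n) = ∑ i, a i * omega u (ex i) := by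
    simp [omega, ex, Pi.single_apply, mul_comm]
  simp only [nablaFun, h2]
  rw [h, map_sum]
  push_cast
  rw [Finset.mul_sum, Finset.sum_mul, ← Finset.sum_sub_distrib]
  refine Finset.sum_congr rfl fun i _ => ?_
  rw [map_smul, Complex.real_smul]
  ring

lemma nablaFun_vertical {n : ℕ} (k : ℕ) (a : Fin n → ℝ) (t : Vec n → ℂ) (u : Vec n) :
    nablaFun k (0, a) t u = ∑ i, (a i : ℂ) * nablaFun k (ey i) t u := by
  have h : ((0, a) : Vec n) = ∑ i, a i • ey i := by
    ext j
    · simp [ey, Prod.fst_sum]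
    · simp [ey, Prod.snd_sum, Finset.sum_apply, Pi.single_apply]
  have h2 : omega u ((0, a) : Vec n) = ∑ i, a i * omega u (ey i) := by
    simp [omega, ey, Pi.single_apply, mul_comm]
  simp only [nablaFun, h2]
  rw [h, map_sum]
  push_cast
  rw [Finset.mul_sum, Finset.sum_mul, ← Finset.sum_sub_distrib]
  refine Finset.sum_congr rfl fun i _ => ?_
  rw [map_smul, Complex.real_smul]
  ring

lemma heis_const_mul {n k : ℕ} {ι : Type*} (s : Finset ι) (c : ι → ℂ) (F : ι → Vec n → ℂ) (v u : Vec n) :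
    heis k v (fun u => ∑ i ∈ s, c i * F i u) u = ∑ i ∈ s, c i * heis k v (F i) u := by
  simp only [heis, Finset.mul_sum]
  exact Finset.sum_congr rfl fun i _ => by ring

open MeasureTheory in
/-- A flat distributional section takes the same value on a section and on its average. The
difference of the two is a sum of covariant derivatives `∇_{∂/∂xⁱ}`: translations along the leaves
are generated by them, so the fundamental theorem of calculus along the segments from `0` to `a`,
`a ∈ [0,1]ⁿ`, applies. -/
lemma flat_average {n k : ℕ} {s : distSection n k}
    (hs : ∀ v ∈ polT n, ∀ t : smoothSection n k, s.1 (nabla v t) = 0) (t : smoothSection n k) :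
    s.1 (average t) = s.1 t := by
  let K : Set ((Fin n → ℝ) × ℝ) := cube n ×ˢ Set.Icc 0 1
  have hK : IsCompact K := (isCompact_cube n).prod isCompact_Icc
  have hKm : MeasurableSet K := (measurableSet_cube n).prod measurableSet_Icc
  let x : (Fin n → ℝ) × ℝ → Vec n := fun p => p.2 • ((p.1, 0) : Vec n)
  have hx : ContDiff ℝ ∞ x := by fun_prop
  have hX : ContDiff ℝ ∞ (Function.uncurry fun (p : (Fin n → ℝ) × ℝ) (_ : Vec n) => x p) :=
    hx.comp contDiff_fst
  have hφ : ∀ i, ContDiff ℝ ∞ fun p : (Fin n → ℝ) × ℝ => (p.1 i : ℂ) := fun i =>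
    Complex.ofRealCLM.contDiff.comp (by fun_prop : ContDiff ℝ ∞ fun p : (Fin n → ℝ) × ℝ => p.1 i)
  let I : Fin n → smoothSection n k := fun i =>
    heisIntegral hK hKm (hφ i) hX (fun _ _ _ => rfl) t
  have hnc : ∀ v, ContDiff ℝ ∞ (nablaFun k v t.1) := fun v => (nabla v t).2.1
  have key : average t - t = ∑ i, nabla (ex i) (I i) := by
    ext u
    have h1 : ∀ i, (nabla (ex i) (I i)).1 u
        = ∫ p in K, (p.1 i : ℂ) * heis k (x p) (nablaFun k (ex i) t.1) u := fun i =>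
      nabla_heisIntegral hK hKm (hφ i) hx hX t (ex i) (fun p => by simp [x, omega, ex]) u
    have hcont : ∀ i, Continuous fun p : (Fin n → ℝ) × ℝ =>
        (p.1 i : ℂ) * heis k (x p) (nablaFun k (ex i) t.1) u := fun i =>
      ((hφ i).mul (contDiff_heis (hnc _) hx contDiff_const)).continuous
    rw [Submodule.coe_sum, Finset.sum_apply, Finset.sum_congr rfl fun i _ => h1 i,
      ← integral_finsetSum _ fun i _ => (hcont i).continuousOn.integrableOn_compact' hK hKm]
    have h2 : ∀ p : (Fin n → ℝ) × ℝ, ∑ i, (p.1 i : ℂ) * heis k (x p) (nablaFun k (ex i) t.1) u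
        = heis k (x p) (nablaFun k (p.1, 0) t.1) u := fun p => by
      rw [← heis_const_mul, ← funext fun u => nablaFun_horizontal k p.1 t.1 u]
    have hc : Continuous fun p : (Fin n → ℝ) × ℝ => heis k (x p) (nablaFun k (p.1, 0) t.1) u := by
      rw [← funext h2]
      exact continuous_finsetSum _ fun i _ => hcont i
    simp only [h2]
    rw [Measure.volume_eq_prod, setIntegral_prod _ (by
      rw [← Measure.volume_eq_prod]; exact hc.continuousOn.integrableOn_compact' hK hKm)]
    have h3 : ∀ a : Fin n → ℝ, ∫ σ in Set.Icc (0 : ℝ) 1, heis k (x (a, σ)) (nablaFun k (a, 0) t.1) u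
        = heis k (a, 0) t.1 u - t.1 u := fun a =>
      integral_heis_nabla k t.2.1 ((a, 0) : Vec n) u
    simp only [h3]
    have hc2 : Continuous fun a : Fin n → ℝ => heis k ((a, 0) : Vec n) t.1 u :=
      (contDiff_heis t.2.1 (V := fun a : Fin n → ℝ => ((a, 0) : Vec n)) (by fun_prop)
        contDiff_const).continuous
    rw [integral_sub (hc2.continuousOn.integrableOn_compact (isCompact_cube n))
      (integrableOn_const (isCompact_cube n).measure_lt_top.ne), setIntegral_const,
      volume_real_cube, one_smul]
    change (∫ a in cube n, (1 : ℂ) * heis k ((a, 0) : Vec n) t.1 u) - t.1 u = _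
    simp only [one_mul]
  have h := congrArg s.1 key
  rw [map_sub, map_sum, Finset.sum_eq_zero fun i _ => hs _ (ex_mem_polT i) _, sub_eq_zero] at h
  exact h

open MeasureTheory in
/-- If the integrals of a section over all Bohr-Sommerfeld fibres vanish, so does its average, on
these fibres. -/
lemma average_eq_zero {n k : ℕ} [NeZero k] {t : smoothSection n k}
    (ht : ∀ m : Fin n → ZMod k, (deltaT m).1 t = 0) (u : Vec n)
    (hu : ∀ i, ∃ j : ℤ, (k : ℝ) * u.2 i = j) : (average t).1 u = 0 := by
  have hk : (k : ℝ) ≠ 0 := by exact_mod_cast NeZero.ne k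
  have hkc : (k : ℂ) ≠ 0 := by exact_mod_cast NeZero.ne k
  -- on the fibre through `m/k` the value of the average is the value of `δ_m` on a translate of `t`
  have main : ∀ (m : Fin n → ZMod k) (x : Fin n → ℝ), (average t).1 (x, bsPoint m) = 0 := by
    intro m x
    have h1 : (deltaT m).1 (translate (x, 0) t) = 0 := by
      rw [flat_translate (fun v hv t => deltaT_nabla m v hv t) (show ((x, 0) : Vec n) ∈ polT n from rfl),
        ht]
    have h2 : starRingEnd ℂ ((average t).1 (x, bsPoint m))
        = ∫ a in cube n, phase 1 m a * starRingEnd ℂ (t.1 (a + x, bsPoint m)) := by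
      change starRingEnd ℂ (∫ a in cube n, (1 : ℂ) * heis k ((a, 0) : Vec n) t.1 (x, bsPoint m)) = _
      rw [← integral_conj]
      congr 1
      ext a
      have e : omega ((x, bsPoint m) : Vec n) (a, 0) = (∑ i, ((m i).val : ℝ) * a i) / k := by
        simp only [omega, bsPoint, Finset.sum_div]
        exact Finset.sum_congr rfl fun i _ => by simp; ring
      simp only [heis, e, one_mul, map_mul, ← Complex.exp_conj, phase, Prod.mk_add_mk, add_zero,
        add_comm x a]
      congr 2
      simp
      field_simp
    have h3 : (deltaT m).1 (translate (x, 0) t)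
        = Complex.exp (Real.pi * Complex.I * ((∑ i, ((m i).val : ℝ) * x i : ℝ) : ℂ)) *
          ∫ a in cube n, phase 1 m a * starRingEnd ℂ (t.1 (a + x, bsPoint m)) := by
      change ∫ a in cube n, phase 1 m a * starRingEnd ℂ (heis k (x, 0) t.1 (a, bsPoint m)) = _
      rw [← integral_const_mul]
      congr 1
      ext a
      have e : omega ((a, bsPoint m) : Vec n) (x, 0) = (∑ i, ((m i).val : ℝ) * x i) / k := by
        simp only [omega, bsPoint, Finset.sum_div]
        exact Finset.sum_congr rfl fun i _ => by simp; ring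
      have e2 : starRingEnd ℂ (Complex.exp (-(k * Real.pi * Complex.I *
          (((∑ i, ((m i).val : ℝ) * x i) / k : ℝ) : ℂ))))
          = Complex.exp (Real.pi * Complex.I * ((∑ i, ((m i).val : ℝ) * x i : ℝ) : ℂ)) := by
        rw [← Complex.exp_conj]
        congr 1
        simp
        field_simp
      simp only [heis, e, map_mul, e2, Prod.mk_add_mk, add_zero]
      ring
    rw [h3, ← h2] at h1
    exact (map_eq_zero _).1 ((mul_eq_zero.1 h1).resolve_left (Complex.exp_ne_zero _))
  choose j hj using hu
  let m : Fin n → ZMod k := fun i => (j i : ZMod k)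
  have hm : ∀ i, ((m i).val : ℤ) = j i % k := fun i => ZMod.val_intCast (j i)
  have h1 : u = (u.1, bsPoint m) + latVec ((0, fun i => j i / k) : Lat n) := by
    ext i
    · simp [latVec]
    · have h2 : ((m i).val : ℝ) + k * ((j i / k : ℤ) : ℝ) = j i := by
        have := Int.emod_add_mul_ediv (j i) k
        rw [← hm] at this
        exact_mod_cast this
      have h3 : u.2 i = (j i : ℝ) / k := by rw [← hj]; field_simp
      change u.2 i = ((m i).val : ℝ) / k + ((j i / k : ℤ) : ℝ)
      rw [h3, ← h2]
      field_simp
  rw [h1, (average t).2.2, main, mul_zero]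

/-! ### Retraction onto the Bohr-Sommerfeld fibres -/

/-- Division of `e^{-2πi u} - 1` by `u`, with an explicit smooth quotient. -/
lemma exp_sub_one_eq (u : ℝ) : Complex.exp (-(2 * Real.pi * Complex.I * (u : ℂ))) - 1
    = u * ∫ σ in Set.Icc (0 : ℝ) 1, -(2 * Real.pi * Complex.I) *
      Complex.exp (-(2 * Real.pi * Complex.I * ((σ * u : ℝ) : ℂ))) := by
  have hd : ∀ σ : ℝ, HasDerivAt (fun σ : ℝ => Complex.exp (-(2 * Real.pi * Complex.I * ((σ * u : ℝ) : ℂ))))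
      (u * (-(2 * Real.pi * Complex.I) *
        Complex.exp (-(2 * Real.pi * Complex.I * ((σ * u : ℝ) : ℂ))))) σ := by
    intro σ
    have h1 : HasDerivAt (fun σ : ℝ => ((σ * u : ℝ) : ℂ)) (u : ℂ) σ := by
      simpa using ((hasDerivAt_id σ).mul_const u).ofReal_comp
    convert! (h1.const_mul (2 * Real.pi * Complex.I : ℂ)).neg.cexp using 1
    simp only [Pi.neg_apply]
    ring
  have hc : Continuous fun σ : ℝ => (u : ℂ) * (-(2 * Real.pi * Complex.I) *
        Complex.exp (-(2 * Real.pi * Complex.I * ((σ * u : ℝ) : ℂ)))) := by fun_prop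
  rw [← MeasureTheory.integral_const_mul, MeasureTheory.integral_Icc_eq_integral_Ioc,
    ← intervalIntegral.integral_of_le zero_le_one,
    intervalIntegral.integral_eq_sub_of_hasDerivAt (fun σ _ => hd σ) (hc.intervalIntegrable _ _)]
  simp

lemma exp_eq_one_iff_int (y : ℝ) : Complex.exp (-(2 * Real.pi * Complex.I * (y : ℂ))) = 1 ↔
    ∃ j : ℤ, y = j := by
  rw [Complex.exp_eq_one_iff]
  have h2 : (2 * Real.pi * Complex.I : ℂ) ≠ 0 := Complex.two_pi_I_ne_zero
  constructor
  · rintro ⟨j, hj⟩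
    refine ⟨-j, ?_⟩
    have h3 : (2 * Real.pi * Complex.I : ℂ) * (y : ℂ) = (2 * Real.pi * Complex.I) * (-j : ℂ) := by
      linear_combination -hj
    have := mul_left_cancel₀ h2 h3
    exact_mod_cast this
  · rintro ⟨j, rfl⟩
    exact ⟨-j, by push_cast; ring⟩

/-- A smooth `1`-periodic `v` with `y + v(y)` locally constant near the integers; it is divisible
by `e^{-2πi y} - 1`, since that function has simple zeros. -/
lemma exists_staircase : ∃ (v : ℝ → ℝ) (q : ℝ → ℂ), ContDiff ℝ ∞ v ∧ ContDiff ℝ ∞ q ∧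
    (∀ (y : ℝ) (j : ℤ), v (y + j) = v y) ∧ (∀ (y : ℝ) (j : ℤ), q (y + j) = q y) ∧
    (∀ y : ℝ, (v y : ℂ) = (Complex.exp (-(2 * Real.pi * Complex.I * (y : ℂ))) - 1) * q y) ∧
    ∀ j : ℤ, ∀ᶠ y in nhds (j : ℝ), y + v y = j := by
  -- `β` is a periodic bump: it is `1` near the integers and `0` near the half-integers, where
  -- `y - round y` jumps
  let β : ℝ → ℝ := fun y => Real.smoothTransition (2 * Real.cos (2 * Real.pi * y))
  let v : ℝ → ℝ := fun y => -((y - round y) * β y)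
  let z : ℝ → ℂ := fun y => Complex.exp (-(2 * Real.pi * Complex.I * (y : ℂ)))
  let E : ℝ → ℂ := fun u => ∫ σ in Set.Icc (0 : ℝ) 1, -(2 * Real.pi * Complex.I) *
      Complex.exp (-(2 * Real.pi * Complex.I * ((σ * u : ℝ) : ℂ)))
  -- at the integers the quotient `v / (z - 1)` takes its limit value
  let q : ℝ → ℂ := fun y => if y = round y then -(E 0)⁻¹ else (z y - 1)⁻¹ * v y
  have hβ : ContDiff ℝ ∞ β := Real.smoothTransition.contDiff.comp
    (contDiff_const.mul (Real.contDiff_cos.comp (by fun_prop)))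
  have hz : ContDiff ℝ ∞ z :=
    (contDiff_const.mul (Complex.ofRealCLM.contDiff.comp contDiff_id)).neg.cexp
  have hE : ContDiff ℝ ∞ E := by
    refine contDiff_setIntegral_param MeasureTheory.volume isCompact_Icc measurableSet_Icc
      (F := fun u σ => -(2 * Real.pi * Complex.I) *
        Complex.exp (-(2 * Real.pi * Complex.I * ((σ * u : ℝ) : ℂ)))) ?_
    have h : ContDiff ℝ ∞ fun q : ℝ × ℝ => q.2 * q.1 := by fun_prop
    exact contDiff_const.mul (contDiff_const.mul (Complex.ofRealCLM.contDiff.comp h)).neg.cexp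
  have hE0 : E 0 ≠ 0 := by
    simp [E, MeasureTheory.measureReal_def, Complex.I_ne_zero, Real.pi_ne_zero]
  have hround : ∀ y : ℝ, Real.cos (2 * Real.pi * y) ≠ -1 → ∀ᶠ y' in nhds y, round y' = round y := by
    intro y hy
    have h1 : (round y : ℝ) - 1 / 2 ≠ y := by
      intro h
      refine hy ?_
      rw [← h, show 2 * Real.pi * ((round y : ℝ) - 1 / 2) = -Real.pi + round y * (2 * Real.pi) by ring,
        Real.cos_add_int_mul_two_pi, Real.cos_neg, Real.cos_pi]
    have h2 := Int.floor_le (y + 1 / 2)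
    have h3 := Int.lt_floor_add_one (y + 1 / 2)
    rw [← round_eq] at h2 h3
    have h4 : (round y : ℝ) - 1 / 2 < y := lt_of_le_of_ne (by linarith) h1
    filter_upwards [Ioo_mem_nhds h4 (by linarith : y < (round y : ℝ) + 1 / 2)] with y' hy'
    rw [round_eq y', Int.floor_eq_iff]
    constructor <;> linarith [hy'.1, hy'.2]
  have hv : ContDiff ℝ ∞ v := by
    rw [contDiff_iff_contDiffAt]
    intro y
    by_cases hy : Real.cos (2 * Real.pi * y) < 0
    · have h1 : ∀ᶠ y' in nhds y, Real.cos (2 * Real.pi * y') < 0 :=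
        (by fun_prop : Continuous fun y : ℝ => Real.cos (2 * Real.pi * y)).continuousAt.eventually_lt_const hy
      refine (contDiffAt_const (c := (0 : ℝ))).congr_of_eventuallyEq ?_
      filter_upwards [h1] with y' hy'
      simp only [v, β]
      rw [Real.smoothTransition.zero_of_nonpos (by linarith)]
      simp
    · have h1 := hround y (by intro h; rw [h] at hy; norm_num at hy)
      refine ((contDiff_id.sub (contDiff_const (c := (round y : ℝ)))).mul hβ).neg.contDiffAt.congr_of_eventuallyEq ?_
      filter_upwards [h1] with y' hy'
      simp [v, hy']
  have hnear : ∀ j : ℤ, ∀ᶠ y in nhds (j : ℝ), round y = j ∧ y + v y = j := by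
    intro j
    have hcos : Real.cos (2 * Real.pi * (j : ℝ)) = 1 := by
      rw [mul_comm]; exact Real.cos_int_mul_two_pi j
    have h1 := hround j (by rw [hcos]; norm_num)
    have h2 : ∀ᶠ y in nhds (j : ℝ), 1 / 2 < Real.cos (2 * Real.pi * y) :=
      (by fun_prop : Continuous fun y : ℝ => Real.cos (2 * Real.pi * y)).continuousAt.eventually_const_lt
        (by beta_reduce; rw [hcos]; norm_num)
    filter_upwards [h1, h2] with y hy hy2
    rw [round_intCast] at hy
    refine ⟨hy, ?_⟩
    simp only [v, β, hy]
    rw [Real.smoothTransition.one_of_one_le (by linarith)]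
    ring
  have hzint : ∀ y, z y = 1 ↔ y = round y := fun y => by
    rw [exp_eq_one_iff_int]
    constructor
    · rintro ⟨j, rfl⟩; simp
    · exact fun h => ⟨_, h⟩
  have hzper : ∀ (y : ℝ) (j : ℤ), z (y + j) = z y := fun y j => by
    simp only [z]
    rw [Complex.exp_eq_exp_iff_exists_int]
    exact ⟨-j, by push_cast; ring⟩
  have hvper : ∀ (y : ℝ) (j : ℤ), v (y + j) = v y := fun y j => by
    have : Real.cos (2 * Real.pi * (y + j)) = Real.cos (2 * Real.pi * y) := by
      rw [show 2 * Real.pi * (y + j) = 2 * Real.pi * y + j * (2 * Real.pi) by ring,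
        Real.cos_add_int_mul_two_pi]
    simp only [v, β, this, round_add_intCast]
    push_cast
    ring
  have hzE : ∀ (y : ℝ) (j : ℤ), z y - 1 = ((y - j : ℝ) : ℂ) * E (y - j) := fun y j => by
    have h := hzper (y - j) j
    rw [sub_add_cancel] at h
    rw [h]
    exact exp_sub_one_eq _
  refine ⟨v, q, hv, ?_, hvper, ?_, ?_, fun j => (hnear j).mono fun y hy => hy.2⟩
  · rw [contDiff_iff_contDiffAt]
    intro y
    by_cases hy : y = round y
    · obtain ⟨j, hj⟩ : ∃ j : ℤ, y = j := ⟨_, hy⟩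
      subst hj
      have hEj : ContDiffAt ℝ ∞ (fun y : ℝ => E (y - j)) (j : ℝ) :=
        (hE.comp (contDiff_id.sub contDiff_const)).contDiffAt
      refine (hEj.inv (by simpa using hE0)).neg.congr_of_eventuallyEq ?_
      filter_upwards [hnear j] with y hy
      change q y = -(E (y - j))⁻¹
      by_cases h : y = j
      · subst h; simp [q]
      · have h2 : ¬ y = round y := by rw [hy.1]; exact h
        have h3 : z y - 1 ≠ 0 := fun h' => h2 ((hzint y).1 (sub_eq_zero.1 h'))
        have h4 : v y = -(y - j) := by linarith [hy.2]
        have h5 := hzE y j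
        have h6 : ((y - j : ℝ) : ℂ) ≠ 0 := by
          rw [Complex.ofReal_ne_zero]; exact sub_ne_zero.2 h
        simp only [q, if_neg h2, h4]
        rw [h5, mul_inv]
        push_cast at h6 ⊢
        field_simp
    · have h1 : z y - 1 ≠ 0 := fun h' => hy ((hzint y).1 (sub_eq_zero.1 h'))
      have h2 : ∀ᶠ y' in nhds y, z y' - 1 ≠ 0 :=
        (hz.continuous.sub continuous_const).continuousAt.eventually_ne h1
      refine (((hz.sub contDiff_const).contDiffAt.inv h1).mul
        (Complex.ofRealCLM.contDiff.comp hv).contDiffAt).congr_of_eventuallyEq ?_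
      filter_upwards [h2] with y' hy'
      have : ¬ y' = round y' := fun h => hy' (sub_eq_zero.2 ((hzint y').2 h))
      simp [q, this]
  · intro y j
    simp only [q, hzper, hvper, round_add_intCast, Int.cast_add, add_left_inj]
  · intro y
    by_cases h : y = round y
    · have h1 : z y - 1 = 0 := sub_eq_zero.2 ((hzint y).2 h)
      change (v y : ℂ) = (z y - 1) * q y
      rw [h1, zero_mul]
      simp [v, sub_eq_zero.2 h]
    · have h1 : z y - 1 ≠ 0 := fun h' => h ((hzint y).1 (sub_eq_zero.1 h'))
      change (v y : ℂ) = (z y - 1) * q y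
      simp only [q, if_neg h]
      field_simp

lemma holonomy_eq_one_iff {n : ℕ} (k : ℕ) (i : Fin n) (u : Vec n) :
    holonomy k i u = 1 ↔ ∃ j : ℤ, (k : ℝ) * u.2 i = j :=
  exp_eq_one_iff_int _

/-- A flat distributional section kills the sections that vanish near the Bohr-Sommerfeld fibres:
such a section is a combination of the functions `holonomyᵢ - 1`, which have no common zero off these
fibres. -/
lemma flat_eq_zero_of_eventually {n k : ℕ} {s : distSection n k}
    (hs : ∀ v ∈ polT n, ∀ t : smoothSection n k, s.1 (nabla v t) = 0) (w : smoothSection n k)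
    (hw : ∀ u : Vec n, (∀ i, holonomy k i u = 1) → ∀ᶠ u' in nhds u, w.1 u' = 0) : s.1 w = 0 := by
  -- `ρ = ∑ |holonomyᵢ - 1|²` is positive off the fibres, and `w = ρ (w / ρ)`
  let ρ : Vec n → ℂ := fun u => ∑ i, (holonomy k i u - 1) * starRingEnd ℂ (holonomy k i u - 1)
  have hh : ∀ i, ContDiff ℝ ∞ fun u : Vec n => holonomy k i u - 1 := fun i =>
    (contDiff_holonomy k i).sub contDiff_const
  have hhc : ∀ i, ContDiff ℝ ∞ fun u : Vec n => starRingEnd ℂ (holonomy k i u - 1) := fun i =>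
    Complex.conjCLE.contDiff.comp (hh i)
  have hρ : ContDiff ℝ ∞ ρ := ContDiff.sum fun i _ => (hh i).mul (hhc i)
  have hρ0 : ∀ u, ρ u = 0 → ∀ i, holonomy k i u = 1 := by
    intro u hu i
    have h1 : ρ u = ((∑ i, Complex.normSq (holonomy k i u - 1) : ℝ) : ℂ) := by
      simp only [ρ, Complex.mul_conj, Complex.ofReal_sum]
    rw [h1, Complex.ofReal_eq_zero, Finset.sum_eq_zero_iff_of_nonneg
      (fun i _ => Complex.normSq_nonneg _)] at hu
    exact sub_eq_zero.1 (Complex.normSq_eq_zero.1 (hu i (Finset.mem_univ i)))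
  have hρp : ∀ u (l : Lat n), ρ (u + latVec l) = ρ u := fun u l => by
    simp only [ρ, holonomy_periodic]
  have hdiv : ContDiff ℝ ∞ fun u => w.1 u / ρ u := by
    rw [contDiff_iff_contDiffAt]
    intro u
    by_cases hu : ρ u = 0
    · refine (contDiffAt_const (c := (0 : ℂ))).congr_of_eventuallyEq ?_
      filter_upwards [hw u (hρ0 u hu)] with u' hu'
      simp [hu']
    · simp only [div_eq_mul_inv]
      exact w.2.1.contDiffAt.mul (hρ.contDiffAt.inv hu)
  let g : Fin n → smoothSection n k := fun i =>
    ⟨fun u => starRingEnd ℂ (holonomy k i u - 1) * (w.1 u / ρ u), (hhc i).mul hdiv, fun u l => by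
      simp only [holonomy_periodic, hρp, w.2.2]; ring⟩
  let h : Fin n → smoothSection n k := fun i =>
    ⟨fun u => (holonomy k i u - 1) * (g i).1 u, (hh i).mul (g i).2.1, fun u l => by
      simp only [holonomy_periodic, (g i).2.2]; ring⟩
  have hsum : w = ∑ i, h i := by
    ext u
    rw [Submodule.coe_sum, Finset.sum_apply]
    have h1 : ∑ i, (h i).1 u = ρ u * (w.1 u / ρ u) := by
      simp only [h, g, ρ, Finset.sum_mul, mul_assoc]
    rw [h1]
    by_cases hu : ρ u = 0
    · rw [(hw u (hρ0 u hu)).self_of_nhds, hu, zero_mul]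
    · field_simp
  rw [hsum, map_sum]
  exact Finset.sum_eq_zero fun i _ => flat_holonomy hs i (t := g i) fun u => rfl

open MeasureTheory in
/-- A flat distributional section kills the sections that vanish on the Bohr-Sommerfeld fibres. The
translation along the field `V` moves a neighbourhood of each fibre into the fibre, so the translate of
`w` vanishes near the fibres. The field is divisible by the functions `holonomyᵢ - 1`, so the translate
differs from `w` by a combination of these functions. -/
lemma flat_eq_zero_of_vanish {n k : ℕ} [NeZero k] {s : distSection n k}
    (hs : ∀ v ∈ polT n, ∀ t : smoothSection n k, s.1 (nabla v t) = 0) (w : smoothSection n k)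
    (hw : ∀ u : Vec n, (∀ i, holonomy k i u = 1) → w.1 u = 0) : s.1 w = 0 := by
  have hk : (k : ℝ) ≠ 0 := by exact_mod_cast NeZero.ne k
  obtain ⟨v, q, hv, hq, hvp, hqp, hvq, hnear⟩ := exists_staircase
  let V : Vec n → Vec n := fun u => (0, fun i => v (k * u.2 i) / k)
  have hki : ∀ i, ContDiff ℝ ∞ fun u : Vec n => k * u.2 i := fun i => by fun_prop
  have hV : ContDiff ℝ ∞ V :=
    contDiff_const.prodMk (contDiff_pi.2 fun i => (hv.comp (hki i)).div_const _)
  have hshift : ∀ (u : Vec n) (l : Lat n) i, (k : ℝ) * (u + latVec l).2 i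
      = k * u.2 i + ((k * l.2 i : ℤ) : ℝ) := fun u l i => by simp [latVec, mul_add]
  have hVp : ∀ u (l : Lat n), V (u + latVec l) = V u := fun u l => by
    simp only [V, hshift, hvp]
  let Q : Fin n → smoothTorus n := fun i => ⟨fun u => q (k * u.2 i) / k,
    (hq.comp (hki i)).div_const _, fun u l => by simp only [hshift, hqp]⟩
  have hX : ContDiff ℝ ∞ (Function.uncurry fun (σ : ℝ) (u : Vec n) => σ • V u) := by
    change ContDiff ℝ ∞ fun p : ℝ × Vec n => p.1 • V p.2
    exact contDiff_fst.smul (hV.comp contDiff_snd)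
  let J : Fin n → smoothSection n k := fun i =>
    mulSection (Q i) (heisIntegral (P := ℝ) (K := Set.Icc 0 1) isCompact_Icc measurableSet_Icc
      (φ := fun _ => 1) contDiff_const hX (fun σ u l => by simp only [hVp]) (nabla (ey i) w))
  let H : Fin n → smoothSection n k := fun i =>
    ⟨fun u => (holonomy k i u - 1) * (J i).1 u,
      ((contDiff_holonomy k i).sub contDiff_const).mul (J i).2.1, fun u l => by
      simp only [holonomy_periodic, (J i).2.2]; ring⟩
  have hH : ∀ i, s.1 (H i) = 0 := fun i => flat_holonomy hs i (t := J i) fun u => rfl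
  have key : translateField hV hVp w - w = ∑ i, H i := by
    ext u
    rw [Submodule.coe_sum, Finset.sum_apply]
    have h1 : heis k (V u) w.1 u - w.1 u
        = ∫ σ in Set.Icc (0 : ℝ) 1, heis k (σ • V u) (nablaFun k (V u) w.1) u :=
      (integral_heis_nabla k w.2.1 (V u) u).symm
    change heis k (V u) w.1 u - w.1 u = _
    have h2 : ∀ σ : ℝ, heis k (σ • V u) (nablaFun k (V u) w.1) u
        = ∑ i, ((v (k * u.2 i) / k : ℝ) : ℂ) * heis k (σ • V u) (nablaFun k (ey i) w.1) u := by
      intro σ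
      rw [← heis_const_mul]
      congr 1
      ext u'
      exact nablaFun_vertical k _ w.1 u'
    have hcont : ∀ i, Continuous fun σ : ℝ => ((v (k * u.2 i) / k : ℝ) : ℂ) *
        heis k (σ • V u) (nablaFun k (ey i) w.1) u := fun i =>
      continuous_const.mul (contDiff_heis (nabla (ey i) w).2.1
        (V := fun σ : ℝ => σ • V u) (by fun_prop) contDiff_const).continuous
    rw [h1]
    simp only [h2]
    rw [integral_finsetSum _ fun i _ => (hcont i).continuousOn.integrableOn_compact isCompact_Icc]
    refine Finset.sum_congr rfl fun i _ => ?_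
    rw [integral_const_mul]
    change _ = (holonomy k i u - 1) * ((q (k * u.2 i) / k) * ∫ σ in Set.Icc (0 : ℝ) 1,
      (1 : ℂ) * heis k (σ • V u) (nablaFun k (ey i) w.1) u)
    simp only [one_mul]
    rw [Complex.ofReal_div, hvq, holonomy]
    push_cast
    ring
  have h0 : s.1 (translateField hV hVp w) = 0 := by
    refine flat_eq_zero_of_eventually hs _ fun u hu => ?_
    have hint : ∀ i, ∃ j : ℤ, (k : ℝ) * u.2 i = j := fun i => (holonomy_eq_one_iff k i u).1 (hu i)
    choose j hj using hint
    have h1 : ∀ᶠ u' : Vec n in nhds u, ∀ i, k * u'.2 i + v (k * u'.2 i) = j i := by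
      rw [Filter.eventually_all]
      intro i
      have h2 : Filter.Tendsto (fun u' : Vec n => (k : ℝ) * u'.2 i) (nhds u) (nhds (j i : ℝ)) := by
        rw [← hj]
        exact (hki i).continuous.continuousAt
      exact h2.eventually (hnear (j i))
    filter_upwards [h1] with u' hu'
    change Complex.exp _ * w.1 (u' + V u') = 0
    rw [hw _ fun i => ?_, mul_zero]
    rw [holonomy_eq_one_iff]
    refine ⟨j i, ?_⟩
    rw [← hu' i]
    simp only [V, Prod.snd_add, Pi.add_apply]
    field_simp
  have h3 := congrArg s.1 key
  rw [map_sub, map_sum, Finset.sum_eq_zero fun i _ => hH i, h0, zero_sub, neg_eq_zero] at h3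
  exact h3

/-- The Bohr-Sommerfeld fibres carry all the flat distributional sections. The common kernel of the
finitely many functionals `δ_m` is contained in the kernel of `s`: if all `δ_m` vanish on `t`, the
average of `t` vanishes on the Bohr-Sommerfeld fibres. -/
lemma exists_eq_sum_deltaT {n k : ℕ} [NeZero k] {s : distSection n k}
    (hs : ∀ v ∈ polT n, ∀ t : smoothSection n k, s.1 (nabla v t) = 0) :
    ∃ c : (Fin n → ZMod k) → ℂ, s = ∑ m, c m • deltaT m := by
  -- conjugation turns antilinear functionals into linear ones
  let lin : (smoothSection n k →ₛₗ[starRingEnd ℂ] ℂ) → (smoothSection n k →ₗ[ℂ] ℂ) := fun f =>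
    { toFun := fun t => starRingEnd ℂ (f t)
      map_add' := fun t t' => by simp
      map_smul' := fun c t => by simp }
  have h : lin s.1 ∈ Submodule.span ℂ (Set.range fun m : Fin n → ZMod k => lin (deltaT m).1) := by
    refine mem_span_of_iInf_ker_le_ker fun t ht => ?_
    have ht' : ∀ m : Fin n → ZMod k, (deltaT m).1 t = 0 := fun m => by
      have := (Submodule.mem_iInf _).1 ht m
      exact (map_eq_zero (starRingEnd ℂ)).1 (LinearMap.mem_ker.1 this)
    rw [LinearMap.mem_ker]
    change starRingEnd ℂ (s.1 t) = 0
    rw [map_eq_zero, ← flat_average hs]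
    refine flat_eq_zero_of_vanish hs _ fun u hu => average_eq_zero ht' u fun i => ?_
    exact (holonomy_eq_one_iff k i u).1 (hu i)
  obtain ⟨c, hc⟩ := (Submodule.mem_span_range_iff_exists_fun ℂ).1 h
  refine ⟨fun m => starRingEnd ℂ (c m), Subtype.ext (LinearMap.ext fun t => ?_)⟩
  have h1 := congrArg (fun f : smoothSection n k →ₗ[ℂ] ℂ => starRingEnd ℂ (f t)) hc
  simp only [LinearMap.sum_apply, LinearMap.smul_apply, lin, LinearMap.coe_mk, AddHom.coe_mk,
    map_sum, smul_eq_mul, map_mul, Complex.conj_conj] at h1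
  rw [← h1]
  simp [LinearMap.sum_apply]

/-! ### Fourier transform on `ℝⁿ` -/

/-- The character `e^{2πi r}` of `ℝ`. -/
def expi (r : ℝ) : ℂ := Complex.exp (2 * Real.pi * Complex.I * (r : ℂ))

lemma expi_add (r r' : ℝ) : expi (r + r') = expi r * expi r' := by
  simp only [expi, ← Complex.exp_add]; congr 1; push_cast; ring

lemma expi_zero : expi 0 = 1 := by simp [expi]

lemma expi_int (j : ℤ) : expi j = 1 := by
  rw [expi, Complex.exp_eq_one_iff]
  exact ⟨j, by push_cast; ring⟩

lemma conj_expi (r : ℝ) : starRingEnd ℂ (expi r) = expi (-r) := by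
  rw [expi, expi, ← Complex.exp_conj]
  simp [map_ofNat]

lemma norm_expi (r : ℝ) : ‖expi r‖ = 1 := by
  rw [expi, Complex.norm_exp]
  simp

lemma expi_eq_one_iff (r : ℝ) : expi r = 1 ↔ ∃ j : ℤ, r = j := by
  have h := exp_eq_one_iff_int (-r)
  have e : expi r = Complex.exp (-(2 * Real.pi * Complex.I * ((-r : ℝ) : ℂ))) := by
    rw [expi]; congr 1; push_cast; ring
  rw [e, h]
  constructor
  · rintro ⟨j, hj⟩; exact ⟨-j, by push_cast; linarith⟩
  · rintro ⟨j, rfl⟩; exact ⟨-j, by push_cast; ring⟩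

lemma contDiff_expi : ContDiff ℝ ∞ expi :=
  (contDiff_const.mul Complex.ofRealCLM.contDiff).cexp

lemma expi_add_int (r : ℝ) (j : ℤ) : expi (r + j) = expi r := by
  rw [expi_add, expi_int, mul_one]

/-- The Fourier transform on `ℝⁿ`. -/
def ft {n : ℕ} (G : (Fin n → ℝ) → ℂ) (ξ : Fin n → ℝ) : ℂ := ∫ x, G x * expi (-∑ i, ξ i * x i)

open MeasureTheory FourierTransform in
/-- Smooth functions with compact support have an integrable Fourier transform, and the inversion
formula holds for them. -/
lemma ft_inversion {n : ℕ} {G : (Fin n → ℝ) → ℂ} (hG : ContDiff ℝ ∞ G) (hGc : HasCompactSupport G) :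
    Integrable (ft G) ∧ ∀ x, ∫ ξ, ft G ξ * expi (∑ i, ξ i * x i) = G x := by
  let e := PiLp.continuousLinearEquiv 2 ℝ (fun _ : Fin n => ℝ)
  have hmp := PiLp.volume_preserving_ofLp (Fin n)
  have hemb := (MeasurableEquiv.toLp 2 (Fin n → ℝ)).symm.measurableEmbedding
  let g : SchwartzMap (EuclideanSpace ℝ (Fin n)) ℂ :=
    (hGc.comp_homeomorph e.toHomeomorph).toSchwartzMap (hG.comp e.contDiff)
  have hinner : ∀ v w : EuclideanSpace ℝ (Fin n), inner ℝ v w = ∑ i, w i * v i := fun v w => by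
    rw [PiLp.inner_apply]
    rfl
  have hfg : ∀ w : EuclideanSpace ℝ (Fin n), 𝓕 (g : EuclideanSpace ℝ (Fin n) → ℂ) w = ft G w.ofLp := by
    intro w
    rw [Real.fourier_eq', ft, ← hmp.integral_comp hemb]
    congr 1
    ext v
    rw [hinner, smul_eq_mul, mul_comm]
    change G v.ofLp * _ = G v.ofLp * _
    rw [expi]
    congr 2
    push_cast
    ring
  have hint : Integrable (ft G) := by
    rw [← hmp.integrable_comp_emb hemb]
    have h1 : Integrable (𝓕 (g : EuclideanSpace ℝ (Fin n) → ℂ)) := by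
      rw [← SchwartzMap.fourier_coe]; exact (𝓕 g).integrable
    exact h1.congr (Filter.Eventually.of_forall hfg)
  refine ⟨hint, fun x => ?_⟩
  have h1 : Integrable (𝓕 (g : EuclideanSpace ℝ (Fin n) → ℂ)) := by
    rw [← SchwartzMap.fourier_coe]; exact (𝓕 g).integrable
  have h2 := congrFun (Continuous.fourierInv_fourier_eq g.continuous g.integrable h1) (WithLp.toLp 2 x)
  rw [Real.fourierInv_eq'] at h2
  change _ = G x at h2
  rw [← h2, ← hmp.integral_comp hemb]
  congr 1
  ext v
  rw [hfg, hinner, smul_eq_mul, mul_comm, expi]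
  congr 2
  simp only [mul_comm (x _)]
  push_cast
  ring

/-! ### Localized Fourier transforms of the Bohr-Sommerfeld distributions -/

open MeasureTheory in
/-- Unfolding of a locally finite sum over the lattice `ℤⁿ × ℤⁿ`, in the first variable. -/
lemma integral_cube_finsum {n : ℕ} {ψ : (Fin n → ℤ) → (Fin n → ℝ) → ℂ} (hψ : ∀ b, Integrable (ψ b))
    (A B : Finset (Fin n → ℤ))
    (hs : ∀ x ∈ cube n, ∀ a b, ψ b (x + intVec a) ≠ 0 → a ∈ A ∧ b ∈ B) :
    ∫ x in cube n, ∑ᶠ l : Lat n, ψ l.2 (x + intVec l.1) = ∑ b ∈ B, ∫ x, ψ b x := by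
  have h1 : ∀ x ∈ cube n, ∑ᶠ l : Lat n, ψ l.2 (x + intVec l.1)
      = ∑ b ∈ B, ∑ a ∈ A, ψ b (x + intVec a) := by
    intro x hx
    rw [finsum_eq_sum_of_support_subset (s := A ×ˢ B), Finset.sum_product, Finset.sum_comm]
    intro l hl
    have := hs x hx l.1 l.2 hl
    simpa using this
  have hi : ∀ b a, IntegrableOn (fun x => ψ b (x + intVec a)) (cube n) := fun b a =>
    ((hψ b).comp_add_right (intVec a)).integrableOn
  rw [setIntegral_congr_fun (measurableSet_cube n) h1,
    integral_finsetSum _ fun b _ => integrable_finsetSum _ fun a _ => hi b a]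
  refine Finset.sum_congr rfl fun b _ => ?_
  rw [integral_finsetSum _ fun a _ => hi b a]
  refine (hasSum_sum_of_ne_finset_zero fun a ha => ?_).unique (hasSum_integral_cube_translate (hψ b))
  refine setIntegral_eq_zero_of_forall_eq_zero fun x hx => ?_
  by_contra h
  exact ha (hs x hx a b h).1

/-- Only finitely many lattice translates of the fundamental domain meet the support of a test
function. -/
lemma TestFn.exists_finset {n : ℕ} (χ : TestFn n) : ∃ A B : Finset (Fin n → ℤ),
    ∀ u ∈ cube n ×ˢ cube n, ∀ l : Lat n, χ.toFun (u + latVec l) ≠ 0 → l.1 ∈ A ∧ l.2 ∈ B := by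
  classical
  obtain ⟨R, hR⟩ := χ.compact.isCompact.isBounded.subset_closedBall (0 : Vec n)
  have hfin := finite_lat (n := n) (R + 1)
  refine ⟨hfin.toFinset.image Prod.fst, hfin.toFinset.image Prod.snd, fun u hu l hl => ?_⟩
  have h2 := hR (subset_tsupport _ hl)
  rw [mem_closedBall_zero_iff] at h2
  have hc : ∀ x ∈ cube n, ‖x‖ ≤ 1 := fun x hx => by
    refine (pi_norm_le_iff_of_nonneg zero_le_one).2 fun i => ?_
    have h0 := hx.1 i
    have h1 := hx.2 i
    simp only [Pi.zero_apply, Pi.one_apply] at h0 h1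
    rw [Real.norm_eq_abs, abs_le]
    exact ⟨by linarith, h1⟩
  have h3 : ‖u‖ ≤ 1 := by
    rw [Prod.norm_def]
    exact max_le (hc _ hu.1) (hc _ hu.2)
  have h4 : ‖latVec l‖ ≤ ‖u + latVec l‖ + ‖u‖ := by
    simpa using norm_sub_le (u + latVec l) u
  have h5 : l ∈ hfin.toFinset := by
    rw [Set.Finite.mem_toFinset]
    change ‖latVec l‖ ≤ R + 1
    linarith
  exact ⟨Finset.mem_image_of_mem _ h5, Finset.mem_image_of_mem _ h5⟩

/-- The conjugate of the section on which `localFourier` evaluates a distribution, as a sum over the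
lattice. -/
lemma conj_periodize {n k : ℕ} (χ : TestFn n) (ζ u : Vec n) :
    starRingEnd ℂ ((periodize k (modulate χ ζ)).1 u) = ∑ᶠ l : Lat n, multiplier k u l *
      (χ.toFun (u + latVec l) * expi (-(∑ i, ζ.1 i * (u + latVec l).1 i
        + ∑ i, ζ.2 i * (u + latVec l).2 i))) := by
  change starRingEnd ℂ (∑ᶠ l : Lat n, starRingEnd ℂ (multiplier k u l) *
    (starRingEnd ℂ (χ.toFun (u + latVec l)) * expi _)) = _
  have h := AddEquiv.map_finsum (starRingAut (R := ℂ) : ℂ ≃+* ℂ).toAddEquiv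
    (fun l : Lat n => starRingEnd ℂ (multiplier k u l) *
    (starRingEnd ℂ (χ.toFun (u + latVec l)) *
      expi (∑ i, (ζ.1 i * (u + latVec l).1 i + ζ.2 i * (u + latVec l).2 i))))
  refine h.trans (finsum_congr fun l => ?_)
  change starRingEnd ℂ _ = _
  rw [map_mul, map_mul, Complex.conj_conj, Complex.conj_conj, conj_expi, Finset.sum_add_distrib]

lemma neg_one_zpow_pow (j : ℤ) (k : ℕ) : (((-1 : ℂ) ^ j) ^ k) = expi (k * j / 2) := by
  have h : (-1 : ℂ) = expi (1 / 2) := by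
    rw [expi, ← Complex.exp_pi_mul_I]
    congr 1
    push_cast
    ring
  rw [h, expi, ← Complex.exp_int_mul, ← Complex.exp_nat_mul, expi]
  congr 1
  push_cast
  ring

lemma phase_eq_expi {n k : ℕ} (c : ℤ) (m : Fin n → ZMod k) (x : Fin n → ℝ) :
    phase c m x = expi (c * (∑ i, ((m i).val : ℝ) * x i) / 2) := by
  rw [phase, expi]
  congr 1
  push_cast
  ring

lemma multiplier_eq_expi {n : ℕ} (k : ℕ) (u : Vec n) (l : Lat n) :
    multiplier k u l = expi (k * (∑ i, (l.1 i : ℝ) * l.2 i) / 2 - k * omega u (latVec l) / 2) := by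
  rw [multiplier, neg_one_zpow_pow, sub_eq_add_neg, expi_add]
  congr 1
  · congr 1
    push_cast
    ring
  · rw [expi]
    congr 1
    push_cast
    ring

/-- The density of the pull-back to `ℝ²ⁿ` of `χ f δ_m` along the component `{y = m/k + b}` of its
support. -/
def densityT {n k : ℕ} (χ : TestFn n) (f : smoothTorus n) (m : Fin n → ZMod k) (b : Fin n → ℤ)
    (x : Fin n → ℝ) : ℂ :=
  expi ((∑ i, (((m i).val : ℝ) + k * b i) * x i) / 2) * f.1 (x, bsPoint m) *
    χ.toFun (x, bsPoint m + intVec b)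

/-- The density of the pull-back to `ℝ²ⁿ` of `χ δ̌_j` along the component `{x = j/k + a}` of its
support. -/
def densityTcheck {n k : ℕ} (χ : TestFn n) (j : Fin n → ZMod k) (a : Fin n → ℤ)
    (y : Fin n → ℝ) : ℂ :=
  expi (-(∑ i, (((j i).val : ℝ) + k * a i) * y i) / 2) * χ.toFun (bsPoint j + intVec a, y)

lemma densityT_smooth {n k : ℕ} (χ : TestFn n) (f : smoothTorus n) (m : Fin n → ZMod k)
    (b : Fin n → ℤ) : ContDiff ℝ ∞ (densityT χ f m b) ∧ HasCompactSupport (densityT χ f m b) := by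
  constructor
  · have h : ContDiff ℝ ∞ fun x : Fin n → ℝ => (∑ i, (((m i).val : ℝ) + k * b i) * x i) / 2 :=
      (ContDiff.sum fun i _ => by fun_prop).div_const _
    exact ((contDiff_expi.comp h).mul (f.2.1.comp (by fun_prop))).mul (χ.smooth.comp (by fun_prop))
  · have he : Topology.IsClosedEmbedding fun x : Fin n → ℝ => ((x, bsPoint m + intVec b) : Vec n) :=
      Function.LeftInverse.isClosedEmbedding (f := Prod.fst) (fun _ => rfl) continuous_fst (by fun_prop)
    exact (χ.compact.comp_isClosedEmbedding he).mul_left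

lemma densityTcheck_smooth {n k : ℕ} (χ : TestFn n) (j : Fin n → ZMod k)
    (a : Fin n → ℤ) :
    ContDiff ℝ ∞ (densityTcheck χ j a) ∧ HasCompactSupport (densityTcheck χ j a) := by
  constructor
  · have h : ContDiff ℝ ∞ fun x : Fin n → ℝ => -(∑ i, (((j i).val : ℝ) + k * a i) * x i) / 2 :=
      (ContDiff.sum fun i _ => by fun_prop).neg.div_const _
    exact (contDiff_expi.comp h).mul (χ.smooth.comp (by fun_prop))
  · have he : Topology.IsClosedEmbedding fun y : Fin n → ℝ => ((bsPoint j + intVec a, y) : Vec n) :=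
      Function.LeftInverse.isClosedEmbedding (f := Prod.snd) (fun _ => rfl) continuous_snd (by fun_prop)
    exact (χ.compact.comp_isClosedEmbedding he).mul_left

lemma torus_add_intVec {n : ℕ} (f : smoothTorus n) (x y : Fin n → ℝ) (a : Fin n → ℤ) :
    f.1 (x + intVec a, y) = f.1 (x, y) := by
  have h : ((x + intVec a, y) : Vec n) = (x, y) + latVec ((a, 0) : Lat n) := by
    ext i <;> simp [latVec, intVec]
  rw [h, f.2.2]

open MeasureTheory in
lemma integrable_mul_expi {n : ℕ} {G : (Fin n → ℝ) → ℂ} (hG : Continuous G) (hc : HasCompactSupport G)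
    {r : (Fin n → ℝ) → ℝ} (hr : Continuous r) : Integrable fun x => G x * expi (r x) :=
  (hG.mul (contDiff_expi.continuous.comp hr)).integrable_of_hasCompactSupport hc.mul_right

open MeasureTheory in
/-- The localized Fourier transform of `f δ_m` is a finite sum over the components `{y = m/k + b}` of
the support that meet the support of the cut-off: along each it is the Fourier transform of the density
in `x`, times a character in the dual variable of `y`. -/
lemma localFourier_deltaT {n k : ℕ} [NeZero k] (χ : TestFn n) (f : smoothTorus n)
    (m : Fin n → ZMod k) (A B : Finset (Fin n → ℤ))
    (hAB : ∀ u ∈ cube n ×ˢ cube n, ∀ l : Lat n, χ.toFun (u + latVec l) ≠ 0 → l.1 ∈ A ∧ l.2 ∈ B)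
    (ζ : Vec n) :
    localFourier χ (distMul f (deltaT m)) ζ = ∑ b ∈ B,
      ft (densityT χ f m b) ζ.1 * expi (-∑ i, ζ.2 i * (bsPoint m + intVec b) i) := by
  have hk : (k : ℝ) ≠ 0 := by exact_mod_cast NeZero.ne k
  let ψ : (Fin n → ℤ) → (Fin n → ℝ) → ℂ := fun b x =>
    densityT χ f m b x * expi (-∑ i, ζ.1 i * x i) * expi (-∑ i, ζ.2 i * (bsPoint m + intVec b) i)
  have hψ : ∀ b, Integrable (ψ b) := fun b =>
    (integrable_mul_expi (densityT_smooth χ f m b).1.continuous (densityT_smooth χ f m b).2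
      (by fun_prop)).mul_const _
  have h1 : ∀ b, ∫ x, ψ b x
      = ft (densityT χ f m b) ζ.1 * expi (-∑ i, ζ.2 i * (bsPoint m + intVec b) i) := fun b =>
    integral_mul_const _ _
  simp only [← h1]
  rw [← integral_cube_finsum hψ A B]
  · change ∫ x in cube n, phase 1 m x * starRingEnd ℂ (starRingEnd ℂ (f.1 (x, bsPoint m)) *
      (periodize k (modulate χ ζ)).1 (x, bsPoint m)) = _
    congr 1
    ext x
    rw [map_mul, Complex.conj_conj, conj_periodize, ← mul_assoc, ← smul_eq_mul, smul_finsum]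
    refine finsum_congr fun l => ?_
    have e1 : ((x, bsPoint m) : Vec n) + latVec l = (x + intVec l.1, bsPoint m + intVec l.2) := rfl
    have e2 : f.1 (x + intVec l.1, bsPoint m) = f.1 (x, bsPoint m) :=
      torus_add_intVec f _ _ _
    have e3 : phase 1 m x * multiplier k (x, bsPoint m) l
        = expi ((∑ i, (((m i).val : ℝ) + k * l.2 i) * (x + intVec l.1) i) / 2) := by
      rw [phase_eq_expi, multiplier_eq_expi, ← expi_add,
        ← expi_add_int _ (∑ i, ((m i).val : ℤ) * l.1 i)]
      congr 1
      have h2 : k * omega ((x, bsPoint m) : Vec n) (latVec l)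
          = ∑ i, (((m i).val : ℝ) * l.1 i - k * (x i * l.2 i)) := by
        simp only [omega, Finset.mul_sum, bsPoint, latVec]
        refine Finset.sum_congr rfl fun i _ => ?_
        field_simp
      rw [h2]
      push_cast
      simp only [Finset.mul_sum, Finset.sum_div, ← Finset.sum_add_distrib, ← Finset.sum_sub_distrib]
      refine Finset.sum_congr rfl fun i _ => ?_
      simp only [intVec, Pi.add_apply]
      ring
    rw [e1, smul_eq_mul]
    simp only [ψ, densityT]
    rw [← e3, e2, neg_add, expi_add]
    ring
  · intro x hx a b hab
    refine hAB (x, bsPoint m) ⟨hx, bsPoint_mem m⟩ (a, b) ?_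
    exact right_ne_zero_of_mul (left_ne_zero_of_mul (left_ne_zero_of_mul hab))

open MeasureTheory in
/-- As `localFourier_deltaT`, with the roles of `x` and `y` exchanged. -/
lemma localFourier_deltaTcheck {n k : ℕ} [NeZero k] (χ : TestFn n)
    (j : Fin n → ZMod k) (A B : Finset (Fin n → ℤ))
    (hAB : ∀ u ∈ cube n ×ˢ cube n, ∀ l : Lat n, χ.toFun (u + latVec l) ≠ 0 → l.1 ∈ A ∧ l.2 ∈ B)
    (ζ : Vec n) :
    localFourier χ (deltaTcheck j) ζ = ∑ a ∈ A,
      ft (densityTcheck χ j a) ζ.2 * expi (-∑ i, ζ.1 i * (bsPoint j + intVec a) i) := by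
  have hk : (k : ℝ) ≠ 0 := by exact_mod_cast NeZero.ne k
  let ψ : (Fin n → ℤ) → (Fin n → ℝ) → ℂ := fun a y =>
    densityTcheck χ j a y * expi (-∑ i, ζ.2 i * y i) * expi (-∑ i, ζ.1 i * (bsPoint j + intVec a) i)
  have hψ : ∀ a, Integrable (ψ a) := fun a =>
    (integrable_mul_expi (densityTcheck_smooth χ j a).1.continuous (densityTcheck_smooth χ j a).2
      (by fun_prop)).mul_const _
  have h1 : ∀ a, ∫ y, ψ a y
      = ft (densityTcheck χ j a) ζ.2 * expi (-∑ i, ζ.1 i * (bsPoint j + intVec a) i) := fun a =>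
    integral_mul_const _ _
  simp only [← h1]
  rw [← integral_cube_finsum hψ B A]
  · change ∫ y in cube n, phase (-1) j y * starRingEnd ℂ
      ((periodize k (modulate χ ζ)).1 (bsPoint j, y)) = _
    congr 1
    ext y
    rw [conj_periodize, ← smul_eq_mul, smul_finsum, ← finsum_comp_equiv (Equiv.prodComm _ _)]
    refine finsum_congr fun l => ?_
    have e1 : ((bsPoint j, y) : Vec n) + latVec (l.2, l.1)
        = (bsPoint j + intVec l.2, y + intVec l.1) := rfl
    have e3 : phase (-1) j y * multiplier k (bsPoint j, y) (l.2, l.1)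
        = expi (-(∑ i, (((j i).val : ℝ) + k * l.2 i) * (y + intVec l.1) i) / 2) := by
      rw [phase_eq_expi, multiplier_eq_expi, ← expi_add,
        ← expi_add_int _ (-∑ i, (((j i).val : ℤ) * l.1 i + k * l.1 i * l.2 i))]
      congr 1
      have h2 : k * omega ((bsPoint j, y) : Vec n) (latVec (l.2, l.1))
          = ∑ i, (k * (y i * l.2 i) - ((j i).val : ℝ) * l.1 i) := by
        simp only [omega, Finset.mul_sum, bsPoint, latVec]
        refine Finset.sum_congr rfl fun i _ => ?_
        field_simp
      rw [h2]
      push_cast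
      simp only [Finset.mul_sum, Finset.sum_div, ← Finset.sum_add_distrib, ← Finset.sum_sub_distrib,
        ← Finset.sum_neg_distrib]
      refine Finset.sum_congr rfl fun i _ => ?_
      simp only [intVec, Pi.add_apply]
      ring
    simp only [Equiv.prodComm_apply, Prod.swap]
    rw [e1, smul_eq_mul]
    simp only [ψ, densityTcheck]
    rw [← e3, neg_add, expi_add]
    ring
  · intro y hy b a hab
    have := hAB (bsPoint j, y) ⟨bsPoint_mem j, hy⟩ (a, b)
      (right_ne_zero_of_mul (left_ne_zero_of_mul (left_ne_zero_of_mul hab)))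
    exact this.symm

open MeasureTheory in
/-- The pairing of Bohr-Sommerfeld distributions of the two polarizations. The two fibres meet in one
point of `X`, where Fourier inversion evaluates the densities; the sum over its lifts to `ℝ²ⁿ` is `1` by
the assumption on the cut-offs. -/
lemma hasPairing_deltaT {n k : ℕ} [NeZero k] (f : smoothTorus n) (m j : Fin n → ZMod k) :
    HasPairing (distMul f (deltaT m)) (deltaTcheck j)
      (f.1 (bsPoint j, bsPoint m) * character m j) := by
  classical
  have hk : (k : ℝ) ≠ 0 := by exact_mod_cast NeZero.ne k
  intro χ χ' hχ
  obtain ⟨A, B, hAB⟩ := χ.exists_finset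
  obtain ⟨A', B', hAB'⟩ := χ'.exists_finset
  have hT := fun b => ft_inversion (densityT_smooth χ f m b).1 (densityT_smooth χ f m b).2
  have hC := fun a => ft_inversion (densityTcheck_smooth χ' j a).1 (densityTcheck_smooth χ' j a).2
  let P : (Fin n → ℤ) → (Fin n → ℤ) → (Fin n → ℝ) → ℂ := fun b a ξ =>
    ft (densityT χ f m b) ξ * expi (∑ i, ξ i * (bsPoint j + intVec a) i)
  let R : (Fin n → ℤ) → (Fin n → ℤ) → (Fin n → ℝ) → ℂ := fun b a η =>
    starRingEnd ℂ (ft (densityTcheck χ' j a) η * expi (∑ i, η i * (bsPoint m + intVec b) i))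
  have hbdd : ∀ (F : (Fin n → ℝ) → ℂ) (x : Fin n → ℝ), Integrable F →
      Integrable fun ξ => F ξ * expi (∑ i, ξ i * x i) := fun F x hF => by
    refine hF.mul_bdd (c := 1) (Continuous.aestronglyMeasurable ?_)
      (Filter.Eventually.of_forall fun ξ => (norm_expi _).le)
    exact contDiff_expi.continuous.comp (by fun_prop)
  have hP : ∀ b a, Integrable (P b a) := fun b a => hbdd _ _ (hT b).1
  have hR : ∀ b a, Integrable (R b a) := fun b a =>
    (Complex.conjCLE.integrable_comp_iff).2 (hbdd _ _ (hC a).1)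
  have hprod : ∀ ζ : Vec n, localFourier χ (distMul f (deltaT m)) ζ *
      starRingEnd ℂ (localFourier χ' (deltaTcheck j) ζ) = ∑ b ∈ B, ∑ a ∈ A', P b a ζ.1 * R b a ζ.2 := by
    intro ζ
    rw [localFourier_deltaT χ f m A B hAB, localFourier_deltaTcheck χ' j A' B' hAB', map_sum,
      Finset.sum_mul_sum]
    refine Finset.sum_congr rfl fun b _ => Finset.sum_congr rfl fun a _ => ?_
    simp only [P, R, map_mul, conj_expi, neg_neg]
    ring
  have hPR : ∀ b a, Integrable fun ζ : Vec n => P b a ζ.1 * R b a ζ.2 := fun b a =>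
    (hP b a).mul_prod (hR b a)
  simp only [hprod]
  refine ⟨integrable_finsetSum _ fun b _ => integrable_finsetSum _ fun a _ => hPR b a, ?_⟩
  rw [integral_finsetSum _ fun b _ => integrable_finsetSum _ fun a _ => hPR b a]
  have hval : ∀ b a, ∫ ζ : Vec n, P b a ζ.1 * R b a ζ.2
      = f.1 (bsPoint j, bsPoint m) * character m j * (χ.toFun ((bsPoint j, bsPoint m) + latVec (a, b)) *
        starRingEnd ℂ (χ'.toFun ((bsPoint j, bsPoint m) + latVec (a, b)))) := by
    intro b a
    rw [Measure.volume_eq_prod, integral_prod_mul, (hT b).2, integral_conj, (hC a).2]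
    have e1 : ((bsPoint j, bsPoint m) : Vec n) + latVec (a, b)
        = (bsPoint j + intVec a, bsPoint m + intVec b) := rfl
    have e2 : f.1 (bsPoint j + intVec a, bsPoint m) = f.1 (bsPoint j, bsPoint m) :=
      torus_add_intVec f _ _ _
    have e3 : expi ((∑ i, (((m i).val : ℝ) + k * b i) * (bsPoint j + intVec a) i) / 2) *
        expi ((∑ i, (((j i).val : ℝ) + k * a i) * (bsPoint m + intVec b) i) / 2) = character m j := by
      have h1 : character m j = expi ((∑ i, ((m i).val : ℝ) * (j i).val) / k) := by
        rw [character, expi]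
        congr 1
        push_cast
        ring
      rw [h1, ← expi_add, ← expi_add_int ((∑ i, ((m i).val : ℝ) * (j i).val) / k)
        (∑ i, ((m i).val * a i + b i * (j i).val + k * a i * b i))]
      congr 1
      push_cast
      simp only [Finset.sum_div, ← Finset.sum_add_distrib]
      refine Finset.sum_congr rfl fun i _ => ?_
      simp only [intVec, Pi.add_apply, bsPoint]
      field_simp
      ring
    rw [e1, ← e3, densityT, densityTcheck, e2, map_mul, conj_expi, neg_div, neg_neg]
    ring
  have h2 : ∀ b ∈ B, ∫ ζ : Vec n, ∑ a ∈ A', P b a ζ.1 * R b a ζ.2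
      = ∑ a ∈ A', ∫ ζ : Vec n, P b a ζ.1 * R b a ζ.2 := fun b _ =>
    integral_finsetSum _ fun a _ => hPR b a
  rw [Finset.sum_congr rfl h2]
  simp only [hval, ← Finset.mul_sum]
  have h3 := hχ (bsPoint j, bsPoint m)
  rw [finsum_eq_sum_of_support_subset (s := A' ×ˢ B), Finset.sum_product, Finset.sum_comm] at h3
  · rw [h3, mul_one]
  · intro l hl
    have hc : ((bsPoint j, bsPoint m) : Vec n) ∈ cube n ×ˢ cube n := ⟨bsPoint_mem j, bsPoint_mem m⟩
    have h4 := (hAB _ hc l (left_ne_zero_of_mul hl)).2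
    have h5 := (hAB' _ hc l (fun h => right_ne_zero_of_mul hl (by rw [h, map_zero]))).1
    simp [h4, h5]

/-! ### Cut-offs and the calculus of the pairing -/

/-- There are cut-offs as in the definition of the pairing. -/
lemma exists_cutoffs (n : ℕ) : ∃ χ χ' : TestFn n,
    ∀ u, ∑ᶠ l : Lat n, χ.toFun (u + latVec l) * starRingEnd ℂ (χ'.toFun (u + latVec l)) = 1 := by
  -- the bump is positive on the ball of radius `3`, which contains a fundamental domain
  let b : ContDiffBump (0 : Vec n) := ⟨2, 3, by norm_num, by norm_num⟩
  have hb : ContDiff ℝ ∞ fun u : Vec n => ((b u : ℝ) : ℂ) := Complex.ofRealCLM.contDiff.comp b.contDiff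
  have hbc : HasCompactSupport fun u : Vec n => ((b u : ℝ) : ℂ) :=
    b.hasCompactSupport.comp_left Complex.ofReal_zero
  let φ : TestFn n := ⟨fun u => ((b u : ℝ) : ℂ) * ((b u : ℝ) : ℂ), hb.mul hb, hbc.mul_right⟩
  -- for `k = 0` the line bundle is trivial, and the sum over the lattice is a periodic function
  let S := periodize 0 φ
  have hS : ∀ u, S.1 u = ∑ᶠ l : Lat n, ((b (u + latVec l) : ℝ) : ℂ) * ((b (u + latVec l) : ℝ) : ℂ) := by
    intro u
    refine finsum_congr fun l => ?_
    simp [φ, multiplier]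
  have hSper : ∀ u (l : Lat n), S.1 (u + latVec l) = S.1 u := fun u l => by
    rw [S.2.2]; simp [multiplier]
  have hS0 : ∀ u, S.1 u ≠ 0 := by
    intro u
    let l₀ : Lat n := (fun i => -⌊u.1 i⌋, fun i => -⌊u.2 i⌋)
    have h1 : (0 : ℝ) < b (u + latVec l₀) := by
      refine b.pos_of_mem_ball ?_
      rw [mem_ball_zero_iff, Prod.norm_def]
      have : ∀ x : Fin n → ℝ, ‖x + fun i => ((-⌊x i⌋ : ℤ) : ℝ)‖ ≤ 1 := fun x => by
        refine (pi_norm_le_iff_of_nonneg zero_le_one).2 fun i => ?_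
        rw [Real.norm_eq_abs, abs_le]
        have h2 := Int.floor_le (x i)
        have h3 := Int.lt_floor_add_one (x i)
        simp only [Pi.add_apply]
        push_cast
        constructor <;> linarith
      exact (max_le (this u.1) (this u.2)).trans_lt (by norm_num [b])
    have hfs : (Function.support fun l : Lat n => b (u + latVec l) * b (u + latVec l)).Finite := by
      refine (finite_lat (n := n) (3 + ‖u‖)).subset fun l hl => ?_
      have h2 : u + latVec l ∈ Function.support b := left_ne_zero_of_mul hl
      rw [b.support_eq, mem_ball_zero_iff] at h2
      have h3 : ‖latVec l‖ ≤ ‖u + latVec l‖ + ‖u‖ := by simpa using norm_sub_le (u + latVec l) u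
      change ‖latVec l‖ ≤ _
      exact h3.trans (by gcongr)
    have h4 : S.1 u = ((∑ᶠ l : Lat n, b (u + latVec l) * b (u + latVec l) : ℝ) : ℂ) := by
      rw [hS, finsum_eq_sum_of_support_subset _ (s := hfs.toFinset) (by
        intro l hl
        rw [Set.Finite.coe_toFinset]
        intro h
        apply hl
        simp only
        rw [← Complex.ofReal_mul]
        exact Complex.ofReal_eq_zero.2 h), finsum_eq_sum_of_support_subset _ (s := hfs.toFinset) (by simp)]
      push_cast
      rfl
    rw [h4, Complex.ofReal_ne_zero]
    refine (lt_of_lt_of_le (mul_pos h1 h1) ?_).ne'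
    exact single_le_finsum l₀ hfs fun l => mul_self_nonneg _
  refine ⟨⟨fun u => ((b u : ℝ) : ℂ) * (S.1 u)⁻¹, hb.mul (S.2.1.inv hS0), hbc.mul_right⟩,
    ⟨fun u => ((b u : ℝ) : ℂ), hb, hbc⟩, fun u => ?_⟩
  have h1 : ∀ l : Lat n, ((b (u + latVec l) : ℝ) : ℂ) * (S.1 (u + latVec l))⁻¹ *
      starRingEnd ℂ ((b (u + latVec l) : ℝ) : ℂ)
      = (S.1 u)⁻¹ • (((b (u + latVec l) : ℝ) : ℂ) * ((b (u + latVec l) : ℝ) : ℂ)) := fun l => by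
    rw [hSper, Complex.conj_ofReal, smul_eq_mul]; ring
  simp only [h1]
  rw [← smul_finsum, ← hS, smul_eq_mul, inv_mul_cancel₀ (hS0 u)]

/-- The pairing determines its value: this needs the existence of cut-offs. -/
lemma HasPairing.unique {n k : ℕ} {s s' : distSection n k} {c c' : ℂ} (h : HasPairing s s' c)
    (h' : HasPairing s s' c') : c = c' := by
  obtain ⟨χ, χ', hχ⟩ := exists_cutoffs n
  rw [← (h χ χ' hχ).2, (h' χ χ' hχ).2]

lemma HasPairing.zero_left {n k : ℕ} (s : distSection n k) : HasPairing 0 s 0 := fun χ χ' _ => by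
  simp [localFourier]

lemma HasPairing.zero_right {n k : ℕ} (s : distSection n k) : HasPairing s 0 0 := fun χ χ' _ => by
  simp [localFourier]

lemma HasPairing.add_left {n k : ℕ} {s₁ s₂ s' : distSection n k} {c₁ c₂ : ℂ}
    (h₁ : HasPairing s₁ s' c₁) (h₂ : HasPairing s₂ s' c₂) : HasPairing (s₁ + s₂) s' (c₁ + c₂) := by
  intro χ χ' hχ
  have e : ∀ ζ, localFourier χ (s₁ + s₂) ζ * starRingEnd ℂ (localFourier χ' s' ζ)
      = localFourier χ s₁ ζ * starRingEnd ℂ (localFourier χ' s' ζ)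
        + localFourier χ s₂ ζ * starRingEnd ℂ (localFourier χ' s' ζ) := fun ζ => add_mul _ _ _
  obtain ⟨i₁, e₁⟩ := h₁ χ χ' hχ
  obtain ⟨i₂, e₂⟩ := h₂ χ χ' hχ
  simp only [e]
  exact ⟨i₁.add i₂, by rw [MeasureTheory.integral_add i₁ i₂, e₁, e₂]⟩

lemma HasPairing.add_right {n k : ℕ} {s s₁ s₂ : distSection n k} {c₁ c₂ : ℂ}
    (h₁ : HasPairing s s₁ c₁) (h₂ : HasPairing s s₂ c₂) : HasPairing s (s₁ + s₂) (c₁ + c₂) := by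
  intro χ χ' hχ
  have e : ∀ ζ, localFourier χ s ζ * starRingEnd ℂ (localFourier χ' (s₁ + s₂) ζ)
      = localFourier χ s ζ * starRingEnd ℂ (localFourier χ' s₁ ζ)
        + localFourier χ s ζ * starRingEnd ℂ (localFourier χ' s₂ ζ) := fun ζ => by
    rw [← mul_add, ← map_add]; rfl
  obtain ⟨i₁, e₁⟩ := h₁ χ χ' hχ
  obtain ⟨i₂, e₂⟩ := h₂ χ χ' hχ
  simp only [e]
  exact ⟨i₁.add i₂, by rw [MeasureTheory.integral_add i₁ i₂, e₁, e₂]⟩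

lemma HasPairing.smul_left {n k : ℕ} {s s' : distSection n k} {c : ℂ} (a : ℂ)
    (h : HasPairing s s' c) : HasPairing (a • s) s' (a * c) := by
  intro χ χ' hχ
  have e : ∀ ζ, localFourier χ (a • s) ζ * starRingEnd ℂ (localFourier χ' s' ζ)
      = a * (localFourier χ s ζ * starRingEnd ℂ (localFourier χ' s' ζ)) := fun ζ => mul_assoc _ _ _
  obtain ⟨i, e'⟩ := h χ χ' hχ
  simp only [e]
  exact ⟨i.const_mul a, by rw [MeasureTheory.integral_const_mul, e']⟩

lemma HasPairing.smul_right {n k : ℕ} {s s' : distSection n k} {c : ℂ} (a : ℂ)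
    (h : HasPairing s s' c) : HasPairing s (a • s') (starRingEnd ℂ a * c) := by
  intro χ χ' hχ
  have e : ∀ ζ, localFourier χ s ζ * starRingEnd ℂ (localFourier χ' (a • s') ζ)
      = starRingEnd ℂ a * (localFourier χ s ζ * starRingEnd ℂ (localFourier χ' s' ζ)) := fun ζ => by
    change _ * starRingEnd ℂ (a * localFourier χ' s' ζ) = _
    rw [map_mul]; ring
  obtain ⟨i, e'⟩ := h χ χ' hχ
  simp only [e]
  exact ⟨i.const_mul _, by rw [MeasureTheory.integral_const_mul, e']⟩

lemma HasPairing.sum_left {n k : ℕ} {ι : Type*} (S : Finset ι) {s : ι → distSection n k}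
    {s' : distSection n k} {c : ι → ℂ} (h : ∀ i ∈ S, HasPairing (s i) s' (c i)) :
    HasPairing (∑ i ∈ S, s i) s' (∑ i ∈ S, c i) := by
  classical
  induction S using Finset.induction_on with
  | empty => simpa using HasPairing.zero_left s'
  | insert a S ha ih =>
    rw [Finset.sum_insert ha, Finset.sum_insert ha]
    exact (h a (Finset.mem_insert_self _ _)).add_left
      (ih fun i hi => h i (Finset.mem_insert_of_mem hi))

lemma HasPairing.sum_right {n k : ℕ} {ι : Type*} (S : Finset ι) {s : distSection n k}
    {s' : ι → distSection n k} {c : ι → ℂ} (h : ∀ i ∈ S, HasPairing s (s' i) (c i)) :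
    HasPairing s (∑ i ∈ S, s' i) (∑ i ∈ S, c i) := by
  classical
  induction S using Finset.induction_on with
  | empty => simpa using HasPairing.zero_right s
  | insert a S ha ih =>
    rw [Finset.sum_insert ha, Finset.sum_insert ha]
    exact (h a (Finset.mem_insert_self _ _)).add_right
      (ih fun i hi => h i (Finset.mem_insert_of_mem hi))

/-! ### Orthogonality of the characters of `(ℤ/k)ⁿ` -/

lemma sum_zmod_val {k : ℕ} [NeZero k] (F : ℕ → ℂ) : ∑ j : ZMod k, F j.val = ∑ j ∈ Finset.range k, F j := by
  obtain ⟨k', rfl⟩ : ∃ k', k = k' + 1 := Nat.exists_eq_succ_of_ne_zero (NeZero.ne k)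
  exact Fin.sum_univ_eq_sum_range F (k' + 1)

lemma sum_expi_zmod {k : ℕ} [NeZero k] (N : ℤ) :
    ∑ j : ZMod k, expi ((N : ℝ) * j.val / k) = if (N : ZMod k) = 0 then (k : ℂ) else 0 := by
  have hk : (k : ℝ) ≠ 0 := by exact_mod_cast NeZero.ne k
  have hpow : ∀ j : ℕ, expi ((N : ℝ) * j / k) = expi ((N : ℝ) / k) ^ j := fun j => by
    rw [expi, expi, ← Complex.exp_nat_mul]
    congr 1
    push_cast
    ring
  rw [sum_zmod_val (fun j => expi ((N : ℝ) * j / k))]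
  simp only [hpow]
  split_ifs with h
  · obtain ⟨q, rfl⟩ := (ZMod.intCast_zmod_eq_zero_iff_dvd N k).1 h
    have : expi (((k * q : ℤ) : ℝ) / k) = 1 := by
      rw [expi_eq_one_iff]; exact ⟨q, by push_cast; field_simp⟩
    rw [this]
    simp
  · have h1 : expi ((N : ℝ) / k) ≠ 1 := by
      rw [Ne, expi_eq_one_iff]
      rintro ⟨q, hq⟩
      rw [div_eq_iff hk] at hq
      refine h ((ZMod.intCast_zmod_eq_zero_iff_dvd N k).2 ⟨q, ?_⟩)
      rw [mul_comm]
      exact_mod_cast hq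
    have h2 : expi ((N : ℝ) / k) ^ k = 1 := by
      rw [← hpow, mul_div_cancel_right₀ _ hk, expi_int]
    rw [geom_sum_eq h1, h2, sub_self, zero_div]

lemma expi_sum {ι : Type*} (S : Finset ι) (r : ι → ℝ) : expi (∑ i ∈ S, r i) = ∏ i ∈ S, expi (r i) := by
  simp only [expi, ← Complex.exp_sum, Complex.ofReal_sum, Finset.mul_sum]

lemma sum_expi_zmod_pi {n k : ℕ} [NeZero k] (N : Fin n → ℤ) :
    ∑ j : Fin n → ZMod k, expi (∑ i, (N i : ℝ) * (j i).val / k)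
      = if (fun i => (N i : ZMod k)) = 0 then (k : ℂ) ^ n else 0 := by
  simp only [expi_sum]
  have h := Finset.prod_univ_sum (fun _ : Fin n => (Finset.univ : Finset (ZMod k)))
    (fun i j => expi ((N i : ℝ) * j.val / k))
  rw [Fintype.piFinset_univ] at h
  rw [← h]
  simp only [sum_expi_zmod]
  split_ifs with h0
  · have h1 : ∀ i, (N i : ZMod k) = 0 := fun i => congrFun h0 i
    simp [h1]
  · obtain ⟨i, hi⟩ : ∃ i, (N i : ZMod k) ≠ 0 := by
      by_contra hc
      push Not at hc
      exact h0 (funext hc)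
    exact Finset.prod_eq_zero (Finset.mem_univ i) (by simp [hi])

lemma character_eq_expi {n k : ℕ} (m j : Fin n → ZMod k) :
    character m j = expi (∑ i, ((m i).val : ℝ) * (j i).val / k) := by
  rw [character, expi, ← Finset.sum_div]
  congr 1
  push_cast
  ring

lemma sum_character {n k : ℕ} [NeZero k] (m m' : Fin n → ZMod k) :
    ∑ j, character m j * starRingEnd ℂ (character m' j) = if m = m' then (k : ℂ) ^ n else 0 := by
  have h : ∀ j : Fin n → ZMod k, character m j * starRingEnd ℂ (character m' j)
      = expi (∑ i, ((((m i).val : ℤ) - ((m' i).val : ℤ) : ℤ) : ℝ) * (j i).val / k) := fun j => by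
    rw [character_eq_expi, character_eq_expi, conj_expi, ← expi_add, ← Finset.sum_neg_distrib,
      ← Finset.sum_add_distrib]
    congr 1
    refine Finset.sum_congr rfl fun i _ => ?_
    push_cast
    ring
  simp only [h, sum_expi_zmod_pi]
  congr 1
  rw [eq_iff_iff, funext_iff, funext_iff]
  refine forall_congr' fun i => ?_
  simp [sub_eq_zero]

/-! ### The basis of the quantum space and the matrix of the operators -/

/-- The pairings with the `δ̌_j` separate the `δ_m`, since the character table of `(ℤ/k)ⁿ` is
invertible. -/
lemma linearIndependent_deltaT (n k : ℕ) [NeZero k] :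
    LinearIndependent ℂ (fun m : Fin n → ZMod k => deltaT m) := by
  rw [Fintype.linearIndependent_iff]
  intro c hc m'
  let one : smoothTorus n := ⟨fun _ => 1, contDiff_const, fun _ _ => rfl⟩
  have hone : ∀ s : distSection n k, distMul one s = s := fun s => by
    refine Subtype.ext (LinearMap.ext fun t => ?_)
    change s.1 (conjMul one t) = s.1 t
    congr 1
    ext u
    simp [conjMul, one]
  have h1 : ∀ j : Fin n → ZMod k, ∑ m, c m * character m j = 0 := fun j => by
    have h2 : HasPairing (∑ m, c m • deltaT m) (deltaTcheck j) (∑ m, c m * character m j) :=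
      HasPairing.sum_left _ fun m _ => by
        have := (hasPairing_deltaT one m j).smul_left (c m)
        rw [hone] at this
        simpa [one] using this
    rw [hc] at h2
    exact h2.unique (HasPairing.zero_left _)
  have h3 : ∑ j : Fin n → ZMod k, (∑ m, c m * character m j) * starRingEnd ℂ (character m' j)
      = c m' * (k : ℂ) ^ n := by
    simp only [Finset.sum_mul, mul_assoc]
    rw [Finset.sum_comm]
    simp only [← Finset.mul_sum, sum_character, mul_ite, mul_zero]
    rw [Finset.sum_ite_eq' Finset.univ m' fun m => c m * (k : ℂ) ^ n]
    simp
  simp only [h1, zero_mul, Finset.sum_const_zero] at h3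
  have hk : (k : ℂ) ^ n ≠ 0 := pow_ne_zero _ (by exact_mod_cast NeZero.ne k)
  exact (mul_eq_zero.1 h3.symm).resolve_right hk

/-- The factor between `σ^m` and the Dirac distribution on the Bohr-Sommerfeld fibre. -/
def sigmaFactor (n k : ℕ) : ℝ := normFactor n k * (2 * k : ℝ) ^ (-(n : ℝ) / 2)

lemma sigma_coe {n k : ℕ} [NeZero k] (m : Fin n → ZMod k) :
    (sigma m : quantumSpace n k).1 = (sigmaFactor n k : ℂ) • deltaT m := by
  change (normFactor n k : ℂ) • ((((2 * k : ℝ) ^ (-(n : ℝ) / 2) : ℝ) : ℂ) • deltaT m) = _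
  rw [smul_smul, sigmaFactor, Complex.ofReal_mul]

lemma sigmaFactor_ne_zero (n k : ℕ) [NeZero k] : (sigmaFactor n k : ℂ) ≠ 0 := by
  have hk : (0 : ℝ) < k := by exact_mod_cast Nat.pos_of_ne_zero (NeZero.ne k)
  rw [Complex.ofReal_ne_zero, sigmaFactor, normFactor]
  positivity

/-- The basis `σ^m` of the quantum space. -/
def sigmaBasis (n k : ℕ) [NeZero k] : Module.Basis (Fin n → ZMod k) ℂ (quantumSpace n k) :=
  Module.Basis.mk (v := fun m => sigma m) (by
    have h := (linearIndependent_deltaT n k).units_smul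
      fun _ => Units.mk0 _ (sigmaFactor_ne_zero n k)
    refine LinearIndependent.of_comp (polarized k (polT n)).subtype ?_
    convert! h using 1
    ext m : 1
    exact sigma_coe m) (by
    rintro s -
    obtain ⟨c, hc⟩ := exists_eq_sum_deltaT (s := s.1) fun v hv t => neg_eq_zero.1 (s.2 v hv t)
    have h : s = ∑ m, ((sigmaFactor n k : ℂ)⁻¹ * c m) • (sigma m : quantumSpace n k) := by
      refine Subtype.ext ?_
      rw [hc, Submodule.coe_sum]
      refine Finset.sum_congr rfl fun m _ => ?_
      rw [Submodule.coe_smul, sigma_coe, smul_smul, mul_right_comm,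
        inv_mul_cancel₀ (sigmaFactor_ne_zero n k), one_mul]
    rw [h]
    exact Submodule.sum_mem _ fun m _ => Submodule.smul_mem _ _ (Submodule.subset_span ⟨m, rfl⟩))

lemma sigmaBasis_apply {n k : ℕ} [NeZero k] (m : Fin n → ZMod k) :
    sigmaBasis n k m = sigma m := by
  simp [sigmaBasis]

/-- The matrix coefficient `⟨f σ^m, σ̌^{m'}⟩` of `Q_f`; it only depends on the values of `f` at the
points `(j/k, m/k)`. -/
def toeplitzCoeff {n k : ℕ} [NeZero k] (f : Vec n → ℂ) (m' m : Fin n → ZMod k) : ℂ :=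
  ((k : ℂ) ^ n)⁻¹ * ∑ j : Fin n → ZMod k,
    f (bsPoint j, bsPoint m) * character m j * starRingEnd ℂ (character m' j)

/-- The normalization factors of `σ^m` and `σ̌^m` and the half-form pairing combine to `k⁻ⁿ`. -/
lemma normalization (n k : ℕ) [NeZero k] :
    sigmaFactor n k * (normFactor n k * ((2 : ℝ) ^ (-(n : ℝ) / 2) * ((k : ℝ) ^ n)⁻¹))
      * halfFormPairing n k = ((k : ℝ) ^ n)⁻¹ := by
  have hk : (0 : ℝ) < k := by exact_mod_cast Nat.pos_of_ne_zero (NeZero.ne k)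
  have h2 : (0 : ℝ) < 2 := two_pos
  have a1 : (2 : ℝ) ^ ((n : ℝ) / 2) = ((2 : ℝ) ^ ((n : ℝ) / 4)) ^ 2 := by
    rw [← Real.rpow_natCast, ← Real.rpow_mul h2.le]; congr 1; push_cast; ring
  have a2 : (k : ℝ) ^ n = ((k : ℝ) ^ ((n : ℝ) / 2)) ^ 2 := by
    rw [← Real.rpow_natCast, ← Real.rpow_natCast, ← Real.rpow_mul hk.le]; congr 1; push_cast; ring
  have a3 : halfFormPairing n k = (2 : ℝ) ^ ((n : ℝ) / 2) * ((k : ℝ) ^ ((n : ℝ) / 2))⁻¹ := by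
    rw [halfFormPairing, Real.mul_rpow (by positivity) (by positivity), Real.inv_rpow (by positivity),
      ← Real.rpow_natCast, ← Real.rpow_natCast, ← Real.rpow_mul h2.le, ← Real.rpow_mul hk.le]
    congr 2
    · ring
    · congr 1; ring
  rw [a3, sigmaFactor, normFactor, Real.mul_rpow h2.le hk.le, neg_div, Real.rpow_neg h2.le,
    Real.rpow_neg hk.le, a1, a2]
  have p1 : (2 : ℝ) ^ ((n : ℝ) / 4) ≠ 0 := by positivity
  have p2 : (k : ℝ) ^ ((n : ℝ) / 2) ≠ 0 := by positivity
  field_simp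

lemma distMul_smul {n k : ℕ} (f : smoothTorus n) (c : ℂ) (s : distSection n k) :
    distMul f (c • s) = c • distMul f s := rfl

lemma distMul_sum {n k : ℕ} {ι : Type*} (S : Finset ι) (f : smoothTorus n) (s : ι → distSection n k) :
    distMul f (∑ i ∈ S, s i) = ∑ i ∈ S, distMul f (s i) := by
  let F : distSection n k →+ distSection n k :=
    { toFun := distMul f, map_zero' := rfl, map_add' := fun _ _ => rfl }
  exact map_sum F s S

lemma hasBKSPairing_sigma {n k : ℕ} [NeZero k] (f : smoothTorus n) (m m' : Fin n → ZMod k) :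
    HasBKSPairing (distMul f (sigma m : quantumSpace n k).1) (sigmaCheck m' : quantumSpaceCheck n k).1
      (toeplitzCoeff f.1 m' m) := by
  have e : (sigmaCheck m' : quantumSpaceCheck n k).1
      = ((normFactor n k * ((2 : ℝ) ^ (-(n : ℝ) / 2) * ((k : ℝ) ^ n)⁻¹) : ℝ) : ℂ) •
        ∑ j, character m' j • deltaTcheck j := by
    rw [Complex.ofReal_mul, mul_smul]
    rfl
  have h := ((HasPairing.sum_right Finset.univ fun j _ =>
    (hasPairing_deltaT f m j).smul_right (character m' j)).smul_right
    ((normFactor n k * ((2 : ℝ) ^ (-(n : ℝ) / 2) * ((k : ℝ) ^ n)⁻¹) : ℝ) : ℂ)).smul_left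
    (sigmaFactor n k : ℂ)
  rw [← e, ← distMul_smul, ← sigma_coe] at h
  refine ⟨_, h, ?_⟩
  have hn : ((k : ℂ) ^ n)⁻¹ = (sigmaFactor n k : ℂ) *
      ((normFactor n k * ((2 : ℝ) ^ (-(n : ℝ) / 2) * ((k : ℝ) ^ n)⁻¹) : ℝ) : ℂ) *
      (halfFormPairing n k : ℂ) := by
    rw [← Complex.ofReal_mul, ← Complex.ofReal_mul, normalization]
    push_cast
    rfl
  rw [toeplitzCoeff, hn, Complex.conj_ofReal]
  simp only [Finset.mul_sum, Finset.sum_mul]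
  refine Finset.sum_congr rfl fun j _ => ?_
  ring

/-- The operator `Q_f`, by its matrix in the basis `σ^m`. -/
def toeplitz (n k : ℕ) [NeZero k] (f : smoothTorus n) : Module.End ℂ (quantumSpace n k) :=
  Matrix.toLin (sigmaBasis n k) (sigmaBasis n k) (Matrix.of fun m' m => toeplitzCoeff f.1 m' m)

lemma HasBKSPairing.unique {n k : ℕ} {s s' : distSection n k} {c c' : ℂ} (h : HasBKSPairing s s' c)
    (h' : HasBKSPairing s s' c') : c = c' := by
  obtain ⟨a, ha, rfl⟩ := h
  obtain ⟨a', ha', rfl⟩ := h'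
  rw [ha.unique ha']

lemma isProjection_toeplitz {n k : ℕ} [NeZero k] (f : smoothTorus n) (s : quantumSpace n k) :
    IsProjection (distMul f s.1) (toeplitz n k f s) := by
  have hs : s.1 = ∑ m, (sigmaBasis n k).repr s m • (sigma m : quantumSpace n k).1 := by
    conv_lhs => rw [← (sigmaBasis n k).sum_repr s]
    simp [sigmaBasis_apply]
  refine ⟨fun m' => ∑ m, (sigmaBasis n k).repr s m * toeplitzCoeff f.1 m' m, fun m' => ?_, ?_⟩
  · choose a ha ha' using fun m => hasBKSPairing_sigma (k := k) f m m'
    refine ⟨∑ m, (sigmaBasis n k).repr s m * a m, ?_, ?_⟩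
    · rw [hs, distMul_sum]
      exact HasPairing.sum_left _ fun m _ => (ha m).smul_left _
    · rw [Finset.sum_mul]
      exact Finset.sum_congr rfl fun m _ => by rw [ha', mul_assoc]
  · rw [toeplitz, Matrix.toLin_apply]
    refine Finset.sum_congr rfl fun m' _ => ?_
    rw [sigmaBasis_apply]
    congr 1
    simp [Matrix.mulVec, dotProduct, mul_comm]

/-- The defining property of `Q_f` holds for exactly one operator. -/
lemma isToeplitz_iff {n k : ℕ} [NeZero k] (f : smoothTorus n) (A : Module.End ℂ (quantumSpace n k)) :
    IsToeplitz f A ↔ A = toeplitz n k f := by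
  constructor
  · intro h
    ext1 s
    obtain ⟨c, hc, hp⟩ := h s
    obtain ⟨c', hc', hp'⟩ := isProjection_toeplitz f s
    rw [hp, hp']
    exact Finset.sum_congr rfl fun m _ => by rw [(hc m).unique (hc' m)]
  · rintro rfl
    exact isProjection_toeplitz f

/-! ### The boundary value of the inner product -/

lemma summable_int_inv_one_add_sq : Summable fun q : ℤ => (1 + (q : ℝ) ^ 2)⁻¹ := by
  refine Summable.of_norm_bounded_eventually (Real.summable_one_div_int_pow.2 one_lt_two) ?_
  filter_upwards [(Set.finite_singleton (0 : ℤ)).eventually_cofinite_notMem] with q hq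
  rw [Set.mem_singleton_iff] at hq
  have hq' : (0 : ℝ) < (q : ℝ) ^ 2 := by positivity
  rw [Real.norm_of_nonneg (by positivity), one_div]
  exact inv_anti₀ hq' (by linarith)

lemma summable_gaussian {c : ℝ} (hc : 0 < c) : Summable fun q : ℤ => Real.exp (c - c * q ^ 2 / 2) := by
  refine Summable.of_nonneg_of_le (fun q => (Real.exp_pos _).le) (fun q => ?_)
    (summable_int_inv_one_add_sq.mul_left (Real.exp c * (1 + 2 / c)))
  rw [Real.exp_sub, div_eq_mul_inv, mul_assoc]
  refine mul_le_mul_of_nonneg_left ?_ (Real.exp_pos _).le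
  have h1 := Real.add_one_le_exp (c * q ^ 2 / 2)
  have h3 : (0 : ℝ) < 1 + (q : ℝ) ^ 2 := by positivity
  rw [← div_eq_mul_inv, le_div_iff₀ h3, inv_mul_le_iff₀ (Real.exp_pos _)]
  refine le_trans ?_ (mul_le_mul_of_nonneg_right h1 (by positivity))
  have h2 : (c * q ^ 2 / 2 + 1) * (1 + 2 / c) = q ^ 2 + 1 + (c * q ^ 2 / 2 + 2 / c) := by
    field_simp; ring
  rw [h2]
  have : 0 ≤ c * q ^ 2 / 2 + 2 / c := by positivity
  linarith

/-- The Gaussian `e^{-c|y|²}` on `ℝⁿ`. -/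
def gauss {n : ℕ} (c : ℝ) (y : Fin n → ℝ) : ℝ := Real.exp (-(c * ∑ i, y i ^ 2))

lemma gauss_eq_prod {n : ℕ} (c : ℝ) (y : Fin n → ℝ) : gauss c y = ∏ i, Real.exp (-c * y i ^ 2) := by
  rw [gauss, ← Real.exp_sum, Finset.mul_sum, ← Finset.sum_neg_distrib]
  simp only [neg_mul]

lemma continuous_gauss {n : ℕ} (c : ℝ) : Continuous (gauss (n := n) c) := by
  unfold gauss; fun_prop

/-- A bound for the translates of a Gaussian on the cube that is summable over the lattice and does not
depend on the point. -/
lemma gauss_translate_le {n : ℕ} {c : ℝ} (hc : 0 < c) {y b : Fin n → ℝ} (hy : y ∈ cube n)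
    (hb : b ∈ cube n) (q : Fin n → ℤ) :
    gauss c (y - b - intVec q) ≤ ∏ i, Real.exp (c - c * q i ^ 2 / 2) := by
  rw [gauss_eq_prod]
  refine Finset.prod_le_prod (fun i _ => (Real.exp_pos _).le) fun i _ => Real.exp_le_exp.2 ?_
  have h1 := hy.1 i
  have h2 := hy.2 i
  have h3 := hb.1 i
  have h4 := hb.2 i
  simp only [Pi.zero_apply, Pi.one_apply] at h1 h2 h3 h4
  simp only [Pi.sub_apply, intVec]
  have h5 : (y i - b i) ^ 2 ≤ 1 := by
    rw [sq_le_one_iff_abs_le_one, abs_le]; constructor <;> linarith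
  have h6 : (q i : ℝ) ^ 2 / 2 - 1 ≤ (y i - b i - q i) ^ 2 := by
    nlinarith [sq_nonneg (2 * (y i - b i) - q i)]
  nlinarith

open MeasureTheory in
lemma integral_gauss {n : ℕ} (c : ℝ) :
    ∫ y : Fin n → ℝ, ((gauss c y : ℝ) : ℂ) = ((√(Real.pi / c) ^ n : ℝ) : ℂ) := by
  rw [integral_complex_ofReal]
  congr 1
  simp only [gauss_eq_prod]
  rw [integral_fintype_prod_volume_eq_pow (fun y : ℝ => Real.exp (-c * y ^ 2)), integral_gaussian,
    Fintype.card_fin]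

open MeasureTheory in
lemma integrable_gauss {n : ℕ} {c : ℝ} (hc : 0 < c) :
    Integrable fun y : Fin n → ℝ => ((gauss c y : ℝ) : ℂ) := by
  have h : Integrable (gauss (n := n) c) := by
    rw [funext (gauss_eq_prod c)]
    exact Integrable.fintype_prod (f := fun (_ : Fin n) (y : ℝ) => Real.exp (-c * y ^ 2))
      fun _ => integrable_exp_neg_mul_sq hc
  exact h.ofReal

lemma hasFDerivAt_expi_dot {n : ℕ} (p x : Fin n → ℝ) :
    ∃ D : (Fin n → ℝ) →L[ℝ] ℂ, HasFDerivAt (fun x : Fin n → ℝ => expi (∑ i, p i * x i)) D x ∧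
      ∀ a, D a = 2 * Real.pi * Complex.I * ((∑ i, p i * a i : ℝ) : ℂ) * expi (∑ i, p i * x i) := by
  let A : (Fin n → ℝ) →ₗ[ℝ] ℝ :=
    { toFun := fun a => ∑ i, p i * a i
      map_add' := fun a b => by simp [mul_add, Finset.sum_add_distrib]
      map_smul' := fun r a => by
        simp only [Pi.smul_apply, smul_eq_mul, RingHom.id_apply, Finset.mul_sum]
        exact Finset.sum_congr rfl fun i _ => by ring }
  have h1 := (Complex.ofRealCLM.hasFDerivAt (x := A x)).comp x
    A.toContinuousLinearMap.hasFDerivAt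
  have h2 := (h1.const_mul (2 * Real.pi * Complex.I : ℂ)).cexp
  refine ⟨_, h2, fun a => ?_⟩
  simp [expi, A]
  ring

open MeasureTheory in
lemma integral_cube_expi {n : ℕ} (N : Fin n → ℤ) :
    ∫ x in cube n, expi (∑ i, (N i : ℝ) * x i) = if N = 0 then 1 else 0 := by
  split_ifs with h
  · subst h
    simp [expi_zero, volume_real_cube]
  · obtain ⟨i, hi⟩ : ∃ i, N i ≠ 0 := by
      by_contra hc
      push Not at hc
      exact h (funext hc)
    have hF : ContDiff ℝ 1 fun x : Fin n → ℝ => expi (∑ i, (N i : ℝ) * x i) :=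
      (contDiff_expi.of_le (by exact_mod_cast le_top)).comp (ContDiff.sum fun i _ => by fun_prop)
    have h1 := integral_cube_fderiv _ hF (fun x i => by
      rw [← expi_add_int (∑ j, (N j : ℝ) * x j) (N i)]
      congr 1
      simp [mul_add, Finset.sum_add_distrib, Pi.single_apply]) (Pi.single i 1)
    have h2 : ∀ x : Fin n → ℝ, fderiv ℝ (fun x : Fin n → ℝ => expi (∑ i, (N i : ℝ) * x i)) x
        (Pi.single i 1) = (2 * Real.pi * Complex.I * N i) * expi (∑ i, (N i : ℝ) * x i) := fun x => by
      obtain ⟨D, hD, hw⟩ := hasFDerivAt_expi_dot (fun i => (N i : ℝ)) x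
      rw [hD.fderiv, hw]
      simp [Pi.single_apply]
    simp only [h2] at h1
    rw [integral_const_mul] at h1
    refine (mul_eq_zero.1 h1).resolve_left ?_
    exact mul_ne_zero Complex.two_pi_I_ne_zero (by exact_mod_cast hi)

/-- The terms of the theta series `thetaRay`, without the common factors. -/
def thetaTerm {n k : ℕ} (c : ℝ) (m : Fin n → ZMod k) (q : Fin n → ℤ) (u : Vec n) : ℂ :=
  ((gauss c (u.2 - bsPoint m - intVec q) : ℝ) : ℂ) *
    expi (∑ i, (((m i).val : ℝ) + k * q i) * u.1 i)

lemma thetaRay_eq {n k : ℕ} [NeZero k] (r : ℝ) (m : Fin n → ZMod k) (u : Vec n) :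
    thetaRay r m u = (((1 - r) ^ (-(n : ℝ) / 2) : ℝ) : ℂ) * expi (-(k * ∑ i, u.1 i * u.2 i) / 2) *
      ∑' q, thetaTerm (k * Real.pi * ((1 + r) / (1 - r))) m q u := by
  have hk : (k : ℝ) ≠ 0 := by exact_mod_cast NeZero.ne k
  rw [thetaRay]
  congr 1
  · congr 1
    rw [expi]; congr 1; push_cast; ring
  · refine tsum_congr fun q => ?_
    rw [thetaTerm, gauss, expi]
    congr 5
    refine Finset.sum_congr rfl fun i _ => ?_
    simp only [Pi.sub_apply, bsPoint, intVec]
    congr 1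
    field_simp
    ring

lemma norm_thetaTerm_le {n k : ℕ} [NeZero k] {c : ℝ} (hc : 0 < c) (m : Fin n → ZMod k)
    (q : Fin n → ℤ) {u : Vec n} (hu : u.2 ∈ cube n) :
    ‖thetaTerm c m q u‖ ≤ ∏ i, Real.exp (c - c * q i ^ 2 / 2) := by
  rw [thetaTerm, norm_mul, norm_expi, mul_one, Complex.norm_real,
    Real.norm_of_nonneg (by unfold gauss; positivity)]
  exact gauss_translate_le hc hu (bsPoint_mem m) q

open MeasureTheory in
/-- The theta functions are orthogonal. The integral over `x` leaves only the pairs of terms with equal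
frequency; for `m = m'` the remaining sum over the lattice unfolds to a Gaussian integral over `ℝⁿ`. -/
lemma integral_thetaTerm {n k : ℕ} [NeZero k] {c : ℝ} (hc : 0 < c) (m m' : Fin n → ZMod k) :
    ∫ u in cube n ×ˢ cube n, (∑' q, thetaTerm c m q u) * starRingEnd ℂ (∑' q, thetaTerm c m' q u)
      = if m = m' then ((√(Real.pi / (2 * c)) ^ n : ℝ) : ℂ) else 0 := by
  have hk : (k : ℝ) ≠ 0 := by exact_mod_cast NeZero.ne k
  let G : (Fin n → ℤ) → ℝ := fun q => ∏ i, Real.exp (c - c * q i ^ 2 / 2)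
  have hG0 : ∀ q, 0 ≤ G q := fun q => Finset.prod_nonneg fun i _ => (Real.exp_pos _).le
  have hG : Summable G := summable_pi_prod (h := fun _ (q : ℤ) => Real.exp (c - c * q ^ 2 / 2))
    (fun _ _ => (Real.exp_pos _).le) fun _ => summable_gaussian hc
  have hGG : Summable fun p : (Fin n → ℤ) × (Fin n → ℤ) => G p.1 * G p.2 :=
    hG.mul_of_nonneg hG hG0 hG0
  let F : (Fin n → ℤ) × (Fin n → ℤ) → Vec n → ℂ := fun p u =>
    thetaTerm c m p.1 u * starRingEnd ℂ (thetaTerm c m' p.2 u)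
  have hFn : ∀ p, ∀ u ∈ cube n ×ˢ cube n, ‖F p u‖ ≤ G p.1 * G p.2 := fun p u hu => by
    rw [norm_mul, RCLike.norm_conj]
    exact mul_le_mul (norm_thetaTerm_le hc m _ hu.2) (norm_thetaTerm_le hc m' _ hu.2)
      (norm_nonneg _) (hG0 _)
  have hmeas : MeasurableSet (cube n ×ˢ cube n) := (measurableSet_cube n).prod (measurableSet_cube n)
  have hcont : ∀ (m : Fin n → ZMod k) q, Continuous (thetaTerm c m q) := fun m q => by
    refine Continuous.mul (Complex.continuous_ofReal.comp ((continuous_gauss c).comp (by fun_prop)))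
      (contDiff_expi.continuous.comp (by fun_prop))
  have hFc : ∀ p, Continuous (F p) := fun p =>
    (hcont _ _).mul (Complex.continuous_conj.comp (hcont _ _))
  have hFi : ∀ p, IntegrableOn (F p) (cube n ×ˢ cube n) := fun p =>
    (hFc p).continuousOn.integrableOn_compact (isCompact_box n)
  have hvol : volume.real (cube n ×ˢ cube n) = 1 := by
    rw [Measure.volume_eq_prod, measureReal_prod_prod, volume_real_cube, one_mul]
  have hFs : Summable fun p => ∫ u in cube n ×ˢ cube n, ‖F p u‖ := by
    refine Summable.of_nonneg_of_le (fun p => integral_nonneg fun u => norm_nonneg _) (fun p => ?_) hGG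
    have := setIntegral_mono_on (hFi p).norm (integrableOn_const (isCompact_box n).measure_lt_top.ne)
      hmeas (hFn p)
    rwa [setIntegral_const, hvol, one_smul] at this
  have h1 : ∀ u ∈ cube n ×ˢ cube n,
      (∑' q, thetaTerm c m q u) * starRingEnd ℂ (∑' q, thetaTerm c m' q u) = ∑' p, F p u := by
    intro u hu
    have s1 : ∀ m : Fin n → ZMod k, Summable fun q => ‖thetaTerm c m q u‖ := fun m =>
      Summable.of_nonneg_of_le (fun _ => norm_nonneg _) (fun q => norm_thetaTerm_le hc m q hu.2) hG
    rw [Complex.conj_tsum]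
    exact tsum_mul_tsum_of_summable_norm (s1 m) (by simpa using s1 m')
  rw [setIntegral_congr_fun hmeas h1, ← integral_tsum_of_summable_integral_norm hFi hFs]
  have h2 : ∀ p : (Fin n → ℤ) × (Fin n → ℤ), ∫ u in cube n ×ˢ cube n, F p u
      = (if (fun i => ((m i).val + k * p.1 i - ((m' i).val + k * p.2 i) : ℤ)) = 0 then 1 else 0) *
        ∫ y in cube n, ((gauss c (y - bsPoint m - intVec p.1) * gauss c (y - bsPoint m' - intVec p.2) : ℝ) : ℂ) := by
    intro p
    rw [← integral_cube_expi, ← setIntegral_prod_mul, ← Measure.volume_eq_prod]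
    refine setIntegral_congr_fun hmeas fun u _ => ?_
    simp only [F, thetaTerm, map_mul, Complex.conj_ofReal, conj_expi]
    have e : expi (∑ i, (((m i).val + k * p.1 i - ((m' i).val + k * p.2 i) : ℤ) : ℝ) * u.1 i)
        = expi (∑ i, (((m i).val : ℝ) + k * p.1 i) * u.1 i) *
          expi (-∑ i, (((m' i).val : ℝ) + k * p.2 i) * u.1 i) := by
      rw [← expi_add, ← Finset.sum_neg_distrib, ← Finset.sum_add_distrib]
      congr 1
      refine Finset.sum_congr rfl fun i _ => ?_
      push_cast
      ring
    rw [e]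
    push_cast
    ring
  simp only [h2]
  have hN : ∀ p : (Fin n → ℤ) × (Fin n → ℤ),
      (fun i => ((m i).val + k * p.1 i - ((m' i).val + k * p.2 i) : ℤ)) = 0 → m = m' := by
    intro p hp
    ext i
    have h3 := congrArg (fun z : ℤ => (z : ZMod k)) (congrFun hp i)
    simp at h3
    exact sub_eq_zero.1 h3
  split_ifs with hm
  · subst hm
    have hdiag : ∀ p : (Fin n → ℤ) × (Fin n → ℤ),
        (fun i => ((m i).val + k * p.1 i - ((m i).val + k * p.2 i) : ℤ)) = 0 ↔ p.1 = p.2 := by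
      intro p
      have hkz : (k : ℤ) ≠ 0 := by exact_mod_cast NeZero.ne k
      rw [funext_iff, funext_iff]
      refine forall_congr' fun i => ?_
      rw [Pi.zero_apply, add_sub_add_left_eq_sub, ← mul_sub, mul_eq_zero, or_iff_right hkz, sub_eq_zero]
    simp only [hdiag]
    have hg2 : ∀ y : Fin n → ℝ, gauss c y * gauss c y = gauss (2 * c) y := fun y => by
      rw [gauss, gauss, ← Real.exp_add]; congr 1; ring
    let φ : (Fin n → ℝ) → ℂ := fun y => ((gauss (2 * c) (y - bsPoint m) : ℝ) : ℂ)
    have hφ : Integrable φ := (integrable_gauss (by positivity)).comp_sub_right (bsPoint m)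
    have h4 := hasSum_integral_cube_translate hφ
    have h5 : ∫ y, φ y = ((√(Real.pi / (2 * c)) ^ n : ℝ) : ℂ) := by
      rw [← integral_gauss]
      exact integral_sub_right_eq_self (fun y => ((gauss (2 * c) y : ℝ) : ℂ)) (bsPoint m)
    rw [h5, ← (Equiv.neg (Fin n → ℤ)).hasSum_iff] at h4
    refine HasSum.tsum_eq ?_
    have hinj : Function.Injective fun q : Fin n → ℤ => (q, q) := fun a b h => congrArg Prod.fst h
    rw [← hinj.hasSum_iff]
    · refine h4.congr_fun fun q => ?_
      simp only [Function.comp_apply, if_true, one_mul, hg2, φ, Equiv.neg_apply]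
      congr 1
      ext y
      congr 2
      ext i
      simp [intVec]
      ring
    · intro p hp
      have : p.1 ≠ p.2 := fun h => hp ⟨p.1, Prod.ext rfl h⟩
      rw [if_neg this, zero_mul]
  · have : ∀ p : (Fin n → ℤ) × (Fin n → ℤ),
        ¬ (fun i => ((m i).val + k * p.1 i - ((m' i).val + k * p.2 i) : ℤ)) = 0 := fun p hp => hm (hN p hp)
    simp only [if_neg (this _), zero_mul, tsum_zero]

/-- The `σ_τ^m` are orthonormal, for all `τ = -rI`: the half-form factor cancels the dependence on
`r`. -/
lemma bksRay_eq {n k : ℕ} [NeZero k] {r : ℝ} (h0 : 0 < r) (h1 : r < 1) (m m' : Fin n → ZMod k) :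
    bksRay r m m' = if m = m' then 1 else 0 := by
  have hk : (0 : ℝ) < k := by exact_mod_cast Nat.pos_of_ne_zero (NeZero.ne k)
  have hr : 0 < 1 - r := by linarith
  have hr' : 0 < 1 + r := by linarith
  have hc : 0 < k * Real.pi * ((1 + r) / (1 - r)) := by positivity
  have e : ∀ u : Vec n, thetaRay r m u * starRingEnd ℂ (thetaRay r m' u)
      = (((1 - r) ^ (-(n : ℝ) / 2) * (1 - r) ^ (-(n : ℝ) / 2) : ℝ) : ℂ) *
        ((∑' q, thetaTerm (k * Real.pi * ((1 + r) / (1 - r))) m q u) *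
        starRingEnd ℂ (∑' q, thetaTerm (k * Real.pi * ((1 + r) / (1 - r))) m' q u)) := fun u => by
    rw [thetaRay_eq, thetaRay_eq, map_mul, map_mul, conj_expi, Complex.conj_ofReal, Complex.ofReal_mul]
    have h2 : expi (-(k * ∑ i, u.1 i * u.2 i) / 2) * expi (-(-(k * ∑ i, u.1 i * u.2 i) / 2)) = 1 := by
      rw [← expi_add, add_neg_cancel, expi_zero]
    linear_combination (((1 - r) ^ (-(n : ℝ) / 2) : ℝ) : ℂ) ^ 2 *
      (∑' q, thetaTerm (k * Real.pi * ((1 + r) / (1 - r))) m q u) *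
        starRingEnd ℂ (∑' q, thetaTerm (k * Real.pi * ((1 + r) / (1 - r))) m' q u) * h2
  rw [bksRay]
  simp only [e]
  rw [MeasureTheory.integral_const_mul, integral_thetaTerm hc]
  split_ifs with hm
  · rw [← Complex.ofReal_mul, ← Complex.ofReal_mul, ← Complex.ofReal_one]
    congr 1
    have hs : ∀ a : ℝ, 0 ≤ a → √a ^ n = a ^ ((n : ℝ) / 2) := fun a ha => by
      rw [Real.sqrt_eq_rpow, ← Real.rpow_natCast, ← Real.rpow_mul ha]; congr 1; ring
    have e1 : normFactor n k ^ 2 = (2 * k ^ 2) ^ ((n : ℝ) / 2) := by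
      rw [normFactor, mul_pow, ← Real.rpow_natCast, ← Real.rpow_natCast, ← Real.rpow_mul hk.le,
        ← Real.rpow_mul two_pos.le, Real.mul_rpow two_pos.le (by positivity), ← Real.rpow_natCast k 2,
        ← Real.rpow_mul hk.le]
      congr 2 <;> push_cast <;> ring
    have e2 : (1 - r) ^ (-(n : ℝ) / 2) * (1 - r) ^ (-(n : ℝ) / 2) = (((1 - r) ^ 2)⁻¹) ^ ((n : ℝ) / 2) := by
      rw [Real.inv_rpow (by positivity), ← Real.rpow_natCast, ← Real.rpow_mul hr.le,
        ← Real.rpow_neg hr.le, ← Real.rpow_add hr]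
      congr 1; push_cast; ring
    have h3 : 0 < 1 - r ^ 2 := by nlinarith
    rw [hs _ (by positivity), e1, e2, ← Real.mul_rpow (by positivity) (by positivity),
      ← Real.mul_rpow (by positivity) (by positivity), ← Real.mul_rpow (by positivity) (by positivity)]
    have h4 : 2 * (k : ℝ) ^ 2 * ((1 - r ^ 2) / k) * (((1 - r) ^ 2)⁻¹ *
        (Real.pi / (2 * (k * Real.pi * ((1 + r) / (1 - r)))))) = 1 := by
      have hpi := Real.pi_pos
      rw [show 1 - r ^ 2 = (1 - r) * (1 + r) by ring]
      field_simp
    rw [h4, Real.one_rpow]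
  · simp

/-! ### Fourier series of smooth functions on the torus -/

/-- The pairing of a frequency `p = (a, b)` with a vector `u = (x, y)`. -/
def latDot {n : ℕ} (p : Lat n) (u : Vec n) : ℝ :=
  ∑ i, (p.1 i : ℝ) * u.1 i + ∑ i, (p.2 i : ℝ) * u.2 i

lemma latDot_add {n : ℕ} (p : Lat n) (u v : Vec n) : latDot p (u + v) = latDot p u + latDot p v := by
  simp only [latDot, Prod.fst_add, Prod.snd_add, Pi.add_apply, mul_add, Finset.sum_add_distrib]
  ring

lemma latDot_smul {n : ℕ} (p : Lat n) (c : ℝ) (u : Vec n) : latDot p (c • u) = c * latDot p u := by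
  simp only [latDot, Prod.smul_fst, Prod.smul_snd, Pi.smul_apply, smul_eq_mul, mul_add, Finset.mul_sum]
  congr 1 <;> exact Finset.sum_congr rfl fun i _ => by ring

lemma latDot_latVec {n : ℕ} (p l : Lat n) :
    latDot p (latVec l) = ((∑ i, p.1 i * l.1 i + ∑ i, p.2 i * l.2 i : ℤ) : ℝ) := by
  simp [latDot, latVec]

lemma contDiff_latDot {n : ℕ} (p : Lat n) : ContDiff ℝ ∞ (latDot p) := by
  unfold latDot; fun_prop

lemma hasFDerivAt_expi_latDot {n : ℕ} (p : Lat n) (u : Vec n) :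
    ∃ D : Vec n →L[ℝ] ℂ, HasFDerivAt (fun u : Vec n => expi (-latDot p u)) D u ∧
      ∀ v, D v = -(2 * Real.pi * Complex.I * (latDot p v : ℂ)) * expi (-latDot p u) := by
  let A : Vec n →ₗ[ℝ] ℝ :=
    { toFun := latDot p
      map_add' := latDot_add p
      map_smul' := latDot_smul p }
  have h1 := (Complex.ofRealCLM.hasFDerivAt (x := -A u)).comp u
    A.toContinuousLinearMap.hasFDerivAt.neg
  have h2 := (h1.const_mul (2 * Real.pi * Complex.I : ℂ)).cexp
  refine ⟨_, h2, fun a => ?_⟩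
  simp [expi, A]
  ring

/-- The Fourier coefficients of a function on the torus. The function is not required to be periodic. -/
def fourierCoef {n : ℕ} (f : Vec n → ℂ) (p : Lat n) : ℂ :=
  ∫ u in cube n ×ˢ cube n, f u * expi (-latDot p u)

open MeasureTheory in
/-- Derivatives of functions on the torus have mean zero. -/
lemma integral_box_fderiv {n : ℕ} (h : smoothTorus n) (v : Vec n) (hv : v.1 = 0 ∨ v.2 = 0) :
    ∫ u in cube n ×ˢ cube n, fderiv ℝ h.1 u v = 0 := by
  have hd : Differentiable ℝ h.1 := h.2.1.differentiable (by simp)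
  have hc : Continuous fun u => fderiv ℝ h.1 u v :=
    (h.2.1.continuous_fderiv (by simp)).clm_apply continuous_const
  have hi : Integrable (fun u => fderiv ℝ h.1 u v)
      ((volume.restrict (cube n)).prod (volume.restrict (cube n))) := by
    rw [Measure.prod_restrict, ← Measure.volume_eq_prod]
    exact hc.continuousOn.integrableOn_compact (isCompact_box n)
  have hper : ∀ (u : Vec n) (l : Lat n), h.1 (u + latVec l) = h.1 u := h.2.2
  rw [Measure.volume_eq_prod, ← Measure.prod_restrict]
  rcases hv with hv | hv
  · rw [integral_prod _ hi]
    refine integral_eq_zero_of_ae (Filter.Eventually.of_forall fun x => ?_)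
    have hF : ContDiff ℝ 1 fun y : Fin n → ℝ => h.1 (x, y) :=
      (h.2.1.of_le (by exact_mod_cast le_top)).comp (by fun_prop)
    rw [Pi.zero_apply, ← integral_cube_fderiv _ hF (fun y i => ?_) v.2]
    · refine integral_congr_ae (Filter.Eventually.of_forall fun y => ?_)
      change fderiv ℝ h.1 (x, y) v = fderiv ℝ (fun y : Fin n → ℝ => h.1 (x, y)) y v.2
      have h1 := (hd (x, y)).hasFDerivAt.comp y (hasFDerivAt_prodMk_right x y)
      have h2 : fderiv ℝ (fun y : Fin n → ℝ => h.1 (x, y)) y = _ := h1.fderiv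
      rw [h2]
      have hvv : v = (0, v.2) := by rw [← hv]
      conv_lhs => rw [hvv]
      simp
    · have h1 : ((x, y + Pi.single i 1) : Vec n) = (x, y) + latVec ((0, Pi.single i 1) : Lat n) := by
        ext j
        · simp [latVec]
        · by_cases hj : j = i
          · subst hj; simp [latVec]
          · simp [latVec, hj]
      rw [h1, hper]
  · rw [integral_prod_symm _ hi]
    refine integral_eq_zero_of_ae (Filter.Eventually.of_forall fun y => ?_)
    have hF : ContDiff ℝ 1 fun x : Fin n → ℝ => h.1 (x, y) :=
      (h.2.1.of_le (by exact_mod_cast le_top)).comp (by fun_prop)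
    rw [Pi.zero_apply, ← integral_cube_fderiv _ hF (fun x i => ?_) v.1]
    · refine integral_congr_ae (Filter.Eventually.of_forall fun x => ?_)
      change fderiv ℝ h.1 (x, y) v = fderiv ℝ (fun x : Fin n → ℝ => h.1 (x, y)) x v.1
      have h0 : HasFDerivAt (fun x : Fin n → ℝ => ((x, y) : Vec n))
        (ContinuousLinearMap.inl ℝ _ _) x := hasFDerivAt_prodMk_left x y
      have h1 := (hd (x, y)).hasFDerivAt.comp x h0
      have h2 : fderiv ℝ (fun x : Fin n → ℝ => h.1 (x, y)) x = _ := h1.fderiv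
      rw [h2]
      have hvv : v = (v.1, 0) := by rw [← hv]
      conv_lhs => rw [hvv]
      simp
    · have h1 : ((x + Pi.single i 1, y) : Vec n) = (x, y) + latVec ((Pi.single i 1, 0) : Lat n) := by
        ext j
        · by_cases hj : j = i
          · subst hj; simp [latVec]
          · simp [latVec, hj]
        · simp [latVec]
      rw [h1, hper]

open MeasureTheory in
lemma integrableOn_fourier {n : ℕ} (f : smoothTorus n) (p : Lat n) :
    IntegrableOn (fun u => f.1 u * expi (-latDot p u)) (cube n ×ˢ cube n) :=
  (f.2.1.continuous.mul (contDiff_expi.continuous.comp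
    (contDiff_latDot p).continuous.neg)).continuousOn.integrableOn_compact (isCompact_box n)

open MeasureTheory in
/-- Integration by parts. The vector `v` is horizontal or vertical. -/
lemma fourierCoef_fderiv {n : ℕ} (f g : smoothTorus n) (v : Vec n) (hv : v.1 = 0 ∨ v.2 = 0)
    (hg : ∀ u, g.1 u = fderiv ℝ f.1 u v) (p : Lat n) :
    fourierCoef g.1 p = 2 * Real.pi * Complex.I * (latDot p v : ℂ) * fourierCoef f.1 p := by
  let h : smoothTorus n := ⟨fun u => f.1 u * expi (-latDot p u),
    f.2.1.mul (contDiff_expi.comp (contDiff_latDot p).neg), fun u l => by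
      beta_reduce
      rw [f.2.2, latDot_add, latDot_latVec, neg_add, ← Int.cast_neg, expi_add_int]⟩
  have h1 := integral_box_fderiv h v hv
  have h2 : ∀ u, fderiv ℝ h.1 u v = g.1 u * expi (-latDot p u)
      - 2 * Real.pi * Complex.I * (latDot p v : ℂ) * (f.1 u * expi (-latDot p u)) := fun u => by
    obtain ⟨D, hD, hw⟩ := hasFDerivAt_expi_latDot p u
    have h3 := ((f.2.1.differentiable (by simp) u).hasFDerivAt).mul hD
    have h4 : fderiv ℝ h.1 u = _ := h3.fderiv
    rw [h4, hg]
    simp [hw]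
    ring
  simp only [h2] at h1
  rw [integral_sub (integrableOn_fourier g p) ((integrableOn_fourier f p).const_mul _),
    integral_const_mul, sub_eq_zero] at h1
  exact h1

/-- The Fourier coefficients of iterated partial derivatives. -/
lemma fourierCoef_partials {n : ℕ} (j : ℕ) (v : Fin j → Vec n) (hv : ∀ l, (v l).1 = 0 ∨ (v l).2 = 0)
    (f : smoothTorus n) (p : Lat n) :
    fourierCoef (partials v f).1 p
      = (∏ l, 2 * Real.pi * Complex.I * (latDot p (v l) : ℂ)) * fourierCoef f.1 p := by
  induction j with
  | zero =>
    rw [Fin.prod_univ_zero, one_mul]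
    congr 1
  | succ j ih =>
    rw [fourierCoef_fderiv (partials (Fin.tail v) f) (partials v f) (v 0) (hv 0), ih (Fin.tail v) fun l => hv l.succ,
      Fin.prod_univ_succ]
    · exact (mul_assoc _ _ _).symm
    · intro u
      have hd : Differentiable ℝ (iteratedFDeriv ℝ j f.1) :=
        f.2.1.differentiable_iteratedFDeriv (by exact_mod_cast WithTop.coe_lt_top j)
      change iteratedFDeriv ℝ (j + 1) f.1 u v = fderiv ℝ (fun u => iteratedFDeriv ℝ j f.1 u (Fin.tail v)) u (v 0)
      rw [iteratedFDeriv_succ_apply_left]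
      have h1 := ((ContinuousMultilinearMap.apply ℝ (fun _ : Fin j => Vec n) ℂ
        (Fin.tail v)).hasFDerivAt).comp u (hd u).hasFDerivAt
      have h2 : fderiv ℝ (fun u => iteratedFDeriv ℝ j f.1 u (Fin.tail v)) u = _ := h1.fderiv
      rw [h2]
      rfl

/-- The weight `∏ (1 + aᵢ²) ∏ (1 + bᵢ²)` of a frequency `(a, b)`. -/
def weight {n : ℕ} (p : Lat n) : ℝ := (∏ i, (1 + (p.1 i : ℝ) ^ 2)) * ∏ i, (1 + (p.2 i : ℝ) ^ 2)

lemma weight_pos {n : ℕ} (p : Lat n) : 0 < weight p := by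
  unfold weight; positivity

lemma summable_weight_inv (n : ℕ) : Summable fun p : Lat n => (weight p)⁻¹ := by
  have h : Summable fun a : Fin n → ℤ => ∏ i, (1 + (a i : ℝ) ^ 2)⁻¹ :=
    summable_pi_prod (h := fun _ (q : ℤ) => (1 + (q : ℝ) ^ 2)⁻¹) (fun _ _ => by positivity)
      fun _ => summable_int_inv_one_add_sq
  have h0 : ∀ a : Fin n → ℤ, 0 ≤ ∏ i, (1 + (a i : ℝ) ^ 2)⁻¹ := fun a =>
    Finset.prod_nonneg fun i _ => by positivity
  refine (h.mul_of_nonneg h h0 h0).congr fun p => ?_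
  rw [weight, mul_inv, Finset.prod_inv_distrib, Finset.prod_inv_distrib]

open MeasureTheory in
lemma fourierCoef_sub_smul {n : ℕ} (f g : smoothTorus n) (c : ℂ) (p : Lat n) :
    fourierCoef (f - c • g).1 p = fourierCoef f.1 p - c * fourierCoef g.1 p := by
  rw [fourierCoef, fourierCoef, fourierCoef, ← integral_const_mul,
    ← integral_sub (integrableOn_fourier f p) ((integrableOn_fourier g p).const_mul _)]
  congr 1
  ext u
  change (f.1 u - c * g.1 u) * _ = _
  ring

/-- The operator `1 - ∂_v² / 4π²` multiplies the Fourier coefficients by `1 + ⟨p,v⟩²`. -/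
lemma exists_weight_operator {n : ℕ} (v : Vec n) (hv : v.1 = 0 ∨ v.2 = 0) (f : smoothTorus n) :
    ∃ g : smoothTorus n, ∀ p, fourierCoef g.1 p = (1 + (latDot p v : ℂ) ^ 2) * fourierCoef f.1 p := by
  refine ⟨f - (4 * Real.pi ^ 2 : ℂ)⁻¹ • partials (fun _ : Fin 2 => v) f, fun p => ?_⟩
  rw [fourierCoef_sub_smul, fourierCoef_partials 2 _ fun _ => hv]
  have hpi : (Real.pi : ℂ) ≠ 0 := by exact_mod_cast Real.pi_ne_zero
  rw [Fin.prod_univ_two]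
  field_simp
  linear_combination (-4 * (latDot p v : ℂ) ^ 2 * (fourierCoef f.1 p)) * Complex.I_sq

lemma latDot_ex {n : ℕ} (p : Lat n) (i : Fin n) : latDot p (ex i) = p.1 i := by
  simp [latDot, ex, Pi.single_apply]

lemma latDot_ey {n : ℕ} (p : Lat n) (i : Fin n) : latDot p (ey i) = p.2 i := by
  simp [latDot, ey, Pi.single_apply]

/-- Multiplication of the Fourier coefficients by `weight` preserves smoothness: apply the operator of
`exists_weight_operator` once for every coordinate. -/
lemma exists_fourierCoef_weight {n : ℕ} (f : smoothTorus n) :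
    ∃ g : smoothTorus n, ∀ p, fourierCoef g.1 p = (weight p : ℂ) * fourierCoef f.1 p := by
  have h1 : ∀ (S : Finset (Fin n)) (f : smoothTorus n), ∃ g : smoothTorus n, ∀ p,
      fourierCoef g.1 p = (∏ i ∈ S, (1 + (p.1 i : ℂ) ^ 2)) * fourierCoef f.1 p := by
    intro S
    induction S using Finset.induction_on with
    | empty => exact fun f => ⟨f, fun p => by simp⟩
    | insert a S ha ih =>
      intro f
      obtain ⟨g, hg⟩ := ih f
      obtain ⟨h, hh⟩ := exists_weight_operator (ex a) (Or.inr rfl) g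
      refine ⟨h, fun p => ?_⟩
      rw [hh, hg, Finset.prod_insert ha, latDot_ex, mul_assoc]
      push_cast
      rfl
  have h2 : ∀ (S : Finset (Fin n)) (f : smoothTorus n), ∃ g : smoothTorus n, ∀ p,
      fourierCoef g.1 p = (∏ i ∈ S, (1 + (p.2 i : ℂ) ^ 2)) * fourierCoef f.1 p := by
    intro S
    induction S using Finset.induction_on with
    | empty => exact fun f => ⟨f, fun p => by simp⟩
    | insert a S ha ih =>
      intro f
      obtain ⟨g, hg⟩ := ih f
      obtain ⟨h, hh⟩ := exists_weight_operator (ey a) (Or.inl rfl) g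
      refine ⟨h, fun p => ?_⟩
      rw [hh, hg, Finset.prod_insert ha, latDot_ey, mul_assoc]
      push_cast
      rfl
  obtain ⟨g, hg⟩ := h2 Finset.univ f
  obtain ⟨h, hh⟩ := h1 Finset.univ g
  refine ⟨h, fun p => ?_⟩
  rw [hh, hg, weight, ← mul_assoc]
  push_cast
  rfl

open MeasureTheory in
/-- The Fourier coefficients of a smooth function are rapidly decreasing. -/
lemma summable_weight_pow_fourierCoef {n : ℕ} (M : ℕ) (f : smoothTorus n) :
    Summable fun p => weight p ^ M * ‖fourierCoef f.1 p‖ := by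
  have hpow : ∀ M : ℕ, ∃ g : smoothTorus n, ∀ p,
      fourierCoef g.1 p = (weight p : ℂ) ^ M * fourierCoef f.1 p := by
    intro M
    induction M with
    | zero => exact ⟨f, fun p => by simp⟩
    | succ M ih =>
      obtain ⟨g, hg⟩ := ih
      obtain ⟨h, hh⟩ := exists_fourierCoef_weight g
      exact ⟨h, fun p => by rw [hh, hg, pow_succ]; ring⟩
  obtain ⟨g, hg⟩ := hpow (M + 1)
  obtain ⟨C, hC⟩ := (isCompact_box n).exists_bound_of_continuousOn g.2.1.continuous.continuousOn
  have hb : ∀ p, ‖fourierCoef g.1 p‖ ≤ C * volume.real (cube n ×ˢ cube n) := fun p =>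
    norm_setIntegral_le_of_norm_le_const (isCompact_box n).measure_lt_top fun u hu => by
      rw [norm_mul, norm_expi, mul_one]; exact hC u hu
  refine Summable.of_nonneg_of_le (fun p => by have := weight_pos p; positivity) (fun p => ?_)
    ((summable_weight_inv n).mul_left (C * volume.real (cube n ×ˢ cube n)))
  have hw := weight_pos p
  have h1 := hb p
  rw [hg, norm_mul, norm_pow, Complex.norm_real, Real.norm_of_nonneg hw.le, pow_succ] at h1
  rw [← div_eq_mul_inv, le_div_iff₀ hw]
  linarith

lemma summable_fourierCoef {n : ℕ} (f : smoothTorus n) : Summable fun p => ‖fourierCoef f.1 p‖ := by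
  simpa using summable_weight_pow_fourierCoef 0 f

open MeasureTheory in
/-- A smooth function on the torus is the sum of its Fourier series. It is transported to
`UnitAddTorus`, where the pointwise convergence is known for summable coefficients. -/
lemma hasSum_fourierCoef {n : ℕ} (f : smoothTorus n) (u : Vec n) :
    HasSum (fun p => fourierCoef f.1 p * expi (latDot p u)) (f.1 u) := by
  let d := Fin n ⊕ Fin n
  let π : C(d → ℝ, UnitAddTorus d) := ⟨fun x i => (x i : UnitAddCircle),
    continuous_pi fun i => (AddCircle.continuous_mk' 1).comp (continuous_apply i)⟩
  have hπ : Topology.IsQuotientMap π :=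
    (IsOpenQuotientMap.piMap fun _ : d =>
      (QuotientAddGroup.isOpenQuotientMap_mk (N := AddSubgroup.zmultiples (1 : ℝ)))).isQuotientMap
  let fl : C(d → ℝ, ℂ) := ⟨fun x => f.1 (fun i => x (Sum.inl i), fun i => x (Sum.inr i)),
    f.2.1.continuous.comp (by fun_prop)⟩
  have hfac : Function.FactorsThrough fl π := by
    intro x x' hx
    have h1 : ∀ i, ∃ j : ℤ, x i = x' i + j := fun i => by
      have h2 : ((x i - x' i : ℝ) : UnitAddCircle) = 0 := by
        rw [AddCircle.coe_sub, sub_eq_zero]; exact congrFun hx i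
      obtain ⟨j, hj⟩ := (AddCircle.coe_eq_zero_iff 1).1 h2
      refine ⟨j, ?_⟩
      rw [zsmul_eq_mul, mul_one] at hj
      linarith
    choose j hj using h1
    have h2 := f.2.2 (fun i => x' (Sum.inl i), fun i => x' (Sum.inr i))
      (fun i => j (Sum.inl i), fun i => j (Sum.inr i))
    change f.1 _ = f.1 _
    rw [← h2]
    simp only [hj]
    rfl
  let F : C(UnitAddTorus d, ℂ) := hπ.lift fl hfac
  have hF : ∀ x : d → ℝ, F (fun i => (x i : UnitAddCircle)) = fl x := fun x =>
    congrFun (congrArg DFunLike.coe (hπ.lift_comp fl hfac)) x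
  let e : (d → ℤ) ≃ Lat n := Equiv.sumArrowEquivProdArrow (Fin n) (Fin n) ℤ
  have hm : ∀ (q : d → ℤ) (x : d → ℝ), UnitAddTorus.mFourier q (fun i => (x i : UnitAddCircle))
      = expi (latDot (e q) (fun i => x (Sum.inl i), fun i => x (Sum.inr i))) := by
    intro q x
    change ∏ i, fourier (q i) (x i : UnitAddCircle) = _
    have h1 : ∀ i, fourier (q i) (x i : UnitAddCircle) = expi ((q i : ℝ) * x i) := fun i => by
      rw [fourier_coe_apply, expi]
      congr 1
      push_cast
      ring
    simp only [h1]
    rw [← expi_sum, Fintype.sum_sum_type]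
    rfl
  have hcoef : ∀ q, UnitAddTorus.mFourierCoeff F q = fourierCoef f.1 (e q) := by
    intro q
    have hset : {x : d → ℝ | ∀ i, x i ∈ Set.Ioc ((0 : d → ℝ) i) ((0 : d → ℝ) i + 1)}
        =ᵐ[volume] (MeasurableEquiv.sumPiEquivProdPi fun _ : d => ℝ) ⁻¹' (cube n ×ˢ cube n) := by
      have h1 : {x : d → ℝ | ∀ i, x i ∈ Set.Ioc ((0 : d → ℝ) i) ((0 : d → ℝ) i + 1)}
          = Set.univ.pi fun i => Set.Ioc ((0 : d → ℝ) i) ((1 : d → ℝ) i) := by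
        ext x; simp
      have h2 : (MeasurableEquiv.sumPiEquivProdPi fun _ : d => ℝ) ⁻¹' (cube n ×ˢ cube n)
          = Set.Icc (0 : d → ℝ) 1 := by
        ext x
        change ((0 ≤ (fun i => x (Sum.inl i)) ∧ (fun i => x (Sum.inl i)) ≤ 1) ∧
          (0 ≤ (fun i => x (Sum.inr i)) ∧ (fun i => x (Sum.inr i)) ≤ 1)) ↔ 0 ≤ x ∧ x ≤ 1
        simp only [Pi.le_def, Sum.forall, Pi.zero_apply, Pi.one_apply]
        tauto
      rw [h1, h2]
      exact Measure.univ_pi_Ioc_ae_eq_Icc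
    rw [UnitAddTorus.mFourierCoeff_eq_integral _ _ 0, setIntegral_congr_set hset, fourierCoef]
    rw [← (volume_measurePreserving_sumPiEquivProdPi fun _ : d => ℝ).setIntegral_preimage_emb
      (MeasurableEquiv.measurableEmbedding _)]
    congr 1
    ext x
    rw [hF, hm, smul_eq_mul, mul_comm]
    change f.1 _ * _ = f.1 _ * _
    congr 2
    simp only [latDot]
    change ∑ i, ((-q (Sum.inl i) : ℤ) : ℝ) * _ + ∑ i, ((-q (Sum.inr i) : ℤ) : ℝ) * _
      = -(∑ i, (q (Sum.inl i) : ℝ) * _ + ∑ i, (q (Sum.inr i) : ℝ) * _)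
    rw [neg_add, ← Finset.sum_neg_distrib, ← Finset.sum_neg_distrib]
    congr 1 <;> exact Finset.sum_congr rfl fun i _ => by push_cast; exact neg_mul _ _
  have hs : Summable (UnitAddTorus.mFourierCoeff F) := by
    rw [funext hcoef]
    exact e.summable_iff.2 (summable_fourierCoef f).of_norm
  have h := UnitAddTorus.hasSum_mFourier_series_apply_of_summable hs
    (fun i => ((Sum.elim u.1 u.2 i : ℝ) : UnitAddCircle))
  rw [hF] at h
  simp only [hcoef, hm] at h
  exact e.hasSum_iff.1 h

/-! ### The inner product on the quantum space -/

/-- The coordinates of a quantum state in the basis `σ^m`, with the `ℓ²` norm. -/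
def coord (n k : ℕ) [NeZero k] :
    quantumSpace n k ≃ₗ[ℂ] EuclideanSpace ℂ (Fin n → ZMod k) :=
  (sigmaBasis n k).equivFun ≪≫ₗ (WithLp.linearEquiv 2 ℂ _).symm

lemma coord_apply {n k : ℕ} [NeZero k] (s : quantumSpace n k) (m : Fin n → ZMod k) :
    coord n k s m = (sigmaBasis n k).repr s m := rfl

lemma coord_sigma {n k : ℕ} [NeZero k] (m : Fin n → ZMod k) :
    coord n k (sigma m) = EuclideanSpace.single m 1 := by
  ext m'
  rw [coord_apply, ← sigmaBasis_apply, Module.Basis.repr_self]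
  simp [Finsupp.single_apply, eq_comm]

/-- The inner product on the quantum space for which the states `σ^m` are orthonormal. -/
@[reducible] def sigmaInner (n k : ℕ) [NeZero k] : InnerProductSpace.Core ℂ (quantumSpace n k) where
  inner s t := inner ℂ (coord n k s) (coord n k t)
  conj_inner_symm s t := inner_conj_symm _ _
  re_inner_nonneg s := inner_self_nonneg (𝕜 := ℂ)
  add_left s t u := by rw [map_add, inner_add_left]
  smul_left s t c := by rw [map_smul, inner_smul_left]
  definite s h := by simpa using h

lemma normOf_sigmaInner {n k : ℕ} [NeZero k] (s : quantumSpace n k) :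
    normOf (sigmaInner n k) s = ‖coord n k s‖ :=
  (norm_eq_sqrt_re_inner (𝕜 := ℂ) (coord n k s)).symm

lemma sigmaInner_sigma {n k : ℕ} [NeZero k] (m m' : Fin n → ZMod k) :
    (sigmaInner n k).inner (sigma m') (sigma m) = if m = m' then 1 else 0 := by
  change inner ℂ (coord n k (sigma m')) (coord n k (sigma m)) = _
  rw [coord_sigma, coord_sigma, EuclideanSpace.inner_single_left]
  simp [eq_comm]

/-- An inner product is determined by its values on a basis. -/
lemma core_ext_basis {ι V : Type*} [AddCommGroup V] [Module ℂ V] (b : Module.Basis ι ℂ V)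
    {B B' : InnerProductSpace.Core ℂ V} (h : ∀ i j, B.inner (b i) (b j) = B'.inner (b i) (b j)) :
    B = B' := by
  let F : InnerProductSpace.Core ℂ V → V →ₗ⋆[ℂ] V →ₗ[ℂ] ℂ := fun B =>
    LinearMap.mk₂'ₛₗ (starRingEnd ℂ) (RingHom.id ℂ) B.inner B.add_left
      (fun c x y => B.smul_left x y c)
      (fun x y z => by
        rw [← B.conj_inner_symm, B.add_left, map_add, B.conj_inner_symm, B.conj_inner_symm])
      (fun c x y => by
        rw [← B.conj_inner_symm, B.smul_left, map_mul, B.conj_inner_symm, Complex.conj_conj]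
        rfl)
  have h1 : F B = F B' := LinearMap.ext_basis b b h
  have h2 : B.inner = B'.inner := by
    ext x y
    exact congrArg (fun G : V →ₗ⋆[ℂ] V →ₗ[ℂ] ℂ => G x y) h1
  obtain ⟨⟨⟨i⟩, _, _, _, _⟩, _⟩ := B
  obtain ⟨⟨⟨i'⟩, _, _, _, _⟩, _⟩ := B'
  obtain rfl : i = i' := h2
  rfl

/-- The BKS pairing is constant along the ray, so the boundary value exists. -/
lemma tendsto_bksRay {n k : ℕ} [NeZero k] (m m' : Fin n → ZMod k) :
    Filter.Tendsto (fun r : ℝ => bksRay r m m') (nhdsWithin 1 (Set.Iio 1))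
      (nhds ((sigmaInner n k).inner (sigma m') (sigma m))) := by
  rw [sigmaInner_sigma]
  refine tendsto_const_nhds.congr' ?_
  filter_upwards [Ioo_mem_nhdsLT (zero_lt_one' ℝ)] with r hr
  exact (bksRay_eq hr.1 hr.2 m m').symm

lemma isBKSInner_iff {n k : ℕ} [NeZero k] (B : InnerProductSpace.Core ℂ (quantumSpace n k)) :
    IsBKSInner B ↔ B = sigmaInner n k := by
  constructor
  · intro h
    refine core_ext_basis (sigmaBasis n k) fun m' m => ?_
    rw [sigmaBasis_apply, sigmaBasis_apply]
    exact tendsto_nhds_unique (h m m') (tendsto_bksRay m m')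
  · rintro rfl m m'
    exact tendsto_bksRay m m'

/-! ### Weyl operators -/

/-- The value at `m` of the character of `(ℤ/k)ⁿ` of weight `b`. -/
def weylChar {n k : ℕ} (b : Fin n → ℤ) (m : Fin n → ZMod k) : ℂ :=
  expi (∑ i, (b i : ℝ) * (m i).val / k)

/-- The reduction modulo `k` of an integer vector. -/
def redMod {n : ℕ} (k : ℕ) (a : Fin n → ℤ) : Fin n → ZMod k := fun i => (a i : ZMod k)

lemma redMod_add {n k : ℕ} (a a' : Fin n → ℤ) : redMod k (a + a') = redMod k a + redMod k a' := by
  ext i; simp [redMod]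

lemma weylChar_add_left {n k : ℕ} (b b' : Fin n → ℤ) (m : Fin n → ZMod k) :
    weylChar (b + b') m = weylChar b m * weylChar b' m := by
  rw [weylChar, weylChar, weylChar, ← expi_add, ← Finset.sum_add_distrib]
  congr 1
  exact Finset.sum_congr rfl fun i _ => by simp only [Pi.add_apply]; push_cast; ring

lemma norm_weylChar {n k : ℕ} (b : Fin n → ℤ) (m : Fin n → ZMod k) : ‖weylChar b m‖ = 1 :=
  norm_expi _

/-- `weylChar b` is multiplicative although it is defined by representatives in `[0, k)`: a change of
representatives changes the exponent by an integer. -/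
lemma weylChar_add_redMod {n k : ℕ} [NeZero k] (b a : Fin n → ℤ) (m : Fin n → ZMod k) :
    weylChar b (m + redMod k a) = weylChar b m * expi (∑ i, (b i : ℝ) * a i / k) := by
  have hk : (k : ℝ) ≠ 0 := by exact_mod_cast NeZero.ne k
  have h1 : ∀ i, ∃ z : ℤ, (((m + redMod k a) i).val : ℤ) = (m i).val + a i - k * z := fun i => by
    have h2 : ((((m + redMod k a) i).val : ℤ) : ZMod k) = (((m i).val + a i : ℤ) : ZMod k) := by
      simp [redMod]
    rw [ZMod.intCast_eq_intCast_iff_dvd_sub] at h2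
    obtain ⟨z, hz⟩ := h2
    exact ⟨z, by linarith⟩
  choose z hz using h1
  have h3 : ∀ i, (((m + redMod k a) i).val : ℝ) = (m i).val + a i - k * z i := fun i => by
    exact_mod_cast congrArg (Int.cast : ℤ → ℝ) (hz i)
  rw [weylChar, weylChar, ← expi_add, ← expi_add_int _ (∑ i, b i * z i)]
  congr 1
  push_cast
  rw [← Finset.sum_add_distrib, ← Finset.sum_add_distrib]
  refine Finset.sum_congr rfl fun i _ => ?_
  rw [h3]
  field_simp
  ring

/-- The Weyl operator `W_p`, `p = (a, b)`, given by `W_p σ^m = e^{2πi b·m/k} σ^{m+a}`, in the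
coordinates of `coord`. It is the operator `Q_f` for the character `f(x, y) = e^{2πi(a·x + b·y)}`. -/
def weyl {n : ℕ} (k : ℕ) [NeZero k] (p : Lat n) :
    EuclideanSpace ℂ (Fin n → ZMod k) →L[ℂ] EuclideanSpace ℂ (Fin n → ZMod k) :=
  LinearMap.mkContinuous
    { toFun := fun c => WithLp.toLp 2 fun m =>
        weylChar p.2 (m - redMod k p.1) * c (m - redMod k p.1)
      map_add' := fun c d => by ext m; simp [mul_add]
      map_smul' := fun r c => by ext m; simp; ring } 1 fun c => by
    rw [one_mul, EuclideanSpace.norm_eq, EuclideanSpace.norm_eq]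
    refine Real.sqrt_le_sqrt (le_of_eq ?_)
    simp only [LinearMap.coe_mk, AddHom.coe_mk, norm_mul, norm_weylChar, one_mul]
    exact (Equiv.subRight (redMod k p.1)).sum_comp fun m => ‖c m‖ ^ 2

lemma norm_weyl_le {n k : ℕ} [NeZero k] (p : Lat n) : ‖weyl k p‖ ≤ 1 :=
  LinearMap.mkContinuous_norm_le _ zero_le_one _

/-- The Weyl relation. -/
lemma weyl_mul {n k : ℕ} [NeZero k] (p q : Lat n) :
    weyl k p * weyl k q = expi (∑ i, (p.2 i : ℝ) * q.1 i / k) • weyl k (p + q) := by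
  ext c m
  change weylChar p.2 (m - redMod k p.1) * (weylChar q.2 (m - redMod k p.1 - redMod k q.1) *
      c (m - redMod k p.1 - redMod k q.1))
    = expi _ * (weylChar (p.2 + q.2) (m - redMod k (p.1 + q.1)) * c (m - redMod k (p.1 + q.1)))
  rw [redMod_add, ← sub_sub, weylChar_add_left]
  have h := weylChar_add_redMod p.2 q.1 (m - redMod k p.1 - redMod k q.1)
  rw [sub_add_cancel] at h
  rw [h]
  ring

/-- The matrix of `Q_f` for a character `f` is the matrix of the Weyl operator. -/
lemma toeplitzCoeff_expi {n k : ℕ} [NeZero k] (p : Lat n) (m' m : Fin n → ZMod k) :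
    toeplitzCoeff (fun u => expi (latDot p u)) m' m
      = if m = m' - redMod k p.1 then weylChar p.2 m else 0 := by
  have hk : (k : ℂ) ^ n ≠ 0 := pow_ne_zero _ (by exact_mod_cast NeZero.ne k)
  have h1 : ∀ j : Fin n → ZMod k,
      expi (latDot p (bsPoint j, bsPoint m)) * character m j * starRingEnd ℂ (character m' j)
        = weylChar p.2 m *
          expi (∑ i, ((p.1 i + (m i).val - (m' i).val : ℤ) : ℝ) * (j i).val / k) := fun j => by
    rw [character_eq_expi, character_eq_expi, conj_expi, weylChar, ← expi_add, ← expi_add,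
      ← expi_add]
    congr 1
    simp only [latDot, bsPoint]
    rw [← Finset.sum_neg_distrib, ← Finset.sum_add_distrib, ← Finset.sum_add_distrib,
      ← Finset.sum_add_distrib, ← Finset.sum_add_distrib]
    refine Finset.sum_congr rfl fun i _ => ?_
    push_cast
    ring
  have h2 : ((fun i => ((p.1 i + (m i).val - (m' i).val : ℤ) : ZMod k)) = 0)
      ↔ m = m' - redMod k p.1 := by
    rw [funext_iff, funext_iff]
    refine forall_congr' fun i => ?_
    simp only [redMod, Pi.sub_apply, Pi.zero_apply]
    push_cast
    rw [ZMod.natCast_zmod_val, ZMod.natCast_zmod_val]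
    constructor <;> intro h <;> linear_combination h
  rw [toeplitzCoeff]
  simp only [h1]
  rw [← Finset.mul_sum, sum_expi_zmod_pi]
  simp only [h2]
  split_ifs
  · field_simp
  · simp

lemma summable_smul_weyl {n k : ℕ} [NeZero k] {ι : Type*} {c : ι → ℂ} (p : ι → Lat n)
    (hc : Summable fun i => ‖c i‖) : Summable fun i => ‖c i • weyl k (p i)‖ :=
  hc.of_nonneg_of_le (fun _ => norm_nonneg _) fun i => by
    rw [norm_smul]
    exact mul_le_of_le_one_right (norm_nonneg _) (norm_weyl_le _)

/-- The operator `Q_h` of an absolutely convergent trigonometric series is the corresponding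
series of Weyl operators. -/
lemma coord_toeplitz {n k : ℕ} [NeZero k] {ι : Type*} {c : ι → ℂ} (p : ι → Lat n)
    (hc : Summable fun i => ‖c i‖) (h : smoothTorus n)
    (hs : ∀ u, HasSum (fun i => c i * expi (latDot (p i) u)) (h.1 u)) (s : quantumSpace n k) :
    coord n k (toeplitz n k h s) = (∑' i, c i • weyl k (p i)) (coord n k s) := by
  ext m'
  have h1 := (summable_smul_weyl (k := k) p hc).of_norm.hasSum
  have h2 := ((EuclideanSpace.proj m' : EuclideanSpace ℂ (Fin n → ZMod k) →L[ℂ] ℂ).comp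
    (ContinuousLinearMap.apply ℂ _ (coord n k s))).hasSum h1
  -- a matrix coefficient of `Q_h` is a finite combination of values of `h`, so pointwise convergence
  -- of the series suffices
  have h3 : HasSum (fun i => ∑ m, c i * toeplitzCoeff (fun u => expi (latDot (p i) u)) m' m
      * coord n k s m) (∑ m, toeplitzCoeff h.1 m' m * coord n k s m) := by
    refine hasSum_sum fun m _ => HasSum.mul_right _ ?_
    have h4 := (hasSum_sum (s := Finset.univ) fun (j : Fin n → ZMod k) _ =>
      ((hs (bsPoint j, bsPoint m)).mul_right (character m j)).mul_right
        (starRingEnd ℂ (character m' j))).mul_left ((k : ℂ) ^ n)⁻¹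
    convert! h4 using 2 with i
    rw [toeplitzCoeff, ← mul_assoc, mul_comm (c i), mul_assoc, Finset.mul_sum]
    congr 1
    exact Finset.sum_congr rfl fun j _ => by ring
  have h5 : coord n k (toeplitz n k h s) m' = ∑ m, toeplitzCoeff h.1 m' m * coord n k s m := by
    rw [coord_apply, toeplitz, Matrix.repr_toLin]
    rfl
  rw [h5]
  refine h3.unique ?_
  convert! h2 using 1
  ext i
  change _ = c i * (weylChar (p i).2 (m' - redMod k (p i).1) * coord n k s (m' - redMod k (p i).1))
  simp only [toeplitzCoeff_expi]
  rw [Finset.sum_eq_single (m' - redMod k (p i).1)]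
  · rw [if_pos rfl, mul_assoc]
  · intro m _ hm
    rw [if_neg hm, mul_zero, zero_mul]
  · simp

lemma tsum_smul_weyl_mul {n k : ℕ} [NeZero k] {c d : Lat n → ℂ} (hc : Summable fun p => ‖c p‖)
    (hd : Summable fun p => ‖d p‖) :
    (∑' p, c p • weyl k p) * ∑' q, d q • weyl k q = ∑' z : Lat n × Lat n,
      (c z.1 * d z.2 * expi (∑ i, (z.1.2 i : ℝ) * z.2.1 i / k)) • weyl k (z.1 + z.2) := by
  rw [tsum_mul_tsum_of_summable_norm (f := fun p => c p • weyl k p) (g := fun q => d q • weyl k q)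
    (summable_smul_weyl (fun p => p) hc) (summable_smul_weyl (fun p => p) hd)]
  refine tsum_congr fun z => ?_
  rw [smul_mul_smul_comm, weyl_mul, smul_smul]

/-! ### The symbol of the star product -/

/-- The Taylor polynomial of degree `< M` of the exponential function. -/
def expTaylor (M : ℕ) (z : ℂ) : ℂ := ∑ j ∈ Finset.range M, z ^ j / j.factorial

/-- On the imaginary axis the Taylor remainder of `exp` is bounded by a power, without the
exponential factor that appears off the axis. -/
lemma norm_exp_sub_expTaylor_le (M : ℕ) (t : ℝ) :
    ‖Complex.exp (t * Complex.I) - expTaylor M (t * Complex.I)‖ ≤ |t| ^ M := by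
  induction M generalizing t with
  | zero => simp [expTaylor, Complex.norm_exp_ofReal_mul_I]
  | succ M ih =>
    have hline : ∀ s : ℝ, HasDerivAt (fun s : ℝ => (s : ℂ) * Complex.I) Complex.I s := fun s => by
      simpa using (Complex.ofRealCLM.hasDerivAt (x := s)).mul_const Complex.I
    have hT : ∀ s : ℝ, HasDerivAt (fun s : ℝ => expTaylor (M + 1) (s * Complex.I))
        (expTaylor M (s * Complex.I) * Complex.I) s := fun s => by
      have e : ∀ z, expTaylor (M + 1) z
          = ∑ j ∈ Finset.range M, z ^ (j + 1) / (j + 1).factorial + 1 := fun z => by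
        rw [expTaylor, Finset.sum_range_succ']
        simp
      simp only [e]
      rw [expTaylor, Finset.sum_mul]
      refine HasDerivAt.add_const _ (HasDerivAt.fun_sum fun j _ => ?_)
      convert! ((hline s).pow (j + 1)).div_const ((j + 1).factorial : ℂ) using 1
      have hj : ((j : ℂ) + 1) ≠ 0 := by exact_mod_cast Nat.succ_ne_zero j
      have hf : (j.factorial : ℂ) ≠ 0 := by exact_mod_cast j.factorial_ne_zero
      rw [Nat.factorial_succ]
      push_cast
      field_simp
    have hd : ∀ s : ℝ, HasDerivAt
        (fun s : ℝ => Complex.exp (s * Complex.I) - expTaylor (M + 1) (s * Complex.I))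
        ((Complex.exp (s * Complex.I) - expTaylor M (s * Complex.I)) * Complex.I) s := fun s => by
      rw [sub_mul]
      exact (hline s).cexp.sub (hT s)
    have h := Convex.norm_image_sub_le_of_norm_hasDerivWithin_le (s := Set.uIcc 0 t)
      (C := |t| ^ M) (fun s _ => (hd s).hasDerivWithinAt) (fun s hs => by
        rw [norm_mul, Complex.norm_I, mul_one]
        refine (ih s).trans (pow_le_pow_left₀ (abs_nonneg _) ?_ _)
        simpa using Set.abs_sub_left_of_mem_uIcc hs) (convex_uIcc 0 t) Set.left_mem_uIcc
      Set.right_mem_uIcc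
    simpa [expTaylor, Finset.sum_range_succ', pow_succ] using h

lemma latDot_add_left {n : ℕ} (p q : Lat n) (u : Vec n) :
    latDot (p + q) u = latDot p u + latDot q u := by
  simp only [latDot, Prod.fst_add, Prod.snd_add, Pi.add_apply, Int.cast_add, add_mul,
    Finset.sum_add_distrib]
  ring

/-- The pairing `b·a'` of the frequencies `p = (a, b)` and `q = (a', b')`. -/
def cross {n : ℕ} (p q : Lat n) : ℝ := ∑ i, (p.2 i : ℝ) * q.1 i

lemma one_add_sq_le_weight {n : ℕ} (p : Lat n) (i : Fin n) :
    1 + (p.1 i : ℝ) ^ 2 ≤ weight p ∧ 1 + (p.2 i : ℝ) ^ 2 ≤ weight p := by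
  have h1 : ∀ a : Fin n → ℤ, 1 + (a i : ℝ) ^ 2 ≤ ∏ i, (1 + (a i : ℝ) ^ 2) := fun a => by
    have h := Finset.prod_le_prod (s := Finset.univ)
      (f := fun l => if l = i then 1 + (a l : ℝ) ^ 2 else 1) (g := fun l => 1 + (a l : ℝ) ^ 2)
      (fun l _ => by split_ifs <;> positivity)
      (fun l _ => by split_ifs <;> nlinarith [sq_nonneg (a l : ℝ)])
    simpa using h
  have h2 : ∀ a : Fin n → ℤ, 1 ≤ ∏ i, (1 + (a i : ℝ) ^ 2) := fun a =>
    le_trans (by nlinarith [sq_nonneg (a i : ℝ)]) (h1 a)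
  constructor
  · exact (h1 p.1).trans (le_mul_of_one_le_right (zero_le_one.trans (h2 p.1)) (h2 p.2))
  · exact (h1 p.2).trans (le_mul_of_one_le_left (zero_le_one.trans (h2 p.2)) (h2 p.1))

lemma abs_cross_le {n : ℕ} (p q : Lat n) : |cross p q| ≤ n * (weight p * weight q) := by
  have h : ∀ x : ℝ, |x| ≤ 1 + x ^ 2 := fun x => by
    rw [← sq_abs x]; nlinarith [sq_nonneg (|x| - 1), abs_nonneg x]
  refine (Finset.abs_sum_le_sum_abs _ _).trans ?_
  refine (Finset.sum_le_card_nsmul _ _ (weight p * weight q) fun i _ => ?_).trans (by simp)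
  rw [abs_mul]
  exact mul_le_mul ((h _).trans (one_add_sq_le_weight p i).2)
    ((h _).trans (one_add_sq_le_weight q i).1) (abs_nonneg _) (weight_pos p).le

/-- The phase `b·a'/k` of the Weyl relation, as the argument of `exp`. -/
lemma expi_cross {n k : ℕ} (p q : Lat n) :
    expi (∑ i, (p.2 i : ℝ) * q.1 i / k)
      = Complex.exp ((2 * Real.pi * (1 / (k : ℝ)) * cross p q : ℝ) * Complex.I) := by
  rw [expi, ← Finset.sum_div, cross]
  congr 1
  push_cast
  ring

lemma hasSum_fourierCoef_mul {n : ℕ} (f g : smoothTorus n) (u : Vec n) :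
    HasSum (fun z : Lat n × Lat n => fourierCoef f.1 z.1 * fourierCoef g.1 z.2 *
      expi (latDot (z.1 + z.2) u)) (f.1 u * g.1 u) := by
  have hn : ∀ (h : smoothTorus n), Summable fun p => ‖fourierCoef h.1 p * expi (latDot p u)‖ :=
    fun h => by simpa only [norm_mul, norm_expi, mul_one] using summable_fourierCoef h
  have hs := summable_mul_of_summable_norm (f := fun p => fourierCoef f.1 p * expi (latDot p u))
    (g := fun p => fourierCoef g.1 p * expi (latDot p u)) (hn f) (hn g)
  have h := HasSum.mul (hasSum_fourierCoef f u) (hasSum_fourierCoef g u) hs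
  refine h.congr_fun fun z => ?_
  rw [latDot_add_left, expi_add]
  ring

lemma fourierCoef_partials_ey {n j : ℕ} (i : Fin j → Fin n) (f : smoothTorus n) (p : Lat n) :
    fourierCoef (partials (fun l => ey (i l)) f).1 p
      = (2 * Real.pi * Complex.I) ^ j * (∏ l, (p.2 (i l) : ℂ)) * fourierCoef f.1 p := by
  rw [fourierCoef_partials j _ (fun l => Or.inl rfl), Finset.prod_mul_distrib]
  simp only [latDot_ey, Finset.prod_const, Finset.card_univ, Fintype.card_fin,
    Complex.ofReal_intCast]

lemma fourierCoef_partials_ex {n j : ℕ} (i : Fin j → Fin n) (f : smoothTorus n) (p : Lat n) :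
    fourierCoef (partials (fun l => ex (i l)) f).1 p
      = (2 * Real.pi * Complex.I) ^ j * (∏ l, (p.1 (i l) : ℂ)) * fourierCoef f.1 p := by
  rw [fourierCoef_partials j _ (fun l => Or.inr rfl), Finset.prod_mul_distrib]
  simp only [latDot_ex, Finset.prod_const, Finset.card_univ, Fintype.card_fin,
    Complex.ofReal_intCast]

lemma cross_pow {n : ℕ} (j : ℕ) (p q : Lat n) :
    (cross p q : ℂ) ^ j = ∑ i : Fin j → Fin n, (∏ l, (p.2 (i l) : ℂ)) * ∏ l, (q.1 (i l) : ℂ) := by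
  simp only [← Finset.prod_mul_distrib]
  rw [← Fintype.sum_pow (fun i => (p.2 i : ℂ) * (q.1 i : ℂ)), cross]
  push_cast
  rfl

lemma starTerm_apply {n : ℕ} (j : ℕ) (f g : smoothTorus n) (u : Vec n) :
    (starTerm j f g).1 u = 1 / ((j.factorial : ℂ) * (2 * Real.pi * Complex.I) ^ j) *
      ∑ i : Fin j → Fin n, (partials (fun l => ey (i l)) f).1 u
        * (partials (fun l => ex (i l)) g).1 u := by
  rw [starTerm, Submodule.coe_smul, Submodule.coe_sum, Pi.smul_apply, Finset.sum_apply, smul_eq_mul]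
  rfl

/-- The Fourier series of `C_j(f,g)`: its symbol is `(2πi b·a')^j / j!`, by the multinomial expansion
of `(b·a')^j`. -/
lemma hasSum_starTerm {n : ℕ} (j : ℕ) (f g : smoothTorus n) (u : Vec n) :
    HasSum (fun z : Lat n × Lat n => fourierCoef f.1 z.1 * fourierCoef g.1 z.2 *
      ((2 * Real.pi * Complex.I * cross z.1 z.2) ^ j / j.factorial) *
      expi (latDot (z.1 + z.2) u)) ((starTerm j f g).1 u) := by
  rw [starTerm_apply]
  have h1 := (hasSum_sum (s := Finset.univ) fun (i : Fin j → Fin n) _ =>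
    hasSum_fourierCoef_mul (partials (fun l => ey (i l)) f) (partials (fun l => ex (i l)) g)
      u).mul_left (1 / ((j.factorial : ℂ) * (2 * Real.pi * Complex.I) ^ j))
  refine h1.congr_fun fun z => ?_
  have hpi : (2 * Real.pi * Complex.I : ℂ) ≠ 0 := Complex.two_pi_I_ne_zero
  have hj : (j.factorial : ℂ) ≠ 0 := by exact_mod_cast j.factorial_ne_zero
  simp only [fourierCoef_partials_ey, fourierCoef_partials_ex]
  rw [mul_pow, cross_pow, eq_comm, one_div, inv_mul_eq_iff_eq_mul₀
    (mul_ne_zero hj (pow_ne_zero j hpi)), Finset.mul_sum]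
  simp only [Finset.sum_div, Finset.mul_sum, Finset.sum_mul]
  refine Finset.sum_congr rfl fun i _ => ?_
  field_simp

/-- The Fourier series of the truncated star product: its symbol is the Taylor polynomial of the
phase in the Weyl relation. -/
lemma hasSum_starTrunc {n : ℕ} (N : ℕ) (hbar : ℝ) (f g : smoothTorus n) (u : Vec n) :
    HasSum (fun z : Lat n × Lat n => fourierCoef f.1 z.1 * fourierCoef g.1 z.2 *
      expTaylor (N + 1) ((2 * Real.pi * hbar * cross z.1 z.2 : ℝ) * Complex.I) *
      expi (latDot (z.1 + z.2) u)) ((starTrunc N hbar f g).1 u) := by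
  have h1 := hasSum_sum (s := Finset.range (N + 1)) fun j _ =>
    (hasSum_starTerm j f g u).mul_left ((hbar : ℂ) ^ j)
  have hval : (starTrunc N hbar f g).1 u
      = ∑ j ∈ Finset.range (N + 1), (hbar : ℂ) ^ j * (starTerm j f g).1 u := by
    rw [starTrunc, Submodule.coe_sum, Finset.sum_apply]
    rfl
  rw [hval]
  refine h1.congr_fun fun z => ?_
  rw [expTaylor, Finset.mul_sum, Finset.sum_mul]
  refine Finset.sum_congr rfl fun j _ => ?_
  have e : ((2 * Real.pi * hbar * cross z.1 z.2 : ℝ) * Complex.I : ℂ)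
      = hbar * (2 * Real.pi * Complex.I * cross z.1 z.2) := by
    push_cast; ring
  rw [e, mul_pow]
  ring

/-! ### The operator estimate -/

/-- The norm estimate, with the bound `∑_{p,q} |f̂_p ĝ_q| (2π n w(p) w(q))^{N+1} + 1`, `w = weight`,
which does not depend on `k`. -/
lemma exists_opNormLE {n : ℕ} (f g : smoothTorus n) (N : ℕ) :
    ∃ K : ℝ, 0 < K ∧ ∀ (k : ℕ) [NeZero k], OpNormLE (sigmaInner n k)
      (toeplitz n k f * toeplitz n k g - toeplitz n k (starTrunc N (1 / (k : ℝ)) f g))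
      (K * (1 / (k : ℝ)) ^ (N + 1)) := by
  let F : Lat n × Lat n → ℝ := fun z => (2 * Real.pi * n) ^ (N + 1) *
    ((weight z.1 ^ (N + 1) * ‖fourierCoef f.1 z.1‖) * (weight z.2 ^ (N + 1) * ‖fourierCoef g.1 z.2‖))
  have hnn : ∀ (h : smoothTorus n) (p : Lat n), 0 ≤ weight p ^ (N + 1) * ‖fourierCoef h.1 p‖ :=
    fun h p => by have := weight_pos p; positivity
  have hF : Summable F := ((summable_weight_pow_fourierCoef (N + 1) f).mul_of_nonneg
    (summable_weight_pow_fourierCoef (N + 1) g) (hnn f) (hnn g)).mul_left _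
  have hF0 : ∀ z, 0 ≤ F z := fun z =>
    mul_nonneg (by positivity) (mul_nonneg (hnn f _) (hnn g _))
  -- the summand `1` only serves to make the constant positive
  refine ⟨∑' z, F z + 1, by linarith [tsum_nonneg (L := .unconditional _) hF0], fun k _ s => ?_⟩
  let fg : Lat n × Lat n → ℂ := fun z => fourierCoef f.1 z.1 * fourierCoef g.1 z.2
  let θ : Lat n × Lat n → ℝ := fun z => 2 * Real.pi * (1 / (k : ℝ)) * cross z.1 z.2
  have hfg : Summable fun z => ‖fg z‖ := by
    simpa [fg] using (summable_fourierCoef f).mul_of_nonneg (summable_fourierCoef g)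
      (fun _ => norm_nonneg _) (fun _ => norm_nonneg _)
  have hrem : ∀ z, ‖fg z * (Complex.exp (θ z * Complex.I) - expTaylor (N + 1) (θ z * Complex.I))‖
      ≤ F z * (1 / (k : ℝ)) ^ (N + 1) := fun z => by
    have h1 : |θ z| ≤ 2 * Real.pi * (1 / (k : ℝ)) * (n * (weight z.1 * weight z.2)) := by
      rw [abs_mul, abs_of_nonneg (by positivity : (0 : ℝ) ≤ 2 * Real.pi * (1 / (k : ℝ)))]
      exact mul_le_mul_of_nonneg_left (abs_cross_le _ _) (by positivity)
    rw [norm_mul]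
    calc _ ≤ ‖fg z‖ * (2 * Real.pi * (1 / (k : ℝ)) * (n * (weight z.1 * weight z.2))) ^ (N + 1) :=
          mul_le_mul_of_nonneg_left ((norm_exp_sub_expTaylor_le _ _).trans
            (pow_le_pow_left₀ (abs_nonneg _) h1 _)) (norm_nonneg _)
      _ = _ := by
          simp only [F, fg, norm_mul, mul_pow]
          ring
  have hexp : Summable fun z => ‖fg z * Complex.exp (θ z * Complex.I)‖ := by
    simpa [Complex.norm_exp_ofReal_mul_I] using hfg
  have hsub : Summable fun z =>
      ‖fg z * (Complex.exp (θ z * Complex.I) - expTaylor (N + 1) (θ z * Complex.I))‖ :=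
    (hF.mul_right _).of_nonneg_of_le (fun _ => norm_nonneg _) hrem
  have hpol : Summable fun z => ‖fg z * expTaylor (N + 1) (θ z * Complex.I)‖ :=
    (hexp.add hsub).of_nonneg_of_le (fun _ => norm_nonneg _) fun z => by
      refine le_trans (le_of_eq ?_) (norm_sub_le _ _)
      congr 1
      ring
  have hprod : (∑' p, fourierCoef f.1 p • weyl k p) * (∑' q, fourierCoef g.1 q • weyl k q)
      = ∑' z, (fg z * Complex.exp (θ z * Complex.I)) • weyl k (z.1 + z.2) := by
    rw [tsum_smul_weyl_mul (summable_fourierCoef f) (summable_fourierCoef g)]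
    refine tsum_congr fun z => ?_
    rw [expi_cross]
  have hcoord : coord n k ((toeplitz n k f * toeplitz n k g
        - toeplitz n k (starTrunc N (1 / (k : ℝ)) f g)) s)
      = (∑' z, (fg z * (Complex.exp (θ z * Complex.I) - expTaylor (N + 1) (θ z * Complex.I))) •
          weyl k (z.1 + z.2)) (coord n k s) := by
    rw [LinearMap.sub_apply, Module.End.mul_apply, map_sub,
      coord_toeplitz (fun p => p) (summable_fourierCoef f) f (hasSum_fourierCoef f),
      coord_toeplitz (fun p => p) (summable_fourierCoef g) g (hasSum_fourierCoef g),
      coord_toeplitz (fun z : Lat n × Lat n => z.1 + z.2) hpol _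
        (hasSum_starTrunc N (1 / (k : ℝ)) f g)]
    change ((∑' p, fourierCoef f.1 p • weyl k p) * (∑' q, fourierCoef g.1 q • weyl k q))
      (coord n k s) - _ = _
    have hs1 := (summable_smul_weyl (k := k) (fun z : Lat n × Lat n => z.1 + z.2) hexp).of_norm
    have hs2 := (summable_smul_weyl (k := k) (fun z : Lat n × Lat n => z.1 + z.2) hpol).of_norm
    rw [hprod, ← sub_apply, ← hs1.tsum_sub hs2]
    simp only [← sub_smul, mul_sub]
  rw [normOf_sigmaInner, normOf_sigmaInner, hcoord]
  refine (ContinuousLinearMap.le_opNorm _ _).trans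
    (mul_le_mul_of_nonneg_right ?_ (norm_nonneg _))
  refine (tsum_of_norm_bounded (hF.hasSum.mul_right _) fun z => ?_).trans
    (mul_le_mul_of_nonneg_right (by linarith) (by positivity))
  rw [norm_smul]
  exact (mul_le_of_le_one_right (norm_nonneg _) (norm_weyl_le _)).trans (hrem z)

end RealToeplitz

end

theorem theorem1p1 (n : ℕ) :
    ∃ (Q : (k : ℕ) → [NeZero k] → RealToeplitz.smoothTorus n →
        Module.End ℂ (RealToeplitz.quantumSpace n k))
      (B : (k : ℕ) → [NeZero k] → InnerProductSpace.Core ℂ (RealToeplitz.quantumSpace n k)),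
      -- the Toeplitz-type operators are well defined
      (∀ (k : ℕ) [NeZero k] (f : RealToeplitz.smoothTorus n)
        (A : Module.End ℂ (RealToeplitz.quantumSpace n k)),
        RealToeplitz.IsToeplitz f A ↔ A = Q k f) ∧
      -- the inner product on the quantum Hilbert space is well defined
      (∀ (k : ℕ) [NeZero k] (B' : InnerProductSpace.Core ℂ (RealToeplitz.quantumSpace n k)),
        RealToeplitz.IsBKSInner B' ↔ B' = B k) ∧
      -- the norm estimate, uniform in `k`, with `ħ = 1/k`
      ∀ (f g : RealToeplitz.smoothTorus n) (N : ℕ), ∃ K : ℝ, 0 < K ∧ ∀ (k : ℕ) [NeZero k],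
        RealToeplitz.OpNormLE (B k)
          (Q k f * Q k g - Q k (RealToeplitz.starTrunc N (1 / (k : ℝ)) f g))
          (K * (1 / (k : ℝ)) ^ (N + 1)) :=
  ⟨fun k _ f => RealToeplitz.toeplitz n k f, fun k _ => RealToeplitz.sigmaInner n k,
    fun _ _ f A => RealToeplitz.isToeplitz_iff f A, fun _ _ B => RealToeplitz.isBKSInner_iff B,
    RealToeplitz.exists_opNormLE⟩
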